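/- Let $\kappa\in\mathbb R$ and $R>0$ satisfy $R^2|\kappa|<1$, and let $M=\{z\in\mathbb C:|z|\le R\}$ carry the metric $g=(1+\kappa|z|^2)^{-2}|dz|^2$ (curvature $4\kappa$), with area measure $dVol$. Let $\partial_+SM$ be the manifold of inward unit vectors at boundary points, with fan-beam coordinates $(\beta,\alpha)\in\mathbb S^1\times(-\tfrac\pi2,\tfrac\pi2)$ (the point is $Re^{i\beta}$, the vector is $(1+\kappa R^2)e^{i(\beta+\pi+\alpha)}$), and with the measure $d\Sigma^2=\frac{R}{1+\kappa R^2}\,d\beta\,d\alpha$. The geodesic X-ray transform $I_0f(\beta,\alpha)=\int_0^{\tau}f(\gamma_{\beta,\alpha}(t))\,dt$, where $\gamma_{\beta,\alpha}$ is the unit-speed geodesic with these initial data and $\tau$ its exit time, extends uniquely from $C(M)$ to a bounded operator $I_0:L^2(M,dVol)\to L^2(\partial_+SM,d\Sigma^2)$; let $I_0^*$ be its adjoint. Put $$w(z)=\frac{1+\kappa|z|^2}{1-\kappa|z|^2},\qquad \Phi(z)=\frac{1-\kappa R^2}{1-\kappa|z|^2}\,\frac zR,\qquad \mathcal L=w\,\Phi^*\,\mathcal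 L_e\,(\Phi^{-1})^*\,\frac1w,$$ where $\Phi$ is a diffeomorphism of $M$ onto the closed unit disk and, in polar coordinates on the unit disk, $$\mathcal L_e=-\Big((1-\rho^2)\partial_\rho^2+\big(\tfrac1\rho-3\rho\big)\partial_\rho+\tfrac1{\rho^2}\partial_\omega^2\Big)+1 .$$ The eigenfunctions of $\mathcal L$ in $C^\infty(M)$ (smooth up to the boundary) have positive eigenvalues and are total in $L^2(M,w\,dVol)$; real powers of $\mathcal L$ are defined by expansion in these eigenfunctions. For $s\ge0$ let $\widetilde H^s(M)=\{f\in L^2(M,w\,dVol):\ \mathcal L^{s/2}f\in L^2(M,w\,dVol)\}$. For $s<0$ let $\widetilde H^s(M)$ be the space of linear functionals $u$ on $C^\infty(M)$ with $\mathcal L^{s/2}u\in L^2(M,w\,dVol)$, i.e. such that for some $g\in L^2(M,w\,dVol)$, $u(\varphi)=\int_M g\,(\mathcal L^{-s/2}\varphi)\,w\,dVol$ for all $\varphi\in C^\infty(M)$. Functions $f\in L^2(M,w\,dVol)$ are identified with the functionals $\varphi\mapsto\int_M f\varphi\,w\,dVol$. Then the operator $I_0^*I_0w:f\mapsto I_0^*I_0(wf)$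 maps $C^\infty(M)$ into itself, its transpose for this pairing extends $I_0^*I_0w$ from $L^2(M,w\,dVol)$ to the functionals on $C^\infty(M)$, and with this extension $$I_0^*I_0w\,\big(\widetilde H^s(M)\big)=\widetilde H^{s+1}(M)\quad\text{for all } s\in\mathbb R .$$ Moreover, $$I_0^*I_0\,\big(C^\infty(M)\big)=C^\infty(M).$$ -/

import Mathlib

open MeasureTheory Metric
open scoped ContDiff

noncomputable section

namespace XrayDisk

/-! The surface `M` is the closed disk `{z : ℂ | ‖z‖ ≤ R}` with the metric
`(1 + κ ‖z‖ ^ 2) ^ (-2) |dz| ^ 2`, of curvature `4 κ`. -/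

/-- The Riemannian area measure of `M`, as a measure on `ℂ` carried by the disk. -/
def vol (κ R : ℝ) : Measure ℂ :=
  (volume.restrict (closedBall (0 : ℂ) R)).withDensity
    (fun z => ENNReal.ofReal (((1 + κ * ‖z‖ ^ 2) ^ 2)⁻¹))

/-- The weight `w`. -/
def weight (κ : ℝ) (z : ℂ) : ℝ := (1 + κ * ‖z‖ ^ 2) / (1 - κ * ‖z‖ ^ 2)

/-- The measure `w dVol` on `M`. -/
def wvol (κ R : ℝ) : Measure ℂ :=
  (vol κ R).withDensity (fun z => ENNReal.ofReal (weight κ z))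

/-- The measure `dΣ² = R / (1 + κ R ^ 2) dβ dα` on the inward unit tangent vectors at boundary
points, in fan-beam coordinates `(β, α)`: the point is `R e^{iβ}` and the vector makes the angle
`α ∈ (-π/2, π/2)` with the inner normal. -/
def bdryMeasure (κ R : ℝ) : Measure (ℝ × ℝ) :=
  ENNReal.ofReal (R / (1 + κ * R ^ 2)) •
    (volume.restrict
      (Set.Ioc 0 (2 * Real.pi) ×ˢ Set.Ioo (-(Real.pi / 2)) (Real.pi / 2)) : Measure (ℝ × ℝ))

/-- `γ`, on `[0, τ]`, is the maximal unit-speed geodesic in `M` issued from the inward vector with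
fan-beam coordinates `(β, α)`, and `τ` is its exit time. For the conformal metric
`e^{2φ} |dz| ^ 2` the geodesic equation is `z'' + 2 (∂φ/∂z) z' ^ 2 = 0`; here
`φ = - log (1 + κ |z| ^ 2)`. The speed is constant along solutions, and it is `1` at time `0`. -/
structure IsChord (κ R β α τ : ℝ) (γ : ℝ → ℂ) : Prop where
  pos : 0 < τ
  start : γ 0 = R * Complex.exp (β * Complex.I)
  geodesic : ∃ γ' : ℝ → ℂ,
    γ' 0 = (1 + κ * R ^ 2) * Complex.exp ((β + Real.pi + α) * Complex.I) ∧
    ∀ t ∈ Set.Icc 0 τ, HasDerivWithinAt γ (γ' t) (Set.Icc 0 τ) t ∧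
      HasDerivWithinAt γ'
        (2 * κ * (starRingEnd ℂ) (γ t) * (γ' t) ^ 2 / (1 + κ * ‖γ t‖ ^ 2)) (Set.Icc 0 τ) t
  inside : ∀ t ∈ Set.Ioo 0 τ, ‖γ t‖ < R
  exit : ‖γ τ‖ = R

open Classical in
/-- The geodesic X-ray transform of a function, in fan-beam coordinates. The exit time and the
geodesic up to it are determined by the initial vector. -/
def xray (κ R : ℝ) (f : ℂ → ℂ) (p : ℝ × ℝ) : ℂ :=
  if h : ∃ c : ℝ × (ℝ → ℂ), IsChord κ R p.1 p.2 c.1 c.2 then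
    ∫ t in (0 : ℝ)..h.choose.1, f (h.choose.2 t)
  else 0

/-- `L²(M, dVol)`. -/
abbrev L2M (κ R : ℝ) := Lp ℂ 2 (vol κ R)

/-- `L²(∂₊SM, dΣ²)`. -/
abbrev L2Bdry (κ R : ℝ) := Lp ℂ 2 (bdryMeasure κ R)

/-- `I₀` is the X-ray transform as a bounded operator `L²(M, dVol) → L²(∂₊SM, dΣ²)`: it is given
by integration along geodesics on the (dense) set of functions continuous on `M`. -/
def IsXrayL2 (κ R : ℝ) (I₀ : L2M κ R →L[ℂ] L2Bdry κ R) : Prop :=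
  ∀ f : ℂ → ℂ, ContinuousOn f (closedBall (0 : ℂ) R) → ∀ F : L2M κ R, F =ᵐ[vol κ R] f →
    I₀ F =ᵐ[bdryMeasure κ R] xray κ R f

/-- `I₀* I₀`, with the Hilbert space adjoint. -/
def normalOp {κ R : ℝ} (I₀ : L2M κ R →L[ℂ] L2Bdry κ R) : L2M κ R →L[ℂ] L2M κ R :=
  (ContinuousLinearMap.adjoint I₀).comp I₀

/-- `C^∞(M)`: functions on the closed disk, smooth up to the boundary. A function on `M` is
represented by its extension by zero to `ℂ`, so that equality is equality on `M`. -/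
def SmoothM (R : ℝ) : Submodule ℂ (ℂ → ℂ) where
  carrier := {f | ContDiffOn ℝ ∞ f (closedBall (0 : ℂ) R) ∧ ∀ z ∉ closedBall (0 : ℂ) R, f z = 0}
  add_mem' := by
    rintro f g ⟨hf, hf'⟩ ⟨hg, hg'⟩
    exact ⟨hf.add hg, fun z hz => by simp [hf' z hz, hg' z hz]⟩
  zero_mem' := ⟨contDiffOn_const, fun _ _ => rfl⟩
  smul_mem' := by
    rintro c f ⟨hf, hf'⟩
    exact ⟨contDiffOn_const.smul hf, fun z hz => by simp [hf' z hz]⟩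

/-- `C^∞(M)` as a subset of `L²(M, dVol)`. -/
def smoothL2 (κ R : ℝ) : Set (L2M κ R) :=
  {F | ∃ φ : SmoothM R, F =ᵐ[vol κ R] (φ : ℂ → ℂ)}

/-- The diffeomorphism `Φ` from `M` onto the closed unit disk. -/
def Phi (κ R : ℝ) (z : ℂ) : ℂ := (((1 - κ * R ^ 2) / (1 - κ * ‖z‖ ^ 2) : ℝ) : ℂ) * (z / R)

/-- The inverse of `Φ`. -/
def PhiInv (κ R : ℝ) (ζ : ℂ) : ℂ :=
  ((2 / (1 + Real.sqrt (1 + 4 * κ * (R / (1 - κ * R ^ 2) * ‖ζ‖) ^ 2)) : ℝ) : ℂ) *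
    (((R / (1 - κ * R ^ 2) : ℝ) : ℂ) * ζ)

theorem PhiInv_Phi {κ R : ℝ} (hR : 0 < R) (h : R ^ 2 * |κ| < 1) {z : ℂ} (hz : ‖z‖ ≤ R) :
    PhiInv κ R (Phi κ R z) = z := by
  have hz2 : ‖z‖ ^ 2 ≤ R ^ 2 := by gcongr
  have hk : ∀ t : ℝ, 0 ≤ t → t ≤ R ^ 2 → |κ * t| < 1 := fun t h0 ht => by
    rw [abs_mul, abs_of_nonneg h0]
    nlinarith [abs_nonneg κ]
  have h1 := abs_lt.1 (hk _ (sq_nonneg ‖z‖) hz2)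
  have h2 := abs_lt.1 (hk _ (sq_nonneg R) le_rfl)
  have hd : 0 < 1 - κ * ‖z‖ ^ 2 := by linarith
  have hD : 0 < 1 - κ * R ^ 2 := by linarith
  have hn : R / (1 - κ * R ^ 2) * ‖Phi κ R z‖ = ‖z‖ / (1 - κ * ‖z‖ ^ 2) := by
    simp only [Phi, norm_mul, norm_div, Complex.norm_real, Real.norm_eq_abs, abs_of_pos hD,
      abs_of_pos hd, abs_of_pos hR]
    rw [div_mul_div_comm, div_mul_div_comm, div_eq_div_iff (by positivity) hd.ne']
    ring
  have hs : 1 + 4 * κ * (‖z‖ / (1 - κ * ‖z‖ ^ 2)) ^ 2 =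
      ((1 + κ * ‖z‖ ^ 2) / (1 - κ * ‖z‖ ^ 2)) ^ 2 := by
    field_simp
    ring
  have hr : 2 / (1 + (1 + κ * ‖z‖ ^ 2) / (1 - κ * ‖z‖ ^ 2)) = 1 - κ * ‖z‖ ^ 2 := by
    field_simp
    ring
  have hRc : (R : ℂ) ≠ 0 := by exact_mod_cast hR.ne'
  have hdc : ((1 - κ * ‖z‖ ^ 2 : ℝ) : ℂ) ≠ 0 := by exact_mod_cast hd.ne'
  have hDc : ((1 - κ * R ^ 2 : ℝ) : ℂ) ≠ 0 := by exact_mod_cast hD.ne'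
  rw [PhiInv, hn, hs, Real.sqrt_sq (div_nonneg (by linarith) hd.le), hr, Phi,
    Complex.ofReal_div, Complex.ofReal_div]
  field_simp

/-- The reference operator on the unit disk, in polar coordinates `z = ρ e^{iω}`, `0 < ρ < 1`:
`- ((1 - ρ²) ∂ρ² + (1/ρ - 3ρ) ∂ρ + ρ⁻² ∂ω²) + 1`. -/
def opLe (u : ℂ → ℂ) (z : ℂ) : ℂ :=
  -((1 - ‖z‖ ^ 2 : ℝ) * iteratedDeriv 2 (fun r : ℝ => u (r * (z / ‖z‖))) ‖z‖
    + (1 / ‖z‖ - 3 * ‖z‖ : ℝ) * deriv (fun r : ℝ => u (r * (z / ‖z‖))) ‖z‖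
    + (1 / ‖z‖ ^ 2 : ℝ) * iteratedDeriv 2 (fun t : ℝ => u (z * Complex.exp (t * Complex.I))) 0)
    + u z

/-- The operator `𝓛 = w Φ^* 𝓛ₑ (Φ⁻¹)^* w⁻¹`, at the points `0 < ‖z‖ < R`. -/
def opL (κ R : ℝ) (u : ℂ → ℂ) (z : ℂ) : ℂ :=
  weight κ z * opLe (fun ζ => u (PhiInv κ R ζ) / weight κ (PhiInv κ R ζ)) (Phi κ R z)

/-- `e ∈ C^∞(M)` satisfies `𝓛 e = lam e` (on the interior without the pole of the polar
coordinates, hence wherever one likes, by continuity). -/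
def IsEigen (κ R lam : ℝ) (e : SmoothM R) : Prop :=
  ∀ z : ℂ, 0 < ‖z‖ → ‖z‖ < R → opL κ R e z = lam * (e : ℂ → ℂ) z

/-- The bilinear pairing of `L²(M, w dVol)`. -/
def pair (κ R : ℝ) (f g : ℂ → ℂ) : ℂ := ∫ z, f z * g z ∂(wvol κ R)

/-- The spectral resolution of `𝓛` on `L²(M, w dVol)` by smooth eigenfunctions: the eigenvalues are
positive, and the smooth eigenfunctions are total. -/
def HasSpectralResolution (κ R : ℝ) : Prop :=
  (∀ (lam : ℝ) (e : SmoothM R), IsEigen κ R lam e → e ≠ 0 → 0 < lam) ∧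
  ∀ g : ℂ → ℂ, MemLp g 2 (wvol κ R) →
    (∀ (lam : ℝ) (e : SmoothM R), IsEigen κ R lam e → pair κ R g e = 0) → g =ᵐ[wvol κ R] 0

/-- `g = 𝓛^a f` for the functional calculus of `𝓛`: the component of `g` along each eigenfunction is
that of `f`, multiplied by the power of the eigenvalue. The eigenspaces are stable under complex
conjugation, so that the bilinear pairing may be used. -/
def IsPow (κ R a : ℝ) (f g : ℂ → ℂ) : Prop :=
  ∀ (lam : ℝ) (e : SmoothM R), IsEigen κ R lam e →
    pair κ R g e = ((lam ^ a : ℝ) : ℂ) * pair κ R f e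

/-- Linear functionals on `C^∞(M)`, the ambient space of the scale. -/
abbrev Distr (R : ℝ) := Module.Dual ℂ (SmoothM R)

/-- The functional `u` is the function `f`, through the pairing of `L²(M, w dVol)`. -/
def Represents (κ R : ℝ) (f : ℂ → ℂ) (u : Distr R) : Prop :=
  ∀ φ : SmoothM R, u φ = pair κ R f φ

/-- The Hilbert scale of `𝓛`. For `s ≥ 0` it consists of the `f ∈ L²(M, w dVol)` with
`𝓛^{s/2} f ∈ L²(M, w dVol)`. For `s < 0` it consists of the functionals `u` with
`𝓛^{s/2} u = g ∈ L²(M, w dVol)`, that is, `u φ = ⟨g, 𝓛^{-s/2} φ⟩` for all `φ ∈ C^∞(M)`: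
this is the dual space of that of order `-s`, and the completion of `L²(M, w dVol)` for the norm
`‖𝓛^{s/2} f‖`. -/
def Hscale (κ R s : ℝ) : Set (Distr R) :=
  {u | (0 ≤ s ∧ ∃ f g : ℂ → ℂ, MemLp f 2 (wvol κ R) ∧ MemLp g 2 (wvol κ R) ∧
          IsPow κ R (s / 2) f g ∧ Represents κ R f u) ∨
       (s < 0 ∧ ∃ g : ℂ → ℂ, MemLp g 2 (wvol κ R) ∧
          ∀ (φ : SmoothM R) (ψ : ℂ → ℂ), MemLp ψ 2 (wvol κ R) →
            IsPow κ R (-s / 2) φ ψ → u φ = pair κ R g ψ)}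

/-- `N` is the restriction of `I₀* I₀ w` to an operator of `C^∞(M)`, and its transpose for the
pairing of `L²(M, w dVol)` coincides with `I₀* I₀ w` on `L²(M, w dVol)`. -/
structure IsNormalW {κ R : ℝ} (I₀ : L2M κ R →L[ℂ] L2Bdry κ R)
    (N : SmoothM R →ₗ[ℂ] SmoothM R) : Prop where
  smooth : ∀ φ : SmoothM R, ∃ F : L2M κ R,
    F =ᵐ[vol κ R] (fun z => weight κ z * (φ : ℂ → ℂ) z) ∧
      normalOp I₀ F =ᵐ[vol κ R] (N φ : ℂ → ℂ)
  extends_L2 : ∀ f : ℂ → ℂ, MemLp f 2 (wvol κ R) → ∃ (F : L2M κ R) (u : Distr R),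
    F =ᵐ[vol κ R] (fun z => weight κ z * f z) ∧ Represents κ R f u ∧
      Represents κ R (normalOp I₀ F) (N.dualMap u)

end XrayDisk

end

/-! The operators `𝓛` and `I₀* I₀ w` are diagonal in one and the same explicit basis, and `I₀* I₀ w`
is a positive constant times `𝓛^(-1/2)`. All assertions then become assertions about sequences of
coefficients.

The map `Φ` is projective: it sends the geodesics of `M` to straight chords of the unit disk, and
along a geodesic the affine parameter of the chord has derivative proportional to `w²`
(`isChord_projective`). Hence the X-ray transform of `w² · u ∘ Φ` is, up to a factor depending on
`α` only, the Euclidean chord integral of `u` (`xray_eq_integral_chord`). The weight is also such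
that `u ↦ w · u ∘ Φ` is an isometry, up to a constant, from `L²` of the unit disk onto `L²(M, w
dVol)` (`pair_liftM`).

On the unit disk the basis consists of the ridge polynomials `U_n(⟨x, e^{iδ}⟩)`, `U_n` being the
Chebyshev polynomial of the second kind and `δ = kπ/(n+1)`, `0 ≤ k ≤ n`. In a ridge function `𝓛ₑ`
reduces to the Chebyshev equation, so the eigenvalue is `(n+1)²` (`opLc_ridge`). Chord integrals of
ridges are explicit (`integral_chebU_mul_sin`), and these equispaced directions make the ridges
orthogonal (`integral_ridgeBasis_mul`). Their X-ray transforms are orthogonal too, with squared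
norms proportional to `1/(n+1)` (`integral_xrayBasis_mul`). Together with completeness (a dimension
count and Stone–Weierstrass) this yields the multiplier `const/(n+1)` of `I₀* I₀ w`
(`IsXrayL2.pair_normalOp`).

Smoothness up to the boundary is equivalent to rapid decay of the coefficients. Decay holds because
`𝓛ₑ` is symmetric on smooth functions without any boundary condition, its principal coefficient
degenerating at the circle (`integral_opLc_mul`). The converse follows from polynomial bounds in `n`
for all derivatives of the ridges (`abs_iterate_derivative_U_le`, `contDiffOn_tsum_of_convex`).
Since `const/(n+1)` and its inverse grow at most polynomially, `C^∞(M)` is mapped onto itself; and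
`mem_Hscale_iff` describes the Hilbert scale by weights `(n+1)^(-s)`, on which the multiplier is a
shift by one. -/

noncomputable section

namespace XrayDisk

/-! ### Chebyshev polynomials of the second kind -/

/-- The Chebyshev function of the second kind. -/
def chebU (n : ℕ) (t : ℝ) : ℝ := (Polynomial.Chebyshev.U ℝ n).eval t

theorem chebU_cos_mul_sin (n : ℕ) (θ : ℝ) :
    chebU n (Real.cos θ) * Real.sin θ = Real.sin ((n + 1) * θ) := by
  simp [chebU]

theorem chebU_zero (t : ℝ) : chebU 0 t = 1 := by simp [chebU]

theorem chebU_one (t : ℝ) : chebU 1 t = 2 * t := by simp [chebU]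

theorem chebU_cos_add_two (n : ℕ) (θ : ℝ) :
    chebU (n + 2) (Real.cos θ) = 2 * Real.cos ((n + 2 : ℕ) * θ) + chebU n (Real.cos θ) := by
  have h := Polynomial.Chebyshev.U_eq_two_mul_T_add_U ℝ n
  have h2 := Polynomial.Chebyshev.T_real_cos θ (n + 2)
  simp only [chebU]
  push_cast
  rw [h]
  simp only [Polynomial.eval_add, Polynomial.eval_mul, h2]
  simp

theorem chebU_one_right (n : ℕ) : chebU n 1 = n + 1 := by
  simp [chebU]

theorem chebU_neg (n : ℕ) (t : ℝ) : chebU n (-t) = (-1) ^ n * chebU n t := by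
  simp only [chebU, Polynomial.Chebyshev.U_eval_neg]
  rcases Nat.even_or_odd n with h | h
  · rw [Int.negOnePow_even _ (by exact_mod_cast h), h.neg_one_pow]; simp
  · rw [Int.negOnePow_odd _ (by exact_mod_cast h), h.neg_one_pow]; simp

theorem contDiff_chebU (n : ℕ) : ContDiff ℝ ∞ (chebU n) :=
  (Polynomial.Chebyshev.U ℝ n).contDiff_aeval ∞

theorem continuous_chebU (n : ℕ) : Continuous (chebU n) := (contDiff_chebU n).continuous

theorem iteratedDeriv_chebU (n k : ℕ) (t : ℝ) :
    iteratedDeriv k (chebU n) t =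
      ((Polynomial.derivative^[k]) (Polynomial.Chebyshev.U ℝ n)).eval t := by
  induction k generalizing t with
  | zero => simp [chebU]
  | succ k ih =>
    rw [iteratedDeriv_succ, funext ih, Polynomial.deriv, Function.iterate_succ_apply']

/-- A Markov-type bound; only polynomial growth in `n` matters. From `U_{n+2} = 2 T_{n+2} + U_n` and
`T_{n+2}' = (n+2) U_{n+1}`, the derivative of order `k+1` of `U_{n+2}` is controlled by the
derivative of order `k` of `U_{n+1}` and that of order `k+1` of `U_n`. -/
theorem abs_iterate_derivative_U_le (k n : ℕ) {t : ℝ} (ht : |t| ≤ 1) :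
    |((Polynomial.derivative^[k]) (Polynomial.Chebyshev.U ℝ n)).eval t| ≤
      ((n : ℝ) + 1) ^ (2 * k + 1) := by
  obtain ⟨θ, rfl⟩ : ∃ θ, Real.cos θ = t :=
    ⟨_, Real.cos_arccos (neg_le_of_abs_le ht) (le_of_abs_le ht)⟩
  induction k generalizing n with
  | zero =>
    induction n using Nat.twoStepInduction with
    | zero => simp
    | one => simp; linarith [Real.abs_cos_le_one θ]
    | more n ih _ =>
      have h := chebU_cos_add_two n θ
      simp only [chebU] at h
      simp only [Function.iterate_zero, id_eq] at ih ⊢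
      rw [h]
      have := Real.abs_cos_le_one ((n + 2 : ℕ) * θ)
      have h2 := abs_add_le (2 * Real.cos ((n + 2 : ℕ) * θ))
        ((Polynomial.Chebyshev.U ℝ n).eval (Real.cos θ))
      rw [abs_mul, abs_two] at h2
      push_cast at *
      linarith
  | succ k ihk =>
    induction n using Nat.twoStepInduction with
    | zero => 
      simp only [Function.iterate_succ_apply, CharP.cast_eq_zero, Polynomial.Chebyshev.U_zero,
        Polynomial.derivative_one, Polynomial.iterate_derivative_zero]
      simp
    | one =>
      have hd : Polynomial.derivative (2 * Polynomial.X : Polynomial ℝ) = Polynomial.C 2 := by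
        simp [map_ofNat Polynomial.C 2]
      simp only [Function.iterate_succ_apply, Nat.cast_one, Polynomial.Chebyshev.U_one, hd]
      have h1 : (1 : ℝ) ≤ (1 + 1) ^ (2 * k + 1) := one_le_pow₀ (by norm_num)
      rcases k with _ | k
      · norm_num
      · rw [Polynomial.iterate_derivative_C (by omega)]
        simp only [Polynomial.eval_zero, abs_zero]
        positivity
    | more n ih _ =>
      have h : (Polynomial.derivative^[k + 1]) (Polynomial.Chebyshev.U ℝ (n + 2 : ℕ)) =
          (2 * ((n : ℝ) + 2)) • (Polynomial.derivative^[k]) (Polynomial.Chebyshev.U ℝ (n + 1 : ℕ))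
            + (Polynomial.derivative^[k + 1]) (Polynomial.Chebyshev.U ℝ n) := by
        push_cast
        rw [Polynomial.Chebyshev.U_eq_two_mul_T_add_U, iterate_map_add,
          Function.iterate_succ_apply, ← Polynomial.iterate_derivative_smul]
        congr 2
        have := Polynomial.Chebyshev.T_derivative_eq_U (R := ℝ) (n + 2)
        rw [Polynomial.derivative_mul, this, show ((n : ℤ) + 2 - 1) = n + 1 by ring,
          Polynomial.smul_eq_C_mul]
        simp [map_ofNat Polynomial.C 2]
        ring
      rw [h, Polynomial.eval_add, Polynomial.eval_smul, smul_eq_mul]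
      refine (abs_add_le _ _).trans ?_
      rw [abs_mul, abs_of_nonneg (by positivity)]
      have h1 := ihk (n + 1)
      push_cast at h1 ⊢
      -- The two terms add up to at most `(n+2)^(2k+2) (2 + (n+1))`, which is below `(n+3)^(2k+3)`.
      have e1 : ((n : ℝ) + 1) ^ (2 * (k + 1) + 1) ≤ ((n : ℝ) + 2) ^ (2 * k + 2) * (n + 1) := by
        rw [pow_succ, show 2 * (k + 1) = 2 * k + 2 by ring]
        gcongr
        norm_num
      have e2 : ((n : ℝ) + 2) ^ (2 * k + 2) * (n + 3) ≤ ((n : ℝ) + 2 + 1) ^ (2 * (k + 1) + 1) := by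
        rw [show 2 * (k + 1) + 1 = (2 * k + 2) + 1 by ring, pow_succ _ (2 * k + 2)]
        refine mul_le_mul (pow_le_pow_left₀ (by positivity) (by linarith) _) (by linarith)
          (by positivity) (by positivity)
      have e3 : 2 * ((n : ℝ) + 2) * (n + 1 + 1) ^ (2 * k + 1) = 2 * (n + 2) ^ (2 * k + 2) := by
        ring
      have e4 : 2 * ((n : ℝ) + 2) * |((Polynomial.derivative^[k])
          (Polynomial.Chebyshev.U ℝ (n + 1))).eval (Real.cos θ)| ≤
          2 * ((n : ℝ) + 2) * (n + 1 + 1) ^ (2 * k + 1) := by gcongr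
      linarith

theorem abs_chebU_le (n : ℕ) {t : ℝ} (ht : |t| ≤ 1) : |chebU n t| ≤ n + 1 := by
  simpa [chebU] using abs_iterate_derivative_U_le 0 n ht

/-- The zeroth-order coefficient `n(n+2)` is written `(n+1)² - 1`: the summand `+1` of `𝓛ₑ` turns it
into the eigenvalue `(n+1)²`. -/
theorem chebU_ode (n : ℕ) (t : ℝ) :
    (1 - t ^ 2) * iteratedDeriv 2 (chebU n) t - 3 * t * deriv (chebU n) t
      + ((n + 1) ^ 2 - 1) * chebU n t = 0 := by
  have h := congrArg (Polynomial.eval t)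
    (Polynomial.Chebyshev.one_sub_X_sq_mul_derivative_derivative_U_eq_poly_in_U (R := ℝ) n)
  rw [iteratedDeriv_chebU, ← iteratedDeriv_one, iteratedDeriv_chebU]
  simp [chebU] at h ⊢
  linear_combination h

/-! ### Trigonometric integrals -/

theorem integral_cos_int_mul_add {k : ℤ} (hk : k ≠ 0) (c : ℝ) :
    ∫ β in (0 : ℝ)..2 * Real.pi, Real.cos (k * β + c) = 0 := by
  have hk' : (k : ℝ) ≠ 0 := by exact_mod_cast hk
  rw [intervalIntegral.integral_comp_mul_add (fun x => Real.cos x) hk', integral_cos]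
  have : (k : ℝ) * (2 * Real.pi) + c = c + k * (2 * Real.pi) := by ring
  rw [this, Real.sin_add_int_mul_two_pi]
  simp

theorem integral_cos_mul_cos (a b : ℕ) (ha : 0 < a) (δ δ' : ℝ) :
    ∫ β in (0 : ℝ)..2 * Real.pi, Real.cos (a * (β - δ)) * Real.cos (b * (β - δ')) =
      if a = b then Real.pi * Real.cos (a * (δ - δ')) else 0 := by
  have h : ∀ β : ℝ, Real.cos (a * (β - δ)) * Real.cos (b * (β - δ')) =
      (Real.cos (((a + b : ℤ) : ℝ) * β + (-(a * δ) - b * δ')) +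
        Real.cos (((a - b : ℤ) : ℝ) * β + (-(a * δ) + b * δ'))) / 2 := fun β => by
    have e1 : ((a + b : ℤ) : ℝ) * β + (-(a * δ) - b * δ') = a * (β - δ) + b * (β - δ') := by
      push_cast; ring
    have e2 : ((a - b : ℤ) : ℝ) * β + (-(a * δ) + b * δ') = a * (β - δ) - b * (β - δ') := by
      push_cast; ring
    rw [e1, e2, Real.cos_add, Real.cos_sub]
    ring
  simp_rw [h]
  rw [intervalIntegral.integral_div, intervalIntegral.integral_add
    (Continuous.intervalIntegrable (by fun_prop) _ _)
    (Continuous.intervalIntegrable (by fun_prop) _ _), integral_cos_int_mul_add (by omega)]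
  split_ifs with hab
  · subst hab
    simp only [sub_self, Int.cast_zero, zero_mul, zero_add, intervalIntegral.integral_const,
      smul_eq_mul]
    rw [show -(↑a * δ) + ↑a * δ' = -(a * (δ - δ')) by ring, Real.cos_neg]
    ring
  · rw [integral_cos_int_mul_add (by omega)]
    simp

/-- By the recursion, `U_n(cos ·)` is a trigonometric polynomial with frequencies at most `n`, hence
orthogonal to the frequency `m > n`. -/
theorem integral_cos_mul_chebU (m n : ℕ) (hm : n < m) (δ δ' : ℝ) :
    ∫ β in (0 : ℝ)..2 * Real.pi, Real.cos (m * (β - δ)) * chebU n (Real.cos (β - δ')) = 0 := by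
  have hc := continuous_chebU
  induction n using Nat.twoStepInduction with
  | zero =>
    have := integral_cos_mul_cos m 0 hm δ δ'
    simp only [Nat.cast_zero, zero_mul, Real.cos_zero] at this
    simp only [chebU_zero]
    rw [this, if_neg (by omega)]
  | one =>
    have := integral_cos_mul_cos m 1 (by omega) δ δ'
    rw [if_neg (by omega)] at this
    simp only [Nat.cast_one, one_mul] at this
    simp only [chebU_one, mul_left_comm _ (2 : ℝ)]
    rw [intervalIntegral.integral_const_mul, this, mul_zero]
  | more n ih _ =>
    have := integral_cos_mul_cos m (n + 2) (by omega) δ δ'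
    rw [if_neg (by omega)] at this
    simp only [chebU_cos_add_two, mul_add, mul_left_comm _ (2 : ℝ)]
    rw [intervalIntegral.integral_add, ih (by omega), intervalIntegral.integral_const_mul, this]
    · simp
    · exact Continuous.intervalIntegrable (by fun_prop) _ _
    · exact Continuous.intervalIntegrable (by have := hc n; fun_prop) _ _

/-- `U_n(cos β)` is the sum of `e^{ikβ}` over `|k| ≤ n`, `k ≡ n` mod 2, so it reproduces itself
under convolution. In the induction the cross terms vanish by the preceding lemma. -/
theorem integral_chebU_mul_chebU (n : ℕ) (δ δ' : ℝ) :
    ∫ β in (0 : ℝ)..2 * Real.pi, chebU n (Real.cos (β - δ)) * chebU n (Real.cos (β - δ')) =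
      2 * Real.pi * chebU n (Real.cos (δ - δ')) := by
  have hc := continuous_chebU
  induction n using Nat.twoStepInduction with
  | zero => simp [chebU_zero]
  | one =>
    have := integral_cos_mul_cos 1 1 one_pos δ δ'
    simp only [Nat.cast_one, one_mul, if_true] at this
    simp only [chebU_one, mul_mul_mul_comm (2 : ℝ)]
    rw [intervalIntegral.integral_const_mul, this]
    ring
  | more n ih _ =>
    have h1 := integral_cos_mul_cos (n + 2) (n + 2) (by omega) δ δ'
    have h2 := integral_cos_mul_chebU (n + 2) n (by omega) δ δ'
    have h3 := integral_cos_mul_chebU (n + 2) n (by omega) δ' δ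
    rw [if_pos rfl] at h1
    have e : ∀ β : ℝ, chebU (n + 2) (Real.cos (β - δ)) * chebU (n + 2) (Real.cos (β - δ')) =
      4 * (Real.cos ((n + 2 : ℕ) * (β - δ)) * Real.cos ((n + 2 : ℕ) * (β - δ')))
      + 2 * (Real.cos ((n + 2 : ℕ) * (β - δ)) * chebU n (Real.cos (β - δ')))
      + 2 * (Real.cos ((n + 2 : ℕ) * (β - δ')) * chebU n (Real.cos (β - δ)))
      + chebU n (Real.cos (β - δ)) * chebU n (Real.cos (β - δ')) := fun β => by
      rw [chebU_cos_add_two, chebU_cos_add_two]; ring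
    have hcn := hc n
    simp_rw [e]
    rw [intervalIntegral.integral_add, intervalIntegral.integral_add,
      intervalIntegral.integral_add, ih, intervalIntegral.integral_const_mul,
      intervalIntegral.integral_const_mul, intervalIntegral.integral_const_mul, h1, h2, h3,
      chebU_cos_add_two]
    · ring
    all_goals exact Continuous.intervalIntegrable (by fun_prop) _ _

theorem integral_sin_mul_sin (n m : ℕ) :
    ∫ ψ in (0 : ℝ)..Real.pi, Real.sin ((n + 1) * ψ) * Real.sin ((m + 1) * ψ) =
      if n = m then Real.pi / 2 else 0 := by
  have hI : ∀ k : ℤ, k ≠ 0 → ∫ ψ in (0 : ℝ)..Real.pi, Real.cos (k * ψ) = 0 := fun k hk => by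
    have hk' : (k : ℝ) ≠ 0 := by exact_mod_cast hk
    rw [intervalIntegral.integral_comp_mul_left (fun x => Real.cos x) hk', integral_cos,
      Real.sin_int_mul_pi]
    simp
  have h : ∀ ψ : ℝ, Real.sin ((n + 1) * ψ) * Real.sin ((m + 1) * ψ) =
      (Real.cos (((n - m : ℤ) : ℝ) * ψ) - Real.cos (((n + m + 2 : ℤ) : ℝ) * ψ)) / 2 := fun ψ => by
    have e1 : ((n - m : ℤ) : ℝ) * ψ = (n + 1) * ψ - (m + 1) * ψ := by push_cast; ring
    have e2 : ((n + m + 2 : ℤ) : ℝ) * ψ = (n + 1) * ψ + (m + 1) * ψ := by push_cast; ring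
    rw [e1, e2, Real.cos_add, Real.cos_sub]
    ring
  simp_rw [h]
  rw [intervalIntegral.integral_div, intervalIntegral.integral_sub
    (Continuous.intervalIntegrable (by fun_prop) _ _)
    (Continuous.intervalIntegrable (by fun_prop) _ _), hI _ (by omega : (n + m + 2 : ℤ) ≠ 0)]
  split_ifs with hab
  · subst hab; simp
  · rw [hI _ (by omega)]; simp

/-! ### Ridge functions -/

/-- The ridge function `U_n(⟨x, e^{iδ}⟩)`. -/
def ridge (n : ℕ) (δ : ℝ) (x : ℂ) : ℝ := chebU n (x.re * Real.cos δ + x.im * Real.sin δ)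

theorem contDiff_ridge (n : ℕ) (δ : ℝ) : ContDiff ℝ ∞ (ridge n δ) := by
  refine (contDiff_chebU n).comp ?_
  exact (Complex.reCLM.contDiff.mul contDiff_const).add (Complex.imCLM.contDiff.mul contDiff_const)

theorem continuous_ridge (n : ℕ) (δ : ℝ) : Continuous (ridge n δ) := (contDiff_ridge n δ).continuous

theorem ridge_rotate (n : ℕ) (δ φ p u : ℝ) :
    ridge n δ (Complex.exp (φ * Complex.I) * (p + u * Complex.I)) =
      chebU n (p * Real.cos (φ - δ) - u * Real.sin (φ - δ)) := by
  simp only [ridge, Complex.exp_mul_I]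
  congr 1
  simp [Real.cos_sub, Real.sin_sub, Complex.cos_ofReal_re, Complex.sin_ofReal_re]
  ring

/-- An antiderivative of `U_m` is `T_{m+1}/(m+1)`, and at the ends of the chord its argument is
`cos(ψ ± θ)`. The difference of the two cosines is `2 sin((m+1)ψ) sin((m+1)θ)`, and division by `sin
θ` produces `U_m(cos θ)`. -/
theorem integral_chebU_mul_sin (m : ℕ) (ψ θ : ℝ) :
    ∫ u in -Real.sin ψ..Real.sin ψ,
        chebU m (Real.cos ψ * Real.cos θ - u * Real.sin θ) =
      2 / (m + 1) * Real.sin ((m + 1) * ψ) * chebU m (Real.cos θ) := by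
  have hm : (m : ℝ) + 1 ≠ 0 := by positivity
  -- If `sin θ = 0` the integrand is constant along the chord, and only the values and the parity of
  -- `U_m` are needed.
  by_cases hs : Real.sin θ = 0
  · simp only [hs, mul_zero, sub_zero, intervalIntegral.integral_const, smul_eq_mul]
    have h1 := chebU_cos_mul_sin m ψ
    rcases Real.sin_eq_zero_iff_cos_eq.1 hs with h | h
    · rw [h, mul_one, chebU_one_right]
      field_simp
      linear_combination 2 * h1
    · rw [h, mul_neg_one, chebU_neg, chebU_neg, chebU_one_right]
      field_simp
      linear_combination 2 * h1
  · have hU : ∀ x, HasDerivAt (fun t => (Polynomial.Chebyshev.T ℝ (m + 1)).eval t)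
        ((m + 1) * chebU m x) x := fun x => by
      have := (Polynomial.Chebyshev.T ℝ (m + 1)).hasDerivAt x
      rw [Polynomial.Chebyshev.T_derivative_eq_U] at this
      simpa [chebU] using this
    have hd : ∀ u ∈ Set.uIcc (-Real.sin ψ) (Real.sin ψ), HasDerivAt
        (fun u => -((Polynomial.Chebyshev.T ℝ (m + 1)).eval
          (Real.cos ψ * Real.cos θ - u * Real.sin θ)) / ((m + 1) * Real.sin θ))
        (chebU m (Real.cos ψ * Real.cos θ - u * Real.sin θ)) u := fun u _ => by
      have h2 : HasDerivAt (fun u => Real.cos ψ * Real.cos θ - u * Real.sin θ)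
          (-Real.sin θ) u := by
        simpa using ((hasDerivAt_id u).mul_const (Real.sin θ)).const_sub (Real.cos ψ * Real.cos θ)
      convert! ((hU _).comp u h2).neg.div_const ((m + 1) * Real.sin θ) using 1
      field_simp
    rw [intervalIntegral.integral_eq_sub_of_hasDerivAt hd
      (Continuous.intervalIntegrable (by have := continuous_chebU m; fun_prop) _ _)]
    have e1 : Real.cos ψ * Real.cos θ - Real.sin ψ * Real.sin θ = Real.cos (ψ + θ) := by
      rw [Real.cos_add]
    have e2 : Real.cos ψ * Real.cos θ - -Real.sin ψ * Real.sin θ = Real.cos (ψ - θ) := by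
      rw [Real.cos_sub]; ring
    rw [e1, e2, Polynomial.Chebyshev.T_real_cos, Polynomial.Chebyshev.T_real_cos]
    have h1 := chebU_cos_mul_sin m θ
    have h3 : Real.cos (((m + 1 : ℤ) : ℝ) * (ψ + θ)) =
        Real.cos ((m + 1) * ψ + (m + 1) * θ) := by push_cast; ring_nf
    have h4 : Real.cos (((m + 1 : ℤ) : ℝ) * (ψ - θ)) =
        Real.cos ((m + 1) * ψ - (m + 1) * θ) := by push_cast; ring_nf
    rw [h3, h4, Real.cos_add, Real.cos_sub]
    field_simp
    linear_combination -(2 * Real.sin ((m + 1) * ψ)) * h1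

theorem integral_ridge_chord (m : ℕ) (δ φ ψ : ℝ) :
    ∫ u in -Real.sin ψ..Real.sin ψ,
        ridge m δ (Complex.exp (φ * Complex.I) * (Real.cos ψ + u * Complex.I)) =
      2 / (m + 1) * Real.sin ((m + 1) * ψ) * chebU m (Real.cos (φ - δ)) := by
  simp_rw [ridge_rotate]
  exact integral_chebU_mul_sin m ψ (φ - δ)

/-! ### Integration over the unit disk -/

theorem setIntegral_unitDisk_rotate (f : ℂ → ℂ) (φ : ℝ) :
    ∫ x in closedBall (0 : ℂ) 1, f (Complex.exp (φ * Complex.I) * x) =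
      ∫ x in closedBall (0 : ℂ) 1, f x := by
  have hmp := (rotation (Circle.exp φ)).measurePreserving
  have he := (rotation (Circle.exp φ)).toHomeomorph.measurableEmbedding
  have h := hmp.setIntegral_preimage_emb he f (closedBall (0 : ℂ) 1)
  rw [← h]
  have : ⇑(rotation (Circle.exp φ)) ⁻¹' closedBall (0 : ℂ) 1 = closedBall (0 : ℂ) 1 := by
    ext x
    rw [Set.mem_preimage, mem_closedBall_zero_iff, mem_closedBall_zero_iff,
      LinearIsometryEquiv.norm_map]
  rw [this]
  simp [rotation_apply]

/-- Fubini over vertical chords. Writing the abscissa as `cos ψ` makes the half-length `sin ψ`,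
which matches both the chord formula and the orthogonality of sines. -/
theorem setIntegral_unitDisk {f : ℂ → ℂ} (hf : ContinuousOn f (closedBall (0 : ℂ) 1)) :
    ∫ x in closedBall (0 : ℂ) 1, f x =
      ∫ ψ in (0 : ℝ)..Real.pi, Real.sin ψ •
        ∫ u in -Real.sin ψ..Real.sin ψ, f (Real.cos ψ + u * Complex.I) := by
  have hint : Integrable ((closedBall (0 : ℂ) 1).indicator f) :=
    (integrable_indicator_iff measurableSet_closedBall).2
      (hf.integrableOn_compact (isCompact_closedBall _ _))
  have hmp := Complex.volume_preserving_equiv_real_prod.symm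
  have he := Complex.measurableEquivRealProd.symm.measurableEmbedding
  have hint2 := (hmp.integrable_comp_emb he).2 hint
  rw [← integral_indicator measurableSet_closedBall, ← hmp.integral_comp he,
    Measure.volume_eq_prod, integral_prod (fun y => (closedBall (0 : ℂ) 1).indicator f
      (Complex.measurableEquivRealProd.symm y)) hint2]
  have hs : ∀ p : ℝ, (∫ u : ℝ, (closedBall (0 : ℂ) 1).indicator f
        (Complex.measurableEquivRealProd.symm (p, u))) =
      (Set.Icc (-1 : ℝ) 1).indicator (fun p => ∫ u in Set.Icc (-√(1 - p ^ 2)) (√(1 - p ^ 2)),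
        f (p + u * Complex.I)) p := fun p => by
    have hmem : ∀ u : ℝ, Complex.measurableEquivRealProd.symm (p, u) = p + u * Complex.I :=
      fun u => by
        apply Complex.ext <;> simp [Complex.measurableEquivRealProd]
    have hball : ∀ u : ℝ, ((p + u * Complex.I : ℂ) ∈ closedBall (0 : ℂ) 1 ↔ p ^ 2 + u ^ 2 ≤ 1) :=
      fun u => by
        rw [mem_closedBall_zero_iff, ← sq_le_one_iff₀ (norm_nonneg _), ← Complex.normSq_eq_norm_sq,
          Complex.normSq_add_mul_I]
    by_cases hp : p ∈ Set.Icc (-1 : ℝ) 1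
    · rw [Set.indicator_of_mem hp, ← integral_indicator measurableSet_Icc]
      congr 1
      ext u
      rw [hmem]
      have h1 : 0 ≤ 1 - p ^ 2 := by nlinarith [hp.1, hp.2]
      have : (p + u * Complex.I : ℂ) ∈ closedBall (0 : ℂ) 1 ↔
          u ∈ Set.Icc (-√(1 - p ^ 2)) (√(1 - p ^ 2)) := by
        rw [hball, Set.mem_Icc, ← abs_le]
        constructor
        · intro h; exact Real.abs_le_sqrt (by linarith)
        · intro h
          have := sq_le_sq' (by linarith [neg_le_of_abs_le h]) (le_of_abs_le h)
          rw [Real.sq_sqrt h1] at this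
          linarith
      by_cases hu : (p + u * Complex.I : ℂ) ∈ closedBall (0 : ℂ) 1
      · rw [Set.indicator_of_mem hu, Set.indicator_of_mem (this.1 hu)]
      · rw [Set.indicator_of_notMem hu, Set.indicator_of_notMem (fun h => hu (this.2 h))]
    · rw [Set.indicator_of_notMem hp]
      refine integral_eq_zero_of_ae (Filter.Eventually.of_forall fun u => ?_)
      change (closedBall (0 : ℂ) 1).indicator f (Complex.measurableEquivRealProd.symm (p, u)) = 0
      rw [hmem]
      refine Set.indicator_of_notMem (fun h => hp ?_) _
      rw [hball] at h
      constructor <;> nlinarith [sq_nonneg u, sq_nonneg p]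
  simp_rw [hs]
  rw [integral_indicator measurableSet_Icc, ← Real.bijOn_cos.image_eq,
    integral_image_eq_integral_abs_deriv_smul measurableSet_Icc
      (fun x _ => (Real.hasDerivAt_cos x).hasDerivWithinAt) Real.injOn_cos,
    intervalIntegral.integral_of_le Real.pi_pos.le, integral_Icc_eq_integral_Ioc]
  refine setIntegral_congr_fun measurableSet_Ioc fun ψ hψ => ?_
  have h0 : 0 ≤ Real.sin ψ := Real.sin_nonneg_of_mem_Icc ⟨hψ.1.le, hψ.2⟩
  have h1 : √(1 - Real.cos ψ ^ 2) = Real.sin ψ := by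
    rw [← Real.sin_sq, Real.sqrt_sq h0]
  simp only [abs_neg, abs_of_nonneg h0, h1, integral_Icc_eq_integral_Ioc,
    intervalIntegral.integral_of_le (neg_le_self h0)]

/-- After a rotation by `δ` the first ridge is constant on vertical chords, so the inner integral is
the chord integral of the second ridge. As `U_n(cos ψ) sin ψ = sin((n+1)ψ)`, the outer integral is a
product of two sines. -/
theorem integral_ridge_mul_ridge (n m : ℕ) (δ δ' : ℝ) :
    ∫ x in closedBall (0 : ℂ) 1, (ridge n δ x * ridge m δ' x : ℂ) =
      if n = m then (Real.pi / (m + 1) * chebU m (Real.cos (δ - δ')) : ℝ) else 0 := by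
  have hcr := fun n δ => continuous_ridge n δ
  have hcont : Continuous fun x : ℂ => (ridge n δ x * ridge m δ' x : ℂ) := by
    have := hcr n δ; have := hcr m δ'; fun_prop
  rw [← setIntegral_unitDisk_rotate _ δ, setIntegral_unitDisk]
  swap
  · exact (hcont.comp (by fun_prop)).continuousOn
  have h : ∀ ψ : ℝ, (Real.sin ψ • ∫ u in -Real.sin ψ..Real.sin ψ,
      ((ridge n δ (Complex.exp (δ * Complex.I) * (Real.cos ψ + u * Complex.I)) : ℂ) *
        ridge m δ' (Complex.exp (δ * Complex.I) * (Real.cos ψ + u * Complex.I)))) =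
      ((2 / (m + 1) * chebU m (Real.cos (δ - δ')) *
        (Real.sin ((n + 1) * ψ) * Real.sin ((m + 1) * ψ)) : ℝ) : ℂ) := fun ψ => by
    have h1 : ∀ u : ℝ, ridge n δ (Complex.exp (δ * Complex.I) * (Real.cos ψ + u * Complex.I)) =
        chebU n (Real.cos ψ) := fun u => by rw [ridge_rotate]; simp
    simp_rw [h1, ← Complex.ofReal_mul]
    rw [intervalIntegral.integral_ofReal, intervalIntegral.integral_const_mul,
      integral_ridge_chord, Complex.real_smul, ← Complex.ofReal_mul, ← chebU_cos_mul_sin n]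
    congr 1
    ring
  simp_rw [h]
  rw [intervalIntegral.integral_ofReal, intervalIntegral.integral_const_mul, integral_sin_mul_sin]
  split_ifs <;> simp
  field_simp

/-! ### The orthogonal basis of ridge polynomials -/

/-- The degree of the basis element with index `i`. -/
def deg (i : ℕ × ℕ) : ℕ := i.1 + i.2

/-- The ridge basis of polynomials on the unit disk. -/
def ridgeBasis (i : ℕ × ℕ) : ℂ → ℝ := ridge (deg i) (i.1 * Real.pi / (deg i + 1))

/-- The differences of the directions are zeros of `sin((n+1)θ)/sin θ`, except for coinciding
directions, where the value is `U_n(1)`. -/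
theorem chebU_cos_node {n a b : ℕ} (ha : a ≤ n) (hb : b ≤ n) :
    chebU n (Real.cos (a * Real.pi / (n + 1) - b * Real.pi / (n + 1))) =
      if a = b then (n : ℝ) + 1 else 0 := by
  have hn : (n : ℝ) + 1 ≠ 0 := by positivity
  split_ifs with h
  · subst h; simp [chebU_one_right]
  · have h1 := chebU_cos_mul_sin n (a * Real.pi / (n + 1) - b * Real.pi / (n + 1))
    have h2 : ((n : ℝ) + 1) * (a * Real.pi / (n + 1) - b * Real.pi / (n + 1)) =
        ((a - b : ℤ) : ℝ) * Real.pi := by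
      push_cast; field_simp
    rw [h2, Real.sin_int_mul_pi] at h1
    -- The factor `sin` could vanish only if `n+1` divided `a - b`, which is excluded by `0 < |a -
    -- b| ≤ n`.
    refine (mul_eq_zero.1 h1).resolve_right fun h3 => ?_
    obtain ⟨k, hk⟩ := Real.sin_eq_zero_iff.1 h3
    have h4 : ((k * (n + 1) : ℤ) : ℝ) = ((a - b : ℤ) : ℝ) := by
      have : (k : ℝ) * Real.pi * (n + 1) = (a - b) * Real.pi := by
        rw [hk]; field_simp
      have h5 : (k : ℝ) * (n + 1) = a - b := by
        apply mul_right_cancel₀ Real.pi_ne_zero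
        linear_combination this
      push_cast
      exact h5
    have h5 : k * (n + 1) = (a : ℤ) - b := by exact_mod_cast h4
    have hk0 : k ≠ 0 := by
      rintro rfl
      simp at h5
      omega
    rcases lt_or_gt_of_ne hk0 with h6 | h6
    · have : k * ((n : ℤ) + 1) ≤ (-1) * (n + 1) := by
        apply mul_le_mul_of_nonneg_right <;> omega
      omega
    · have : 1 * ((n : ℤ) + 1) ≤ k * (n + 1) := by
        apply mul_le_mul_of_nonneg_right <;> omega
      omega

/-- Different degrees are separated by the sines, different directions of one degree by the zeros of
`U_n`. The squared norm is `π` in every degree because `U_n(1) = n+1` cancels the factor `1/(n+1)`.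
-/
theorem integral_ridgeBasis_mul (i j : ℕ × ℕ) :
    ∫ x in closedBall (0 : ℂ) 1, (ridgeBasis i x * ridgeBasis j x : ℂ) =
      if i = j then (Real.pi : ℂ) else 0 := by
  rw [ridgeBasis, ridgeBasis, integral_ridge_mul_ridge]
  have hn : ((deg j : ℝ) + 1) ≠ 0 := by positivity
  by_cases hd : deg i = deg j
  · rw [if_pos hd, hd, chebU_cos_node (by rw [← hd]; simp [deg]) (by simp [deg])]
    by_cases h : i.1 = j.1
    · have : i = j := by
        apply Prod.ext h
        simp only [deg] at hd
        omega
      rw [if_pos h, if_pos this]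
      congr 1
      field_simp
    · rw [if_neg h, if_neg (fun h' => h (congrArg Prod.fst h'))]
      simp
  · rw [if_neg hd, if_neg (fun h => hd (congrArg deg h)), Complex.ofReal_zero]

theorem contDiff_ridgeBasis (i : ℕ × ℕ) : ContDiff ℝ ∞ (ridgeBasis i) := contDiff_ridge _ _

theorem continuous_ridgeBasis (i : ℕ × ℕ) : Continuous (ridgeBasis i) := continuous_ridge _ _

theorem ridgeBasis_eq_comp (i : ℕ × ℕ) : ∃ ℓ : ℂ →L[ℝ] ℝ, ‖ℓ‖ ≤ 1 ∧
    ridgeBasis i = chebU (deg i) ∘ ℓ := by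
  set δ := i.1 * Real.pi / ((deg i : ℝ) + 1) with hδ
  refine ⟨Real.cos δ • Complex.reCLM + Real.sin δ • Complex.imCLM, ?_, ?_⟩
  · refine ContinuousLinearMap.opNorm_le_bound _ zero_le_one fun x => ?_
    simp only [add_apply, smul_apply, Complex.reCLM_apply,
      Complex.imCLM_apply, smul_eq_mul, one_mul, Real.norm_eq_abs]
    refine abs_le_of_sq_le_sq ?_ (norm_nonneg _)
    rw [← Complex.normSq_eq_norm_sq, Complex.normSq_apply]
    nlinarith [Real.sin_sq_add_cos_sq δ, sq_nonneg (Real.sin δ * x.re - Real.cos δ * x.im)]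
  · ext x
    simp only [ridgeBasis, ridge, ← hδ, Function.comp]
    congr 1
    simp
    ring

theorem norm_iteratedFDeriv_ridgeBasis_le (i : ℕ × ℕ) (k : ℕ) {x : ℂ} (hx : ‖x‖ ≤ 1) :
    ‖iteratedFDeriv ℝ k (ridgeBasis i) x‖ ≤ ((deg i : ℝ) + 1) ^ (2 * k + 1) := by
  obtain ⟨ℓ, hℓ, h⟩ := ridgeBasis_eq_comp i
  have hx' : |ℓ x| ≤ 1 := (ℓ.le_opNorm x).trans (mul_le_one₀ hℓ (norm_nonneg _) hx)
  rw [h, ℓ.iteratedFDeriv_comp_right (contDiff_chebU _) x (by exact_mod_cast le_top)]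
  refine (ContinuousMultilinearMap.norm_compContinuousLinearMap_le _ _).trans ?_
  rw [norm_iteratedFDeriv_eq_norm_iteratedDeriv, iteratedDeriv_chebU]
  refine (mul_le_of_le_one_right (norm_nonneg _) ?_).trans (abs_iterate_derivative_U_le _ _ hx')
  exact Finset.prod_le_one (fun _ _ => norm_nonneg _) fun _ _ => hℓ

theorem abs_ridgeBasis_le (i : ℕ × ℕ) {x : ℂ} (hx : ‖x‖ ≤ 1) :
    |ridgeBasis i x| ≤ (deg i : ℝ) + 1 := by
  simpa using norm_iteratedFDeriv_ridgeBasis_le i 0 hx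

/-! ### Density of polynomials -/

/-- The monomials in `x` and its conjugate. -/
def mono (i : ℕ × ℕ) (x : ℂ) : ℂ := x ^ i.1 * (starRingEnd ℂ x) ^ i.2

/-- The indices of degree at most `n`. -/
def indices (n : ℕ) : Finset (ℕ × ℕ) :=
  (Finset.range (n + 1) ×ˢ Finset.range (n + 1)).filter fun i => deg i ≤ n

theorem mem_indices {n : ℕ} {i : ℕ × ℕ} : i ∈ indices n ↔ deg i ≤ n := by
  rw [indices, Finset.mem_filter, Finset.mem_product, Finset.mem_range, Finset.mem_range]
  simp only [deg]
  omega

/-- Polynomials in `x`, `x̄` of degree at most `n`. -/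
def polyLE (n : ℕ) : Submodule ℂ (ℂ → ℂ) := Submodule.span ℂ (mono '' (indices n : Set (ℕ × ℕ)))

theorem polyLE_mono {m n : ℕ} (h : m ≤ n) : polyLE m ≤ polyLE n := by
  refine Submodule.span_mono (Set.image_mono fun i hi => ?_)
  simp only [Finset.mem_coe, mem_indices] at hi ⊢
  omega

theorem mono_mem_polyLE {n : ℕ} {i : ℕ × ℕ} (h : deg i ≤ n) : mono i ∈ polyLE n :=
  Submodule.subset_span ⟨i, by simpa [mem_indices] using h, rfl⟩

theorem mul_mem_polyLE {n : ℕ} {f : ℂ → ℂ} (hf : f ∈ polyLE n) :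
    (fun x => x * f x) ∈ polyLE (n + 1) ∧ (fun x => starRingEnd ℂ x * f x) ∈ polyLE (n + 1) := by
  induction hf using Submodule.span_induction with
  | mem f hf =>
    obtain ⟨i, hi, rfl⟩ := hf
    simp only [Finset.mem_coe, mem_indices, deg] at hi
    constructor
    · convert mono_mem_polyLE (i := (i.1 + 1, i.2)) (n := n + 1) (by simp [deg]; omega) using 1
      ext x; simp only [mono]; ring
    · convert mono_mem_polyLE (i := (i.1, i.2 + 1)) (n := n + 1) (by simp [deg]; omega) using 1
      ext x; simp only [mono]; ring
  | zero => simp only [Pi.zero_apply, mul_zero]; exact ⟨zero_mem _, zero_mem _⟩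
  | add f g _ _ hf hg =>
    constructor
    · convert add_mem hf.1 hg.1 using 1; ext x; simp only [Pi.add_apply]; ring
    · convert add_mem hf.2 hg.2 using 1; ext x; simp only [Pi.add_apply]; ring
  | smul c f _ hf =>
    constructor
    · convert Submodule.smul_mem _ c hf.1 using 1
      ext x; simp only [Pi.smul_apply, smul_eq_mul]; ring
    · convert Submodule.smul_mem _ c hf.2 using 1
      ext x; simp only [Pi.smul_apply, smul_eq_mul]; ring

theorem linear_pow_mem_polyLE (a b : ℂ) (k : ℕ) :
    (fun x => (a * x + b * starRingEnd ℂ x) ^ k) ∈ polyLE k := by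
  induction k with
  | zero =>
    convert mono_mem_polyLE (i := (0, 0)) (n := 0) (by simp [deg]) using 1
    ext x; simp [mono]
  | succ k ih =>
    have h := mul_mem_polyLE ih
    convert add_mem (Submodule.smul_mem _ a h.1) (Submodule.smul_mem _ b h.2) using 1
    ext x
    simp only [Pi.add_apply, Pi.smul_apply, smul_eq_mul]
    ring

theorem ridgeBasis_mem_polyLE (i : ℕ × ℕ) : (fun x => (ridgeBasis i x : ℂ)) ∈ polyLE (deg i) := by
  set δ := i.1 * Real.pi / ((deg i : ℝ) + 1) with hδ
  set a : ℂ := (Real.cos δ - Real.sin δ * Complex.I) / 2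
  set b : ℂ := (Real.cos δ + Real.sin δ * Complex.I) / 2
  have hℓ : ∀ x : ℂ, ((x.re * Real.cos δ + x.im * Real.sin δ : ℝ) : ℂ) =
      a * x + b * starRingEnd ℂ x := fun x => by
    simp only [a, b]
    apply Complex.ext <;> simp [Complex.cos_ofReal_re, Complex.sin_ofReal_re] <;> ring
  have h : (fun x => (ridgeBasis i x : ℂ)) = ∑ k ∈ Finset.range (deg i + 1),
      ((Polynomial.Chebyshev.U ℝ (deg i)).coeff k : ℂ) •
        fun x => (a * x + b * starRingEnd ℂ x) ^ k := by
    ext x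
    simp only [ridgeBasis, ridge, chebU, ← hδ, Finset.sum_apply, Pi.smul_apply, smul_eq_mul, ← hℓ]
    rw [Polynomial.eval_eq_sum_range, Polynomial.Chebyshev.natDegree_U_natCast]
    push_cast
    rfl
  rw [h]
  refine Submodule.sum_mem _ fun k hk => Submodule.smul_mem _ _ ?_
  exact polyLE_mono (by simpa [Nat.lt_succ_iff] using hk) (linear_pow_mem_polyLE a b k)

/-! ### Completeness of the ridge basis in the polynomials. -/

/-- The ridge basis, as complex-valued functions. -/
def cbasis (i : ℕ × ℕ) (x : ℂ) : ℂ := ridgeBasis i x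

theorem continuous_cbasis (i : ℕ × ℕ) : Continuous (cbasis i) :=
  Complex.continuous_ofReal.comp (continuous_ridgeBasis i)

theorem contDiff_cbasis (i : ℕ × ℕ) : ContDiff ℝ ∞ (cbasis i) :=
  Complex.ofRealCLM.contDiff.comp (contDiff_ridgeBasis i)

theorem integral_cbasis_mul (i j : ℕ × ℕ) :
    ∫ x in closedBall (0 : ℂ) 1, cbasis i x * cbasis j x = if i = j then (Real.pi : ℂ) else 0 :=
  integral_ridgeBasis_mul i j

theorem linearIndependent_cbasis : LinearIndependent ℂ cbasis := by
  rw [linearIndependent_iff']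
  intro s c hc i hi
  have h : ∫ x in closedBall (0 : ℂ) 1, (∑ j ∈ s, c j • cbasis j) x * cbasis i x = c i * Real.pi := by
    simp only [Finset.sum_apply, Pi.smul_apply, smul_eq_mul, Finset.sum_mul, mul_assoc]
    rw [integral_finsetSum]
    · simp_rw [integral_const_mul, integral_cbasis_mul]
      simp [hi]
    · intro j _
      have h1 := continuous_cbasis j
      have h2 := continuous_cbasis i
      have h3 : Continuous fun x => c j * (cbasis j x * cbasis i x) := by fun_prop
      exact h3.continuousOn.integrableOn_compact (isCompact_closedBall _ _)
  rw [hc] at h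
  simpa [Real.pi_ne_zero] using h.symm

/-- A dimension count: orthogonality makes the ridge polynomials of degree at most `n` independent,
and there are as many of them as monomials spanning the space. -/
theorem span_cbasis (n : ℕ) :
    Submodule.span ℂ (cbasis '' (indices n : Set (ℕ × ℕ))) = polyLE n := by
  have hfin : Module.Finite ℂ (polyLE n) :=
    Module.Finite.span_of_finite ℂ ((indices n).finite_toSet.image _)
  apply Submodule.eq_of_le_of_finrank_le
  · rw [Submodule.span_le]
    rintro _ ⟨i, hi, rfl⟩
    exact polyLE_mono (mem_indices.1 hi) (ridgeBasis_mem_polyLE i)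
  · have h1 : Module.finrank ℂ (Submodule.span ℂ (cbasis '' (indices n : Set (ℕ × ℕ)))) =
        (indices n).card := by
      have := finrank_span_eq_card
        (linearIndependent_cbasis.comp (Subtype.val : indices n → ℕ × ℕ) Subtype.val_injective)
      have e : Submodule.span ℂ (cbasis '' (indices n : Set (ℕ × ℕ))) =
          Submodule.span ℂ (Set.range (cbasis ∘ (Subtype.val : indices n → ℕ × ℕ))) := by
        rw [Set.range_comp]
        simp
      rw [(LinearEquiv.ofEq _ _ e).finrank_eq, this, Fintype.card_coe]
    have h2 : Module.finrank ℂ (polyLE n) ≤ (indices n).card := by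
      classical
      have := finrank_span_finset_le_card (R := ℂ) ((indices n).image mono)
      rw [Finset.coe_image] at this
      exact this.trans Finset.card_image_le
    rw [h1]
    exact h2

theorem mono_mem_span_cbasis (i : ℕ × ℕ) : mono i ∈ Submodule.span ℂ (Set.range cbasis) := by
  have h := mono_mem_polyLE (le_refl (deg i))
  rw [← span_cbasis] at h
  exact Submodule.span_mono (Set.image_subset_range _ _) h

/-- Uniform approximation by linear combinations of the ridge basis in a continuous injective
coordinate. -/
theorem exists_cbasis_approx {K : Set ℂ} (hK : IsCompact K) {P : ℂ → ℂ} (hP : ContinuousOn P K)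
    (hinj : Set.InjOn P K) {f : ℂ → ℂ} (hf : ContinuousOn f K) {ε : ℝ} (hε : 0 < ε) :
    ∃ c : ℕ × ℕ →₀ ℂ, ∀ z ∈ K, ‖f z - Finsupp.linearCombination ℂ cbasis c (P z)‖ < ε := by
  have : CompactSpace K := isCompact_iff_compactSpace.1 hK
  let p : C(K, ℂ) := ⟨fun z => P z, hP.domRestrict⟩
  let g : C(K, ℂ) := ⟨fun z => f z, hf.domRestrict⟩
  -- Stone–Weierstrass for the star algebra generated by the coordinate, which separates points by
  -- injectivity.
  have hsep : (StarAlgebra.adjoin ℂ ({p} : Set C(K, ℂ))).SeparatesPoints := by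
    intro x y hxy
    refine ⟨p, ⟨p, StarAlgebra.self_mem_adjoin_singleton ℂ p, rfl⟩, fun h => hxy ?_⟩
    exact Subtype.ext (hinj x.2 y.2 h)
  have hp : ∀ z : K, p z = P z := fun z => rfl
  have hdense := ContinuousMap.starSubalgebra_topologicalClosure_eq_top_of_separatesPoints _ hsep
  have hg : g ∈ closure ((StarAlgebra.adjoin ℂ ({p} : Set C(K, ℂ))) : Set C(K, ℂ)) := by
    rw [← StarSubalgebra.topologicalClosure_coe, hdense]
    trivial
  obtain ⟨q, hq, hd⟩ := Metric.mem_closure_iff.1 hg ε hε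
  -- The elements of that algebra are polynomials in `P` and its conjugate, hence combinations of
  -- the ridge basis composed with `P`.
  have hrep : ∀ q ∈ StarAlgebra.adjoin ℂ ({p} : Set C(K, ℂ)),
      ∃ Q ∈ Submodule.span ℂ (Set.range cbasis), ∀ z : K, q z = Q (P z) := fun q hq => by
    have hq' : q ∈ (StarAlgebra.adjoin ℂ ({p} : Set C(K, ℂ))).toSubalgebra := hq
    rw [StarAlgebra.adjoin_toSubalgebra, ← Subalgebra.mem_toSubmodule, Algebra.adjoin_eq_span] at hq'
    clear hq
    induction hq' using Submodule.span_induction with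
    | mem q hq =>
      have : ∃ i, ∀ z : K, q z = mono i (P z) := by
        induction hq using Submonoid.closure_induction with
        | mem q hq =>
          rcases hq with hq | hq
          · rw [Set.mem_singleton_iff] at hq
            subst hq
            exact ⟨(1, 0), fun z => by simp [mono, hp]⟩
          · have : q = star p := by
              rw [Set.mem_star, Set.mem_singleton_iff] at hq
              rw [← hq, star_star]
            subst this
            exact ⟨(0, 1), fun z => by simp [mono, hp]⟩
        | one => exact ⟨(0, 0), fun z => by simp [mono]⟩
        | mul q r _ _ hq hr =>
          obtain ⟨i, hi⟩ := hq
          obtain ⟨j, hj⟩ := hr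
          refine ⟨(i.1 + j.1, i.2 + j.2), fun z => ?_⟩
          rw [ContinuousMap.mul_apply, hi, hj]
          simp only [mono]
          ring
      obtain ⟨i, hi⟩ := this
      exact ⟨mono i, mono_mem_span_cbasis i, hi⟩
    | zero => exact ⟨0, zero_mem _, fun z => rfl⟩
    | add q r _ _ hq hr =>
      obtain ⟨Q, hQ, h1⟩ := hq
      obtain ⟨T, hT, h2⟩ := hr
      exact ⟨Q + T, add_mem hQ hT, fun z => by simp [h1, h2]⟩
    | smul c q _ hq =>
      obtain ⟨Q, hQ, h1⟩ := hq
      exact ⟨c • Q, Submodule.smul_mem _ _ hQ, fun z => by simp [h1]⟩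
  obtain ⟨Q, hQ, hqQ⟩ := hrep q hq
  obtain ⟨c, rfl⟩ := (Finsupp.mem_span_range_iff_exists_finsupp).1 hQ
  refine ⟨c, fun z hz => ?_⟩
  have h := (ContinuousMap.dist_lt_iff hε).1 hd ⟨z, hz⟩
  rw [dist_eq_norm, hqQ] at h
  exact h

/-! ### Differential operators on the closed unit disk -/

/-- The closed unit disk. -/
abbrev unitDisk : Set ℂ := closedBall (0 : ℂ) 1

theorem uniqueDiffOn_unitDisk : UniqueDiffOn ℝ unitDisk :=
  uniqueDiffOn_convex (convex_closedBall _ _) (by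
    rw [interior_closedBall _ one_ne_zero]; exact ⟨0, mem_ball_self one_pos⟩)

/-- Smooth functions on the closed unit disk. -/
def SmoothD (f : ℂ → ℂ) : Prop := ContDiffOn ℝ ∞ f unitDisk

/-- Directional derivative on the closed unit disk. -/
def dirD (v : ℂ) (f : ℂ → ℂ) (x : ℂ) : ℂ := fderivWithin ℝ f unitDisk x v

theorem SmoothD.dirD {f : ℂ → ℂ} (hf : SmoothD f) (v : ℂ) : SmoothD (dirD v f) :=
  (hf.fderivWithin uniqueDiffOn_unitDisk (m := ∞) (by simp)).clm_apply contDiffOn_const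

theorem SmoothD.add {f g : ℂ → ℂ} (hf : SmoothD f) (hg : SmoothD g) :
    SmoothD (fun x => f x + g x) := ContDiffOn.add hf hg

theorem SmoothD.sub {f g : ℂ → ℂ} (hf : SmoothD f) (hg : SmoothD g) :
    SmoothD (fun x => f x - g x) := ContDiffOn.sub hf hg

theorem SmoothD.neg {f : ℂ → ℂ} (hf : SmoothD f) : SmoothD (fun x => -f x) := ContDiffOn.neg hf

theorem SmoothD.mul {f g : ℂ → ℂ} (hf : SmoothD f) (hg : SmoothD g) :
    SmoothD (fun x => f x * g x) := ContDiffOn.mul hf hg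

theorem smoothD_const (c : ℂ) : SmoothD (fun _ => c) := contDiffOn_const

theorem smoothD_re : SmoothD (fun x => (x.re : ℂ)) :=
  (Complex.ofRealCLM.contDiff.comp Complex.reCLM.contDiff).contDiffOn

theorem smoothD_im : SmoothD (fun x => (x.im : ℂ)) :=
  (Complex.ofRealCLM.contDiff.comp Complex.imCLM.contDiff).contDiffOn

theorem SmoothD.continuousOn {f : ℂ → ℂ} (hf : SmoothD f) : ContinuousOn f unitDisk :=
  ContDiffOn.continuousOn hf

theorem SmoothD.integrableOn {f : ℂ → ℂ} (hf : SmoothD f) : IntegrableOn f unitDisk :=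
  hf.continuousOn.integrableOn_compact (isCompact_closedBall _ _)

theorem SmoothD.differentiableWithinAt {f : ℂ → ℂ} (hf : SmoothD f) {x : ℂ} (hx : x ∈ unitDisk) :
    DifferentiableWithinAt ℝ f unitDisk x :=
  (ContDiffOn.differentiableOn hf (by simp)) x hx

theorem SmoothD.hasFDerivAt {f : ℂ → ℂ} (hf : SmoothD f) {x : ℂ} (hx : ‖x‖ < 1) :
    HasFDerivAt f (fderivWithin ℝ f unitDisk x) x :=
  (hf.differentiableWithinAt (by simpa using hx.le)).hasFDerivWithinAt.hasFDerivAt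
    (closedBall_mem_nhds_of_mem (by simpa using hx))

theorem dirD_add {f g : ℂ → ℂ} (hf : SmoothD f) (hg : SmoothD g) (v : ℂ) {x : ℂ}
    (hx : x ∈ unitDisk) : dirD v (fun x => f x + g x) x = dirD v f x + dirD v g x := by
  rw [dirD, fderivWithin_fun_add (uniqueDiffOn_unitDisk x hx) (hf.differentiableWithinAt hx)
    (hg.differentiableWithinAt hx)]
  rfl

theorem dirD_sub {f g : ℂ → ℂ} (hf : SmoothD f) (hg : SmoothD g) (v : ℂ) {x : ℂ}
    (hx : x ∈ unitDisk) : dirD v (fun x => f x - g x) x = dirD v f x - dirD v g x := by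
  rw [dirD, fderivWithin_fun_sub (uniqueDiffOn_unitDisk x hx) (hf.differentiableWithinAt hx)
    (hg.differentiableWithinAt hx)]
  rfl

theorem dirD_mul {f g : ℂ → ℂ} (hf : SmoothD f) (hg : SmoothD g) (v : ℂ) {x : ℂ}
    (hx : x ∈ unitDisk) :
    dirD v (fun x => f x * g x) x = dirD v f x * g x + f x * dirD v g x := by
  rw [dirD, fderivWithin_fun_mul (uniqueDiffOn_unitDisk x hx) (hf.differentiableWithinAt hx)
    (hg.differentiableWithinAt hx)]
  simp [dirD]
  ring

theorem dirD_const (c v x : ℂ) : dirD v (fun _ => c) x = 0 := by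
  simp [dirD]

theorem dirD_clm (ℓ : ℂ →L[ℝ] ℂ) (v : ℂ) {x : ℂ} (hx : x ∈ unitDisk) :
    dirD v (fun x => ℓ x) x = ℓ v := by
  rw [dirD, ℓ.hasFDerivWithinAt.fderivWithin (uniqueDiffOn_unitDisk x hx)]

theorem dirD_re (v : ℂ) {x : ℂ} (hx : x ∈ unitDisk) : dirD v (fun x => (x.re : ℂ)) x = v.re :=
  dirD_clm (Complex.ofRealCLM.comp Complex.reCLM) v hx

theorem dirD_im (v : ℂ) {x : ℂ} (hx : x ∈ unitDisk) : dirD v (fun x => (x.im : ℂ)) x = v.im :=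
  dirD_clm (Complex.ofRealCLM.comp Complex.imCLM) v hx

theorem dirD_eq (v : ℂ) (f : ℂ → ℂ) (x : ℂ) :
    dirD v f x = v.re * dirD 1 f x + v.im * dirD Complex.I f x := by
  have : v = v.re • (1 : ℂ) + v.im • Complex.I := by
    simp [Complex.re_add_im]
  conv_lhs => rw [this]
  rw [dirD, map_add, map_smul, map_smul, Complex.real_smul, Complex.real_smul, dirD, dirD]

theorem dirD_congr {f g : ℂ → ℂ} (h : Set.EqOn f g unitDisk) (v : ℂ) :
    Set.EqOn (dirD v f) (dirD v g) unitDisk := fun x hx => by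
  rw [dirD, dirD, fderivWithin_congr h (h hx)]

/-- The rotation field. -/
def rotD (f : ℂ → ℂ) (x : ℂ) : ℂ := x.re * dirD Complex.I f x - x.im * dirD 1 f x

theorem rotD_eq (f : ℂ → ℂ) (x : ℂ) :
    rotD f x = fderivWithin ℝ f unitDisk x (x * Complex.I) := by
  have := dirD_eq (x * Complex.I) f x
  rw [dirD] at this
  rw [this, rotD]
  simp
  ring

theorem SmoothD.rotD {f : ℂ → ℂ} (hf : SmoothD f) : SmoothD (rotD f) :=
  (smoothD_re.mul (hf.dirD _)).sub (smoothD_im.mul (hf.dirD _))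

theorem rotD_congr {f g : ℂ → ℂ} (h : Set.EqOn f g unitDisk) :
    Set.EqOn (rotD f) (rotD g) unitDisk := fun x hx => by
  rw [rotD, rotD, dirD_congr h _ hx, dirD_congr h _ hx]

/-- The reference operator in Cartesian coordinates. -/
def opLc (f : ℂ → ℂ) (x : ℂ) : ℂ :=
  -((1 - (x.re * x.re + x.im * x.im)) * (dirD 1 (dirD 1 f) x + dirD Complex.I (dirD Complex.I f) x)
    - 2 * (x.re * dirD 1 f x + x.im * dirD Complex.I f x) + rotD (rotD f) x) + f x

theorem smoothD_bdryFun : SmoothD (fun x => 1 - ((x.re : ℂ) * x.re + x.im * x.im)) :=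
  (smoothD_const 1).sub ((smoothD_re.mul smoothD_re).add (smoothD_im.mul smoothD_im))

theorem SmoothD.opLc {f : ℂ → ℂ} (hf : SmoothD f) : SmoothD (opLc f) := by
  refine SmoothD.add (SmoothD.neg (SmoothD.add (SmoothD.sub (smoothD_bdryFun.mul ?_)
    ((smoothD_const 2).mul ?_)) hf.rotD.rotD)) hf
  · exact ((hf.dirD _).dirD _).add ((hf.dirD _).dirD _)
  · exact (smoothD_re.mul (hf.dirD _)).add (smoothD_im.mul (hf.dirD _))

theorem opLc_congr {f g : ℂ → ℂ} (h : Set.EqOn f g unitDisk) :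
    Set.EqOn (opLc f) (opLc g) unitDisk := fun x hx => by
  rw [opLc, opLc, dirD_congr (dirD_congr h _) _ hx, dirD_congr (dirD_congr h _) _ hx,
    dirD_congr h _ hx, dirD_congr h _ hx, rotD_congr (rotD_congr h) hx, h hx]

/-! ### Integration by parts -/

/-- The rotation by `θ` carries the vertical chords to chords in the direction of differentiation.
On each of them the integral is the difference of the values of `h` at two points of the unit
circle. -/
theorem integral_dirD_eq_zero {h : ℂ → ℂ} (hh : SmoothD h) (h0 : ∀ x, ‖x‖ = 1 → h x = 0) (θ : ℝ) :
    ∫ x in unitDisk, dirD (Complex.exp (θ * Complex.I) * Complex.I) h x = 0 := by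
  set e := Complex.exp (θ * Complex.I) with he
  have hne : ‖e‖ = 1 := Complex.norm_exp_ofReal_mul_I θ
  have hmaps : Set.MapsTo (fun x => e * x) unitDisk unitDisk := fun x hx => by
    simpa [hne] using hx
  have hc : ContinuousOn (fun x => dirD (e * Complex.I) h (e * x)) unitDisk :=
    (hh.dirD _).continuousOn.comp (by fun_prop) hmaps
  rw [← setIntegral_unitDisk_rotate _ θ, ← he, setIntegral_unitDisk hc]
  rw [intervalIntegral.integral_congr (g := fun _ => 0)]
  · simp
  intro ψ hψ
  rw [Set.uIcc_of_le Real.pi_pos.le] at hψ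
  have hs : 0 ≤ Real.sin ψ := Real.sin_nonneg_of_mem_Icc hψ
  have hnorm : ∀ u : ℝ, ‖e * (Real.cos ψ + u * Complex.I)‖ ^ 2 = Real.cos ψ ^ 2 + u ^ 2 := fun u => by
    rw [norm_mul, hne, one_mul, ← Complex.normSq_eq_norm_sq, Complex.normSq_add_mul_I]
  have hsc := Real.sin_sq_add_cos_sq ψ
  have hmem : ∀ u ∈ Set.Icc (-Real.sin ψ) (Real.sin ψ),
      e * (Real.cos ψ + u * Complex.I) ∈ unitDisk := fun u hu => by
    rw [mem_closedBall_zero_iff, ← sq_le_one_iff₀ (norm_nonneg _), hnorm]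
    nlinarith [hu.1, hu.2]
  have hcu : Continuous fun u : ℝ => e * (Real.cos ψ + u * Complex.I) := by fun_prop
  have key : ∫ u in -Real.sin ψ..Real.sin ψ,
      dirD (e * Complex.I) h (e * (Real.cos ψ + u * Complex.I)) = 0 := by
    rw [intervalIntegral.integral_eq_sub_of_hasDerivAt_of_le (neg_le_self hs)
      (f := fun u : ℝ => h (e * (Real.cos ψ + u * Complex.I)))]
    · have : ∀ u : ℝ, u ^ 2 = Real.sin ψ ^ 2 → h (e * (Real.cos ψ + u * Complex.I)) = 0 :=
        fun u hu => h0 _ (by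
          have h2 := hnorm u
          rw [hu, add_comm (Real.cos ψ ^ 2), hsc] at h2
          exact (pow_eq_one_iff_of_nonneg (norm_nonneg _) two_ne_zero).1 h2)
      rw [this _ rfl, this _ (by ring), sub_zero]
    · exact hh.continuousOn.comp hcu.continuousOn hmem
    · intro u hu
      have hlt : ‖e * (Real.cos ψ + u * Complex.I)‖ < 1 := by
        rw [← sq_lt_one_iff₀ (norm_nonneg _), hnorm]
        nlinarith [hu.1, hu.2]
      have hd : HasDerivAt (fun u : ℝ => e * (Real.cos ψ + u * Complex.I)) (e * Complex.I) u := by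
        simpa using (((Complex.ofRealCLM.hasDerivAt (x := u)).mul_const Complex.I).const_add
          (Real.cos ψ : ℂ)).const_mul e
      exact (hh.hasFDerivAt hlt).comp_hasDerivAt u hd
    · refine ContinuousOn.intervalIntegrable ?_
      rw [Set.uIcc_of_le (neg_le_self hs)]
      exact (hh.dirD _).continuousOn.comp hcu.continuousOn hmem
  simp only [key, smul_zero]

/-- No vanishing at the boundary is required since the rotation field is tangent to the circle.
Averaging over all rotations does not change the integral over the disk, and for fixed `x` the
average is that of the derivative of the periodic function `t ↦ h(e^{it} x)`. -/
theorem integral_rotD_eq_zero {h : ℂ → ℂ} (hh : SmoothD h) : ∫ x in unitDisk, rotD h x = 0 := by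
  have hmaps : Set.MapsTo (fun p : ℝ × ℂ => Complex.exp (p.1 * Complex.I) * p.2)
      (Set.Icc 0 (2 * Real.pi) ×ˢ unitDisk) unitDisk := fun p hp => by
    simpa [Complex.norm_exp_ofReal_mul_I] using hp.2
  have hcont : ContinuousOn (fun p : ℝ × ℂ => rotD h (Complex.exp (p.1 * Complex.I) * p.2))
      (Set.Icc 0 (2 * Real.pi) ×ˢ unitDisk) :=
    hh.rotD.continuousOn.comp (by fun_prop) hmaps
  have hint := hcont.integrableOn_compact (μ := volume)
    (isCompact_Icc.prod (isCompact_closedBall (0 : ℂ) 1))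
  rw [IntegrableOn, Measure.volume_eq_prod, ← Measure.prod_restrict] at hint
  have hswap := integral_integral_swap (f := fun (t : ℝ) (x : ℂ) =>
    rotD h (Complex.exp (t * Complex.I) * x)) hint
  have h1 : ∀ t : ℝ, ∫ x in unitDisk, rotD h (Complex.exp (t * Complex.I) * x) =
      ∫ x in unitDisk, rotD h x := fun t => setIntegral_unitDisk_rotate _ t
  -- The boundary circle is discarded as a null set, so that two-sided derivatives are available.
  have h2 : ∀ᵐ x ∂(volume.restrict unitDisk),
      ∫ t in Set.Icc 0 (2 * Real.pi), rotD h (Complex.exp (t * Complex.I) * x) = 0 := by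
    have hb : ∀ᵐ x ∂(volume.restrict unitDisk), x ∈ ball (0 : ℂ) 1 := by
      have hsph : ∀ᵐ x : ℂ, x ∉ sphere (0 : ℂ) 1 :=
        measure_eq_zero_iff_ae_notMem.1 (Measure.addHaar_sphere volume 0 1)
      filter_upwards [ae_restrict_mem measurableSet_closedBall, ae_restrict_of_ae hsph] with x h1 h2
      exact (ball_union_sphere.ge h1).resolve_right h2
    filter_upwards [hb] with x hx
    have hn : ∀ t : ℝ, ‖Complex.exp (t * Complex.I) * x‖ < 1 := fun t => by
      simpa [Complex.norm_exp_ofReal_mul_I] using hx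
    rw [integral_Icc_eq_integral_Ioc, ← intervalIntegral.integral_of_le (by positivity),
      intervalIntegral.integral_eq_sub_of_hasDerivAt
        (f := fun t : ℝ => h (Complex.exp (t * Complex.I) * x))]
    · simp
    · intro t _
      rw [rotD_eq]
      refine (hh.hasFDerivAt (hn t)).comp_hasDerivAt t ?_
      have := (((Complex.ofRealCLM.hasDerivAt (x := t)).mul_const Complex.I).cexp).mul_const x
      convert! this using 1
      simp
      ring
    · refine Continuous.intervalIntegrable ?_ _ _
      rw [continuous_iff_continuousAt]
      intro t
      have hc : ContinuousAt (rotD h) (Complex.exp (t * Complex.I) * x) :=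
        hh.rotD.continuousOn.continuousAt (closedBall_mem_nhds_of_mem (by simpa using hn t))
      exact ContinuousAt.comp (f := fun t : ℝ => Complex.exp (t * Complex.I) * x) hc
        (by fun_prop)
  rw [integral_congr_ae h2] at hswap
  simp_rw [h1] at hswap
  simp only [integral_zero, setIntegral_const, smul_eq_zero] at hswap
  exact hswap.resolve_left (by simp [Real.pi_pos])

/-- In divergence form `opLc f = -(div((1 - |x|²) ∇f) + rotD² f) + f`. The fluxes in Green's formula
carry the factor `1 - |x|²`, zero on the circle, and the rotation term integrates to zero by itself;
so `f` and `g` need not satisfy boundary conditions. -/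
theorem integral_opLc_mul {f g : ℂ → ℂ} (hf : SmoothD f) (hg : SmoothD g) :
    ∫ x in unitDisk, opLc f x * g x = ∫ x in unitDisk, f x * opLc g x := by
  let q : ℂ → ℂ := fun x => 1 - ((x.re : ℂ) * x.re + x.im * x.im)
  have hq : SmoothD q := smoothD_bdryFun
  let A : ℂ → ℂ → ℂ := fun v x => q x * (dirD v f x * g x - f x * dirD v g x)
  let B : ℂ → ℂ := fun x => rotD f x * g x - f x * rotD g x
  have hA' : ∀ v, SmoothD (fun x => dirD v f x * g x - f x * dirD v g x) := fun v =>
    ((hf.dirD v).mul hg).sub (hf.mul (hg.dirD v))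
  have hA : ∀ v, SmoothD (A v) := fun v => hq.mul (hA' v)
  have hB : SmoothD B := (hf.rotD.mul hg).sub (hf.mul hg.rotD)
  have hA0 : ∀ v x, ‖x‖ = 1 → A v x = 0 := fun v x hx => by
    have : q x = 0 := by
      have h1 : x.re * x.re + x.im * x.im = 1 := by
        rw [← Complex.normSq_apply, Complex.normSq_eq_norm_sq, hx, one_pow]
      simp only [q]
      rw [sub_eq_zero]
      exact_mod_cast h1.symm
    simp [A, this]
  -- The direction `1` is `e^{iθ} i` for `θ = -π/2`.
  have h1 : ∫ x in unitDisk, dirD 1 (A 1) x = 0 := by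
    have := integral_dirD_eq_zero (hA 1) (hA0 1) (-(Real.pi / 2))
    convert this using 4
    push_cast
    rw [neg_mul, Complex.exp_neg, Complex.exp_pi_div_two_mul_I]
    simp
  have h2 : ∫ x in unitDisk, dirD Complex.I (A Complex.I) x = 0 := by
    simpa using integral_dirD_eq_zero (hA Complex.I) (hA0 Complex.I) 0
  have h3 := integral_rotD_eq_zero hB
  have hqd : ∀ v x, x ∈ unitDisk → dirD v q x = -2 * (v.re * x.re + v.im * x.im) := fun v x hx => by
    have e1 := dirD_sub (smoothD_const 1)
      ((smoothD_re.mul smoothD_re).add (smoothD_im.mul smoothD_im)) v hx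
    rw [dirD_add (smoothD_re.mul smoothD_re) (smoothD_im.mul smoothD_im) v hx,
      dirD_mul smoothD_re smoothD_re v hx, dirD_mul smoothD_im smoothD_im v hx, dirD_const,
      dirD_re v hx, dirD_im v hx] at e1
    rw [e1]
    ring
  have hAd : ∀ v x, x ∈ unitDisk → dirD v (A v) x =
      dirD v q x * (dirD v f x * g x - f x * dirD v g x) +
        q x * (dirD v (dirD v f) x * g x - f x * dirD v (dirD v g) x) := fun v x hx => by
    rw [dirD_mul hq (hA' v) v hx, dirD_sub ((hf.dirD v).mul hg) (hf.mul (hg.dirD v)) v hx,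
      dirD_mul (hf.dirD v) hg v hx, dirD_mul hf (hg.dirD v) v hx]
    ring
  have hBd : ∀ x ∈ unitDisk, rotD B x = rotD (rotD f) x * g x - f x * rotD (rotD g) x := fun x hx => by
    rw [rotD, dirD_sub (hf.rotD.mul hg) (hf.mul hg.rotD) _ hx,
      dirD_sub (hf.rotD.mul hg) (hf.mul hg.rotD) _ hx, dirD_mul hf.rotD hg _ hx,
      dirD_mul hf.rotD hg _ hx, dirD_mul hf hg.rotD _ hx, dirD_mul hf hg.rotD _ hx]
    simp only [rotD]
    ring
  rw [← sub_eq_zero, ← integral_sub (hf.opLc.mul hg).integrableOn (hf.mul hg.opLc).integrableOn]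
  have hpt : ∀ x ∈ unitDisk, opLc f x * g x - f x * opLc g x =
      -((dirD 1 (A 1) x + dirD Complex.I (A Complex.I) x) + rotD B x) := fun x hx => by
    rw [hAd 1 x hx, hAd Complex.I x hx, hBd x hx, hqd 1 x hx, hqd Complex.I x hx]
    simp only [opLc, q, Complex.one_re, Complex.one_im, Complex.I_re, Complex.I_im,
      Complex.ofReal_one, Complex.ofReal_zero]
    ring
  rw [setIntegral_congr_fun measurableSet_closedBall hpt, integral_neg, integral_add,
    integral_add, h1, h2, h3]
  · simp
  · exact ((hA _).dirD _).integrableOn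
  · exact ((hA _).dirD _).integrableOn
  · exact (((hA _).dirD _).add ((hA _).dirD _)).integrableOn
  · exact hB.rotD.integrableOn

/-! ### The operator in polar coordinates -/

/-- Differentiation along a ray is `dirD e` for the fixed unit vector `e = z/|z|`, and
differentiation along a circle is `rotD`; the rest is an algebraic identity in the Cartesian
derivatives. -/
theorem opLe_eq_opLc {f : ℂ → ℂ} (hf : SmoothD f) {z : ℂ} (h0 : 0 < ‖z‖) (h1 : ‖z‖ < 1) :
    opLe f z = opLc f z := by
  set e := z / ‖z‖ with he
  have hne : ‖e‖ = 1 := by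
    rw [he, norm_div, Complex.norm_real, norm_norm, div_self h0.ne']
  have hz : (‖z‖ : ℂ) * e = z := by
    rw [he, mul_div_cancel₀]
    exact_mod_cast h0.ne'
  have hzm : z ∈ unitDisk := by simpa using h1.le
  have hrad : ∀ {g : ℂ → ℂ}, SmoothD g → ∀ r : ℝ, |r| < 1 →
      HasDerivAt (fun r : ℝ => g (r * e)) (dirD e g (r * e)) r := fun {g} hg r hr => by
    refine (hg.hasFDerivAt (x := r * e) (by simpa [hne] using hr)).comp_hasDerivAt r ?_
    simpa using (Complex.ofRealCLM.hasDerivAt (x := r)).mul_const e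
  have hang : ∀ {g : ℂ → ℂ}, SmoothD g → ∀ t : ℝ,
      HasDerivAt (fun t : ℝ => g (z * Complex.exp (t * Complex.I)))
        (rotD g (z * Complex.exp (t * Complex.I))) t := fun {g} hg t => by
    rw [rotD_eq]
    refine (hg.hasFDerivAt (x := z * Complex.exp (t * Complex.I))
      (by simpa [Complex.norm_exp_ofReal_mul_I] using h1)).comp_hasDerivAt t ?_
    have := (((Complex.ofRealCLM.hasDerivAt (x := t)).mul_const Complex.I).cexp).const_mul z
    convert! this using 1
    simp
    ring
  have hd1 : deriv (fun r : ℝ => f (r * e)) ‖z‖ = dirD e f z := by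
    rw [(hrad hf ‖z‖ (by simpa using h1)).deriv, hz]
  have hd2 : iteratedDeriv 2 (fun r : ℝ => f (r * e)) ‖z‖ = dirD e (dirD e f) z := by
    have hev : deriv (fun r : ℝ => f (r * e)) =ᶠ[nhds ‖z‖] fun r : ℝ => dirD e f (r * e) := by
      have : Set.Ioo (-1 : ℝ) 1 ∈ nhds ‖z‖ := Ioo_mem_nhds (by linarith) h1
      filter_upwards [this] with r hr
      exact (hrad hf r (abs_lt.2 hr)).deriv
    rw [iteratedDeriv_succ, iteratedDeriv_one, hev.deriv_eq,
      (hrad (hf.dirD e) ‖z‖ (by simpa using h1)).deriv, hz]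
  have hd3 : iteratedDeriv 2 (fun t : ℝ => f (z * Complex.exp (t * Complex.I))) 0 =
      rotD (rotD f) z := by
    rw [iteratedDeriv_succ, iteratedDeriv_one, funext fun t => (hang hf t).deriv,
      (hang hf.rotD 0).deriv]
    simp
  have hexp : dirD e (dirD e f) z =
      e.re * e.re * dirD 1 (dirD 1 f) z + e.re * e.im * dirD 1 (dirD Complex.I f) z
      + (e.im * e.re * dirD Complex.I (dirD 1 f) z
        + e.im * e.im * dirD Complex.I (dirD Complex.I f) z) := by
    have hfun : dirD e f = fun x => (e.re : ℂ) * dirD 1 f x + e.im * dirD Complex.I f x :=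
      funext fun x => dirD_eq e f x
    have s1 := (smoothD_const e.re).mul (hf.dirD 1)
    have s2 := (smoothD_const e.im).mul (hf.dirD Complex.I)
    rw [dirD_eq e (dirD e f), hfun, dirD_add s1 s2 _ hzm, dirD_add s1 s2 _ hzm]
    simp only [dirD_mul (smoothD_const _) (hf.dirD _) _ hzm, dirD_const]
    ring
  have hrr : rotD (rotD f) z =
      z.re * (dirD Complex.I f z * 0 + z.re * dirD Complex.I (dirD Complex.I f) z
        - (dirD 1 f z + z.im * dirD Complex.I (dirD 1 f) z))
      - z.im * (dirD Complex.I f z + z.re * dirD 1 (dirD Complex.I f) z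
        - z.im * dirD 1 (dirD 1 f) z) := by
    have s1 := smoothD_re.mul (hf.dirD Complex.I)
    have s2 := smoothD_im.mul (hf.dirD 1)
    have hfun : rotD f = fun x => (x.re : ℂ) * dirD Complex.I f x - x.im * dirD 1 f x := rfl
    rw [rotD, hfun, dirD_sub s1 s2 _ hzm, dirD_sub s1 s2 _ hzm,
      dirD_mul smoothD_re (hf.dirD _) _ hzm, dirD_mul smoothD_im (hf.dirD _) _ hzm,
      dirD_mul smoothD_re (hf.dirD _) _ hzm, dirD_mul smoothD_im (hf.dirD _) _ hzm,
      dirD_re _ hzm, dirD_im _ hzm, dirD_re _ hzm, dirD_im _ hzm]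
    simp
  have hzre : (z.re : ℂ) = ‖z‖ * e.re := by
    conv_lhs => rw [← hz]
    simp
  have hzim : (z.im : ℂ) = ‖z‖ * e.im := by
    conv_lhs => rw [← hz]
    simp
  have hee : (e.re : ℂ) * e.re + e.im * e.im = 1 := by
    have h1 : e.re * e.re + e.im * e.im = 1 := by
      rw [← Complex.normSq_apply, Complex.normSq_eq_norm_sq, hne, one_pow]
    exact_mod_cast h1
  have hρ : (‖z‖ : ℂ) ≠ 0 := by exact_mod_cast h0.ne'
  rw [opLe, ← he, hd1, hd2, hd3, opLc, hexp, hrr, dirD_eq e, hzre, hzim]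
  generalize dirD 1 (dirD 1 f) z = a11
  generalize dirD Complex.I (dirD Complex.I f) z = a22
  -- The two mixed derivatives enter with equal coefficients, so their equality is not needed and
  -- they stay independent.
  generalize dirD 1 (dirD Complex.I f) z = a12
  generalize dirD Complex.I (dirD 1 f) z = a21
  generalize dirD 1 f z = b1
  generalize dirD Complex.I f z = b2
  generalize (e.re : ℂ) = c at *
  generalize (e.im : ℂ) = s at *
  push_cast
  generalize (‖z‖ : ℂ) = ρ at *
  field_simp
  have hs : s ^ 2 = 1 - c ^ 2 := by linear_combination hee
  have hs3 : s ^ 3 = s * (1 - c ^ 2) := by rw [← hs]; ring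
  have hs4 : s ^ 4 = (1 - c ^ 2) ^ 2 := by rw [← hs]; ring
  ring_nf
  simp only [hs]
  ring

/-! ### The ridge basis diagonalizes the operator -/

theorem dirD_comp_ridge {p : ℝ → ℝ} (hp : Differentiable ℝ p) (δ : ℝ) (v : ℂ) {x : ℂ}
    (hx : x ∈ unitDisk) :
    dirD v (fun x => (p (x.re * Real.cos δ + x.im * Real.sin δ) : ℂ)) x =
      (v.re * Real.cos δ + v.im * Real.sin δ) *
        (deriv p (x.re * Real.cos δ + x.im * Real.sin δ) : ℝ) := by
  let ℓ : ℂ →L[ℝ] ℝ := Real.cos δ • Complex.reCLM + Real.sin δ • Complex.imCLM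
  have hℓ : ∀ y : ℂ, ℓ y = y.re * Real.cos δ + y.im * Real.sin δ := fun y => by
    simp [ℓ]; ring
  have h := (Complex.ofRealCLM.hasFDerivAt (x := p (ℓ x))).comp x
    ((hp (ℓ x)).hasDerivAt.hasFDerivAt.comp x ℓ.hasFDerivAt)
  have h2 : (fun x : ℂ => (p (x.re * Real.cos δ + x.im * Real.sin δ) : ℂ)) =
      (Complex.ofRealCLM ∘ p ∘ ℓ) := by
    ext y
    simp [hℓ]
  rw [dirD, h2, h.hasFDerivWithinAt.fderivWithin (uniqueDiffOn_unitDisk x hx), ← hℓ]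
  simp [hℓ]

/-- Let `ℓ` be the coordinate along `e^{iδ}` and `m` the one across it, so that `|x|² = ℓ² + m²`. On
a ridge `rotD²` gives `m² f'' - ℓ f'`, whose first term cancels the `-m² f''` of `(1 - |x|²) Δ`.
What remains is `(1 - ℓ²) f'' - 3 ℓ f'`, the Chebyshev operator. -/
theorem opLc_ridge (n : ℕ) (δ : ℝ) {x : ℂ} (hx : x ∈ unitDisk) :
    opLc (fun x => (ridge n δ x : ℂ)) x = ((n : ℂ) + 1) ^ 2 * ridge n δ x := by
  let ℓ : ℂ → ℝ := fun x => x.re * Real.cos δ + x.im * Real.sin δ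
  set f : ℂ → ℂ := fun x => (ridge n δ x : ℂ) with hf
  let f1 : ℂ → ℂ := fun x => (deriv (chebU n) (ℓ x) : ℝ)
  let f2 : ℂ → ℂ := fun x => (iteratedDeriv 2 (chebU n) (ℓ x) : ℝ)
  have hC := contDiff_chebU n
  have hC1 : ContDiff ℝ ∞ (deriv (chebU n)) := by
    have := (contDiff_infty_iff_deriv.1 hC).2
    exact this
  have hℓs : ContDiff ℝ ∞ ℓ :=
    (Complex.reCLM.contDiff.mul contDiff_const).add (Complex.imCLM.contDiff.mul contDiff_const)
  have hfs : SmoothD f := (Complex.ofRealCLM.contDiff.comp (contDiff_ridge n δ)).contDiffOn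
  have hf1s : SmoothD f1 := (Complex.ofRealCLM.contDiff.comp (hC1.comp hℓs)).contDiffOn
  have d1 : ∀ v x, x ∈ unitDisk → dirD v f x = (v.re * Real.cos δ + v.im * Real.sin δ) * f1 x :=
    fun v x hx => dirD_comp_ridge (hC.differentiable (by simp)) δ v hx
  have d2 : ∀ v x, x ∈ unitDisk → dirD v f1 x = (v.re * Real.cos δ + v.im * Real.sin δ) * f2 x :=
    fun v x hx => by
      have := dirD_comp_ridge (hC1.differentiable (by simp)) δ v hx
      rw [← iteratedDeriv_one, ← iteratedDeriv_succ, iteratedDeriv_one] at this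
      exact this
  have dd : ∀ v, dirD v (dirD v f) x =
      (v.re * Real.cos δ + v.im * Real.sin δ) * ((v.re * Real.cos δ + v.im * Real.sin δ) * f2 x) :=
    fun v => by
      rw [dirD_congr (fun x hx => d1 v x hx) v hx, dirD_mul (smoothD_const _) hf1s _ hx, dirD_const,
        d2 v x hx]
      ring
  have hs : SmoothD (fun x => (x.re : ℂ) * Real.sin δ - x.im * Real.cos δ) :=
    (smoothD_re.mul (smoothD_const _)).sub (smoothD_im.mul (smoothD_const _))
  have hds : ∀ v, dirD v (fun x => (x.re : ℂ) * Real.sin δ - x.im * Real.cos δ) x =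
      v.re * Real.sin δ - v.im * Real.cos δ := fun v => by
    rw [dirD_sub (smoothD_re.mul (smoothD_const _)) (smoothD_im.mul (smoothD_const _)) _ hx,
      dirD_mul smoothD_re (smoothD_const _) _ hx, dirD_mul smoothD_im (smoothD_const _) _ hx,
      dirD_const, dirD_const, dirD_re _ hx, dirD_im _ hx]
    ring
  have hrot : Set.EqOn (rotD f) (fun x => ((x.re : ℂ) * Real.sin δ - x.im * Real.cos δ) * f1 x)
      unitDisk := fun x hx => by
    rw [rotD, d1 _ x hx, d1 _ x hx]
    simp
    ring
  have hrr : rotD (rotD f) x = ((x.re : ℂ) * Real.sin δ - x.im * Real.cos δ) ^ 2 * f2 x -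
      (x.re * Real.cos δ + x.im * Real.sin δ) * f1 x := by
    rw [rotD_congr hrot hx, rotD, dirD_mul hs hf1s _ hx, dirD_mul hs hf1s _ hx, hds, hds, d2 _ x hx,
      d2 _ x hx]
    simp
    ring
  have hode : (1 - (x.re * Real.cos δ + x.im * Real.sin δ : ℂ) ^ 2) * f2 x
      - 3 * (x.re * Real.cos δ + x.im * Real.sin δ) * f1 x + (((n : ℂ) + 1) ^ 2 - 1) * f x = 0 := by
    have := chebU_ode n (ℓ x)
    simp only [f1, f2, hf, ridge]
    simp only [ℓ] at this ⊢
    exact_mod_cast this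
  have hsc : (Real.sin δ : ℂ) ^ 2 + (Real.cos δ : ℂ) ^ 2 = 1 := by
    exact_mod_cast Real.sin_sq_add_cos_sq δ
  have hfx : (ridge n δ x : ℂ) = f x := rfl
  rw [hfx, opLc, dd, dd, hrr, d1 1 x hx, d1 Complex.I x hx]
  simp only [Complex.one_re, Complex.one_im, Complex.I_re, Complex.I_im, Complex.ofReal_one,
    Complex.ofReal_zero, one_mul, zero_mul, add_zero, zero_add]
  generalize (Real.sin δ : ℂ) = s at *
  generalize (Real.cos δ : ℂ) = c at *
  generalize f x = y at *
  generalize f1 x = y1 at *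
  generalize f2 x = y2 at *
  linear_combination (-1) * hode - (1 - 0) * y2 * hsc
    
theorem smoothD_cbasis (i : ℕ × ℕ) : SmoothD (cbasis i) := (contDiff_cbasis i).contDiffOn

theorem opLc_cbasis (i : ℕ × ℕ) {x : ℂ} (hx : x ∈ unitDisk) :
    opLc (cbasis i) x = ((deg i : ℂ) + 1) ^ 2 * cbasis i x := opLc_ridge _ _ hx

theorem integral_opLc_mul_cbasis {f : ℂ → ℂ} (hf : SmoothD f) (i : ℕ × ℕ) :
    ∫ x in unitDisk, opLc f x * cbasis i x =
      ((deg i : ℂ) + 1) ^ 2 * ∫ x in unitDisk, f x * cbasis i x := by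
  rw [integral_opLc_mul hf (smoothD_cbasis i), ← integral_const_mul]
  refine setIntegral_congr_fun measurableSet_closedBall fun x hx => ?_
  simp only [opLc_cbasis i hx]
  ring

/-! ### Rapid decay of the coefficients of smooth functions. -/

/-- Rapid decay of a family indexed by the ridge basis. -/
def RapidDecay (a : ℕ × ℕ → ℂ) : Prop := ∀ k : ℕ, ∃ C : ℝ, ∀ i, ‖a i‖ * ((deg i : ℝ) + 1) ^ k ≤ C

theorem norm_cbasis_le (i : ℕ × ℕ) {x : ℂ} (hx : x ∈ unitDisk) :
    ‖cbasis i x‖ ≤ (deg i : ℝ) + 1 := by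
  simpa [cbasis] using abs_ridgeBasis_le i (by simpa using hx)

/-- By symmetry each application of `opLc` to `f` multiplies the coefficients by `(deg + 1)²`, while
the coefficients of any smooth function are `O(deg + 1)`. -/
theorem rapidDecay_integral_cbasis {f : ℂ → ℂ} (hf : SmoothD f) :
    RapidDecay fun i => ∫ x in unitDisk, f x * cbasis i x := by
  have base : ∀ f : ℂ → ℂ, SmoothD f → ∃ C : ℝ, ∀ i,
      ‖∫ x in unitDisk, f x * cbasis i x‖ ≤ C * ((deg i : ℝ) + 1) := fun f hf => by
    obtain ⟨C, hC⟩ := (isCompact_closedBall (0 : ℂ) 1).exists_bound_of_continuousOn hf.continuousOn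
    have hC0 : 0 ≤ C := (norm_nonneg _).trans (hC 0 (by simp))
    refine ⟨C * volume.real unitDisk, fun i => ?_⟩
    have := norm_setIntegral_le_of_norm_le_const (μ := volume) (s := unitDisk)
      (f := fun x => f x * cbasis i x) (C := C * ((deg i : ℝ) + 1))
      measure_closedBall_lt_top (fun x hx => by
        rw [norm_mul]
        exact mul_le_mul (hC x hx) (norm_cbasis_le i hx) (norm_nonneg _) hC0)
    linarith
  have step : ∀ k : ℕ, ∀ f : ℂ → ℂ, SmoothD f → ∃ C : ℝ, ∀ i,
      ‖∫ x in unitDisk, f x * cbasis i x‖ * ((deg i : ℝ) + 1) ^ (2 * k) ≤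
        C * ((deg i : ℝ) + 1) := fun k => by
    induction k with
    | zero => simpa using base
    | succ k ih =>
      intro f hf
      obtain ⟨C, hC⟩ := ih _ hf.opLc
      refine ⟨C, fun i => ?_⟩
      have := hC i
      rw [integral_opLc_mul_cbasis hf, norm_mul, norm_pow] at this
      have hn : ‖(deg i : ℂ) + 1‖ = (deg i : ℝ) + 1 := by
        rw [← Nat.cast_succ, Complex.norm_natCast, Nat.cast_succ]
      rw [hn] at this
      calc _ = _ := by ring
        _ ≤ _ := this
  intro k
  -- With `k+1` applications the weight `(deg + 1)^(2k+2)` dominates `(deg + 1)^(k+1)`, and the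
  -- extra factor `deg + 1` cancels the one on the right.
  obtain ⟨C, hC⟩ := step (k + 1) f hf
  refine ⟨C, fun i => ?_⟩
  have h1 : (1 : ℝ) ≤ (deg i : ℝ) + 1 := by
    have : (0 : ℝ) ≤ deg i := Nat.cast_nonneg _
    linarith
  have h2 : ‖∫ x in unitDisk, f x * cbasis i x‖ * ((deg i : ℝ) + 1) ^ k * ((deg i : ℝ) + 1) ≤
      C * ((deg i : ℝ) + 1) := by
    refine le_trans ?_ (hC i)
    rw [mul_assoc, ← pow_succ]
    gcongr
    omega
  exact le_of_mul_le_mul_right h2 (by linarith)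

/-! ### Smoothness of series on convex sets -/

/-- Termwise differentiation on a set that need not be open, here the closed disk. By the mean value
inequality on a convex set the normalised remainders of the `i`-th term are at most `2 u i`; each
tends to zero, and dominated convergence applies to their sum. -/
theorem hasFDerivWithinAt_tsum_of_convex {ι E F : Type*} [NormedAddCommGroup E] [NormedSpace ℝ E]
    [NormedAddCommGroup F] [NormedSpace ℝ F] [CompleteSpace F] {s : Set E} (hs : Convex ℝ s)
    {f : ι → E → F} {f' : ι → E → E →L[ℝ] F} {u : ι → ℝ} (hu : Summable u)
    (hf : ∀ i, ∀ x ∈ s, HasFDerivWithinAt (f i) (f' i x) s x)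
    (hf' : ∀ i, ∀ x ∈ s, ‖f' i x‖ ≤ u i) (hsum : ∀ x ∈ s, Summable fun i => f i x) {x : E}
    (hx : x ∈ s) :
    HasFDerivWithinAt (fun y => ∑' i, f i y) (∑' i, f' i x) s x := by
  rw [hasFDerivWithinAt_iff_tendsto]
  have hsum' : Summable fun i => f' i x := Summable.of_norm_bounded hu fun i => hf' i x hx
  let r : E → ι → ℝ := fun y i => ‖y - x‖⁻¹ * ‖f i y - f i x - f' i x (y - x)‖
  have hr0 : ∀ y i, 0 ≤ r y i := fun y i => by positivity
  have hrb : ∀ y ∈ s, ∀ i, r y i ≤ 2 * u i := fun y hy i => by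
    have h1 := hs.norm_image_sub_le_of_norm_hasFDerivWithin_le (hf i) (hf' i) hx hy
    have h2 : ‖f' i x (y - x)‖ ≤ u i * ‖y - x‖ := (f' i x).le_of_opNorm_le (hf' i x hx) _
    have h3 := norm_sub_le (f i y - f i x) (f' i x (y - x))
    have h4 : 0 ≤ u i := (norm_nonneg _).trans (hf' i x hx)
    -- At `y = x` the factor `‖y - x‖⁻¹` is zero by convention, so the remainder vanishes there.
    rcases eq_or_ne y x with h | h
    · simp [r, h, h4]
    · have h5 : 0 < ‖y - x‖ := norm_pos_iff.2 (sub_ne_zero.2 h)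
      rw [inv_mul_le_iff₀ h5]
      linarith
  have hlim : Filter.Tendsto (fun y => ∑' i, r y i) (nhdsWithin x s) (nhds (∑' _ : ι, (0 : ℝ))) := by
    refine tendsto_tsum_of_dominated_convergence (hu.mul_left 2)
      (fun i => hasFDerivWithinAt_iff_tendsto.1 (hf i x hx)) ?_
    filter_upwards [self_mem_nhdsWithin] with y hy i
    rw [Real.norm_of_nonneg (hr0 y i)]
    exact hrb y hy i
  rw [tsum_zero] at hlim
  refine squeeze_zero' (Filter.Eventually.of_forall fun y => by positivity) ?_ hlim
  filter_upwards [self_mem_nhdsWithin] with y hy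
  have hsr : Summable (r y) :=
    Summable.of_nonneg_of_le (hr0 y) (hrb y hy) (hu.mul_left 2)
  have happ : (∑' i, f' i x) (y - x) = ∑' i, f' i x (y - x) :=
    (ContinuousLinearMap.apply ℝ F (y - x)).map_tsum hsum'
  have hsapp : Summable fun i => f' i x (y - x) :=
    (ContinuousLinearMap.apply ℝ F (y - x)).summable hsum'
  rw [happ, ← (hsum y hy).tsum_sub (hsum x hx),
    ← ((hsum y hy).sub (hsum x hx)).tsum_sub hsapp]
  rcases eq_or_ne y x with h | h
  · simp [r, h]
  · have h5 : 0 < ‖y - x‖ := norm_pos_iff.2 (sub_ne_zero.2 h)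
    rw [inv_mul_le_iff₀ h5, ← tsum_mul_left]
    have h6 : ∀ i, ‖f i y - f i x - f' i x (y - x)‖ = ‖y - x‖ * r y i := fun i => by
      rw [mul_inv_cancel_left₀ h5.ne']
    simp_rw [← h6]
    refine norm_tsum_le_tsum_norm ?_
    simp_rw [h6]
    exact hsr.mul_left _

/-- The termwise sums of the iterated derivatives form a Taylor series on `s`, by the preceding
lemma at every order. -/
theorem contDiffOn_tsum_of_convex {ι E F : Type*} [NormedAddCommGroup E] [NormedSpace ℝ E]
    [NormedAddCommGroup F] [NormedSpace ℝ F] [CompleteSpace F] {s : Set E} (hs : Convex ℝ s)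
    {f : ι → E → F} {u : ℕ → ι → ℝ} (hu : ∀ k, Summable (u k)) (hf : ∀ i, ContDiff ℝ ∞ (f i))
    (hb : ∀ k i, ∀ x ∈ s, ‖iteratedFDeriv ℝ k (f i) x‖ ≤ u k i) :
    ContDiffOn ℝ ∞ (fun x => ∑' i, f i x) s := by
  have hft : ∀ i, HasFTaylorSeriesUpTo ∞ (f i) (ftaylorSeries ℝ (f i)) := fun i =>
    (hf i).ftaylorSeries
  have hsum : ∀ k, ∀ x ∈ s, Summable fun i => iteratedFDeriv ℝ k (f i) x := fun k x hx =>
    Summable.of_norm_bounded (hu k) fun i => hb k i x hx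
  have hT : HasFTaylorSeriesUpToOn ((⊤ : ℕ∞) : WithTop ℕ∞) (fun x => ∑' i, f i x)
      (fun x k => ∑' i, iteratedFDeriv ℝ k (f i) x) s := by
    refine ⟨fun x hx => ?_, fun m _ x hx => ?_, fun m _ => ?_⟩
    · exact (continuousMultilinearCurryFin0 ℝ E
        F).toContinuousLinearEquiv.toContinuousLinearMap.map_tsum (hsum 0 x hx)
    · have h := hasFDerivWithinAt_tsum_of_convex hs (f := fun i => iteratedFDeriv ℝ m (f i))
        (f' := fun i x => (iteratedFDeriv ℝ (m + 1) (f i) x).curryLeft) (hu (m + 1))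
        (fun i x _ => ((hft i).fderiv m (by exact_mod_cast ENat.natCast_lt_top m) x).hasFDerivWithinAt)
        (fun i x hx => by
          rw [ContinuousMultilinearMap.curryLeft_norm]
          exact hb (m + 1) i x hx) (hsum m) hx
      have e : (∑' i, iteratedFDeriv ℝ (m + 1) (f i) x).curryLeft =
          ∑' i, (iteratedFDeriv ℝ (m + 1) (f i) x).curryLeft :=
        (continuousMultilinearCurryLeftEquiv ℝ (fun _ : Fin (m + 1) => E)
          F).toContinuousLinearEquiv.toContinuousLinearMap.map_tsum (hsum (m + 1) x hx)
      change HasFDerivWithinAt _ ((∑' i, iteratedFDeriv ℝ (m + 1) (f i) x).curryLeft) s x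
      rw [e]
      exact h
    · exact continuousOn_tsum (fun i => ((hf i).continuous_iteratedFDeriv
        (by exact_mod_cast le_top)).continuousOn) (hu m) (hb m)
  exact hT.contDiffOn

/-! ### Rapidly decaying families -/

theorem one_le_deg_add_one (i : ℕ × ℕ) : (1 : ℝ) ≤ (deg i : ℝ) + 1 := by
  have : (0 : ℝ) ≤ deg i := Nat.cast_nonneg _
  linarith

/-- Both `i.1 + 1` and `i.2 + 1` are at most `deg i + 1`, which leaves a product of two convergent
series in one index. -/
theorem summable_deg : Summable fun i : ℕ × ℕ => (((deg i : ℝ) + 1) ^ 4)⁻¹ := by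
  have h1 : Summable fun n : ℕ => (((n : ℝ) + 1) ^ 2)⁻¹ := by
    have := (summable_nat_add_iff 1).2 (Real.summable_nat_pow_inv.2 (one_lt_two))
    simpa using this
  have h2 := h1.mul_of_nonneg h1 (fun n => by positivity) (fun n => by positivity)
  refine Summable.of_nonneg_of_le (fun i => by positivity) (fun i => ?_) h2
  rw [← mul_inv]
  apply inv_anti₀ (by positivity)
  have e1 : ((i.1 : ℝ) + 1) ≤ (deg i : ℝ) + 1 := by
    simp only [deg]; push_cast; linarith [Nat.cast_nonneg (α := ℝ) i.2]
  have e2 : ((i.2 : ℝ) + 1) ≤ (deg i : ℝ) + 1 := by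
    simp only [deg]; push_cast; linarith [Nat.cast_nonneg (α := ℝ) i.1]
  calc ((i.1 : ℝ) + 1) ^ 2 * ((i.2 : ℝ) + 1) ^ 2 ≤ ((deg i : ℝ) + 1) ^ 2 * ((deg i : ℝ) + 1) ^ 2 := by
        gcongr
    _ = _ := by ring

theorem RapidDecay.summable {a : ℕ × ℕ → ℂ} (ha : RapidDecay a) (k : ℕ) :
    Summable fun i => ‖a i‖ * ((deg i : ℝ) + 1) ^ k := by
  obtain ⟨C, hC⟩ := ha (k + 4)
  refine Summable.of_nonneg_of_le (fun i => by positivity) (fun i => ?_) (summable_deg.mul_left C)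
  have h1 : (0 : ℝ) < ((deg i : ℝ) + 1) ^ 4 := by positivity
  rw [← div_eq_mul_inv, le_div_iff₀ h1, mul_assoc, ← pow_add]
  exact hC i

theorem RapidDecay.mul_of_le {a c : ℕ × ℕ → ℂ} (ha : RapidDecay a) (m : ℕ) (K : ℝ)
    (hc : ∀ i, ‖c i‖ ≤ K * ((deg i : ℝ) + 1) ^ m) : RapidDecay fun i => c i * a i := fun k => by
  obtain ⟨C, hC⟩ := ha (k + m)
  have hK : 0 ≤ K := by
    have := (norm_nonneg _).trans (hc 0)
    have h1 : (0 : ℝ) < ((deg 0 : ℝ) + 1) ^ m := by positivity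
    exact nonneg_of_mul_nonneg_left this h1
  refine ⟨K * C, fun i => ?_⟩
  rw [norm_mul]
  calc ‖c i‖ * ‖a i‖ * ((deg i : ℝ) + 1) ^ k
      ≤ (K * ((deg i : ℝ) + 1) ^ m) * ‖a i‖ * ((deg i : ℝ) + 1) ^ k := by gcongr; exact hc i
    _ = K * (‖a i‖ * ((deg i : ℝ) + 1) ^ (k + m)) := by ring
    _ ≤ K * C := by gcongr; exact hC i

/-- The function on the unit disk with given coefficients in the ridge basis. -/
def synthD (a : ℕ × ℕ → ℂ) (x : ℂ) : ℂ := ∑' i, a i * cbasis i x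

theorem norm_iteratedFDeriv_cbasis_le (i : ℕ × ℕ) (k : ℕ) {x : ℂ} (hx : x ∈ unitDisk) :
    ‖iteratedFDeriv ℝ k (cbasis i) x‖ ≤ ((deg i : ℝ) + 1) ^ (2 * k + 1) := by
  have h := Complex.ofRealLI.norm_iteratedFDeriv_comp_left (f := ridgeBasis i) (x := x) (i := k)
    (n := ∞) (contDiff_ridgeBasis i).contDiffAt (by exact_mod_cast le_top)
  have he : (Complex.ofRealLI ∘ ridgeBasis i) = cbasis i := rfl
  rw [he] at h
  rw [h]
  exact norm_iteratedFDeriv_ridgeBasis_le i k (by simpa using hx)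

/-- Derivatives of order `k` of the basis grow at most like `(deg + 1)^(2k+1)`, uniformly up to the
boundary, and rapid decay absorbs this. -/
theorem RapidDecay.smoothD {a : ℕ × ℕ → ℂ} (ha : RapidDecay a) : SmoothD (synthD a) := by
  refine contDiffOn_tsum_of_convex (convex_closedBall _ _)
    (u := fun k i => ‖a i‖ * ((deg i : ℝ) + 1) ^ (2 * k + 1)) (fun k => ha.summable _)
    (fun i => contDiff_const.mul (contDiff_cbasis i)) fun k i x hx => ?_
  have h : (fun x => a i * cbasis i x) = fun x => a i • cbasis i x := rfl
  rw [h, iteratedFDeriv_const_smul_apply' ((contDiff_cbasis i).contDiffAt.of_le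
    (by exact_mod_cast le_top)), norm_smul]
  gcongr
  exact norm_iteratedFDeriv_cbasis_le i k hx

theorem RapidDecay.integral_synthD_mul {a : ℕ × ℕ → ℂ} (ha : RapidDecay a) (j : ℕ × ℕ) :
    ∫ x in unitDisk, synthD a x * cbasis j x = a j * Real.pi := by
  have h : ∀ x, synthD a x * cbasis j x = ∑' i, a i * cbasis i x * cbasis j x := fun x => by
    rw [synthD, tsum_mul_right]
  have hcont : ∀ i, Continuous fun x => a i * cbasis i x * cbasis j x := fun i => by
    have := continuous_cbasis i
    have := continuous_cbasis j
    fun_prop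
  have hb : ∀ i, ∀ x ∈ unitDisk, ‖a i * cbasis i x * cbasis j x‖ ≤
      ‖a i‖ * ((deg i : ℝ) + 1) ^ 1 * ((deg j : ℝ) + 1) := fun i x hx => by
    rw [norm_mul, norm_mul, pow_one]
    have := norm_cbasis_le i hx
    have := norm_cbasis_le j hx
    gcongr
  have hi : ∀ i, Integrable (fun x => a i * cbasis i x * cbasis j x) (volume.restrict unitDisk) :=
    fun i => (hcont i).continuousOn.integrableOn_compact (isCompact_closedBall _ _)
  simp_rw [h]
  rw [← integral_tsum_of_summable_integral_norm hi]
  · have : ∀ i, ∫ x in unitDisk, a i * cbasis i x * cbasis j x =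
        if i = j then a i * Real.pi else 0 := fun i => by
      simp_rw [mul_assoc]
      rw [integral_const_mul, integral_cbasis_mul]
      split_ifs <;> simp
    simp_rw [this]
    rw [tsum_ite_eq j (fun i => a i * (Real.pi : ℂ))]
  · refine Summable.of_nonneg_of_le (fun i => integral_nonneg fun x => norm_nonneg _) (fun i => ?_)
      (((ha.summable 1).mul_right ((deg j : ℝ) + 1)).mul_right (volume.real unitDisk))
    have := norm_setIntegral_le_of_norm_le_const (μ := volume) (s := unitDisk)
      (f := fun x => ‖a i * cbasis i x * cbasis j x‖) measure_closedBall_lt_top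
      (fun x hx => by rw [norm_norm]; exact hb i x hx)
    exact (le_abs_self _).trans this

/-! ### The map to the unit disk -/

section

variable {κ R : ℝ}

theorem abs_kappa_mul_lt {t : ℝ} (h : R ^ 2 * |κ| < 1) (h0 : 0 ≤ t) (ht : t ≤ R ^ 2) :
    |κ * t| < 1 := by
  rw [abs_mul, abs_of_nonneg h0]
  nlinarith [abs_nonneg κ]

theorem one_add_pos {z : ℂ} (h : R ^ 2 * |κ| < 1) (hz : ‖z‖ ≤ R) : 0 < 1 + κ * ‖z‖ ^ 2 := by
  have := abs_lt.1 (abs_kappa_mul_lt h (sq_nonneg ‖z‖) (by gcongr))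
  linarith

theorem one_sub_pos {z : ℂ} (h : R ^ 2 * |κ| < 1) (hz : ‖z‖ ≤ R) : 0 < 1 - κ * ‖z‖ ^ 2 := by
  have := abs_lt.1 (abs_kappa_mul_lt h (sq_nonneg ‖z‖) (by gcongr))
  linarith

theorem one_add_radius_pos (h : R ^ 2 * |κ| < 1) : 0 < 1 + κ * R ^ 2 := by
  have := abs_lt.1 (abs_kappa_mul_lt h (sq_nonneg R) le_rfl)
  linarith

theorem one_sub_radius_pos (h : R ^ 2 * |κ| < 1) : 0 < 1 - κ * R ^ 2 := by
  have := abs_lt.1 (abs_kappa_mul_lt h (sq_nonneg R) le_rfl)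
  linarith

theorem weight_pos {z : ℂ} (h : R ^ 2 * |κ| < 1) (hz : ‖z‖ ≤ R) : 0 < weight κ z :=
  div_pos (one_add_pos h hz) (one_sub_pos h hz)

theorem contDiffOn_weight (h : R ^ 2 * |κ| < 1) :
    ContDiffOn ℝ ∞ (weight κ) (closedBall (0 : ℂ) R) := by
  have hn : ContDiff ℝ ∞ fun z : ℂ => κ * ‖z‖ ^ 2 := contDiff_const.mul (contDiff_norm_sq ℝ)
  exact (contDiff_const.add hn).contDiffOn.div (contDiff_const.sub hn).contDiffOn
    fun z hz => (one_sub_pos h (by simpa using hz)).ne'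

theorem continuousOn_weight (h : R ^ 2 * |κ| < 1) :
    ContinuousOn (weight κ) (closedBall (0 : ℂ) R) := (contDiffOn_weight h).continuousOn

/-- The scale of the projective model. -/
def scale (κ R : ℝ) : ℝ := R / (1 - κ * R ^ 2)

theorem scale_pos (hR : 0 < R) (h : R ^ 2 * |κ| < 1) : 0 < scale κ R :=
  div_pos hR (one_sub_radius_pos h)

theorem norm_Phi (hR : 0 < R) (h : R ^ 2 * |κ| < 1) {z : ℂ} (hz : ‖z‖ ≤ R) :
    scale κ R * ‖Phi κ R z‖ = ‖z‖ / (1 - κ * ‖z‖ ^ 2) := by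
  have hd := one_sub_pos h hz
  have hD := one_sub_radius_pos h
  simp only [scale, Phi, norm_mul, norm_div, Complex.norm_real, Real.norm_eq_abs, abs_of_pos hD,
    abs_of_pos hd, abs_of_pos hR]
  generalize 1 - κ * R ^ 2 = q at *
  field_simp

/-- `r ↦ r/(1 - κ r²)` is increasing: after clearing denominators the difference factors as `(R -
r)(1 + κ r R)`. The hypothesis on `r` is `r² |κ| < 1` and not `r ≤ R`, so that `‖PhiInv ζ‖ ≤ R` can
be deduced from it. -/
theorem div_le_scale_iff (h : R ^ 2 * |κ| < 1) {r : ℝ} (hr0 : 0 ≤ r) (hr : r ^ 2 * |κ| < 1)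
    (hR : 0 < R) : (r / (1 - κ * r ^ 2) ≤ scale κ R ↔ r ≤ R) ∧
      (r / (1 - κ * r ^ 2) < scale κ R ↔ r < R) := by
  have hd : 0 < 1 - κ * r ^ 2 := one_sub_radius_pos hr
  have hD := one_sub_radius_pos h
  have hrR : 0 < 1 + κ * (r * R) := by
    have h1 : |κ * (r * R)| < 1 := by
      rw [abs_mul, abs_of_nonneg (mul_nonneg hr0 hR.le)]
      -- The square of `|κ| r R` is the product of `r² |κ|` and `R² |κ|`, both below one.
      have h2 : (|κ| * (r * R)) ^ 2 < 1 := by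
        have : (|κ| * (r * R)) ^ 2 = (r ^ 2 * |κ|) * (R ^ 2 * |κ|) := by ring
        rw [this]
        exact mul_lt_one_of_nonneg_of_lt_one_left (by positivity) hr h.le
      exact (sq_lt_one_iff₀ (by positivity)).1 h2
    linarith [(abs_lt.1 h1).1]
  have e : R * (1 - κ * r ^ 2) - r * (1 - κ * R ^ 2) = (R - r) * (1 + κ * (r * R)) := by ring
  constructor
  · rw [scale, div_le_div_iff₀ hd hD, ← sub_nonneg, e, ← sub_nonneg (b := r),
      mul_nonneg_iff_of_pos_right hrR]
  · rw [scale, div_lt_div_iff₀ hd hD, ← sub_pos, e, ← sub_pos (b := r), mul_pos_iff_of_pos_right hrR]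

theorem sq_mul_abs_lt {z : ℂ} (h : R ^ 2 * |κ| < 1) (hz : ‖z‖ ≤ R) : ‖z‖ ^ 2 * |κ| < 1 :=
  lt_of_le_of_lt (by gcongr) h

theorem norm_Phi_le_one (hR : 0 < R) (h : R ^ 2 * |κ| < 1) {z : ℂ} (hz : ‖z‖ ≤ R) :
    ‖Phi κ R z‖ ≤ 1 := by
  have h1 := ((div_le_scale_iff h (norm_nonneg z) (sq_mul_abs_lt h hz) hR).1).2 hz
  rw [← norm_Phi hR h hz] at h1
  exact le_of_mul_le_mul_left (by simpa using h1) (scale_pos hR h)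

theorem norm_Phi_lt_one (hR : 0 < R) (h : R ^ 2 * |κ| < 1) {z : ℂ} (hz : ‖z‖ < R) :
    ‖Phi κ R z‖ < 1 := by
  have h1 := ((div_le_scale_iff h (norm_nonneg z) (sq_mul_abs_lt h hz.le) hR).2).2 hz
  rw [← norm_Phi hR h hz.le] at h1
  exact lt_of_mul_lt_mul_left (by simpa using h1) (scale_pos hR h).le

theorem norm_Phi_eq_one (hR : 0 < R) (h : R ^ 2 * |κ| < 1) {z : ℂ} (hz : ‖z‖ = R) :
    ‖Phi κ R z‖ = 1 := by
  have h1 := norm_Phi hR h hz.le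
  rw [hz] at h1
  exact mul_left_cancel₀ (scale_pos hR h).ne' (by rw [h1, mul_one, scale])

/-- At the extreme value `s = scale` the expression is the square of `(1 + κ R²)/(1 - κ R²)`; for
negative `κ` this is its smallest value. -/
theorem disc_pos (h : R ^ 2 * |κ| < 1) {s : ℝ} (h0 : 0 ≤ s) (hs : s ≤ scale κ R) :
    0 < 1 + 4 * κ * s ^ 2 := by
  have hD := one_sub_radius_pos h
  have hS := one_add_radius_pos h
  have h1 : 1 + 4 * κ * scale κ R ^ 2 = ((1 + κ * R ^ 2) / (1 - κ * R ^ 2)) ^ 2 := by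
    rw [scale]; field_simp; ring
  have h2 : 0 < 1 + 4 * κ * scale κ R ^ 2 := by rw [h1]; positivity
  rcases le_or_gt 0 κ with hk | hk
  · positivity
  · have : s ^ 2 ≤ scale κ R ^ 2 := by gcongr
    nlinarith

/-- The radius `r` solves `κ s r² + r - s = 0`; the root `2s/(1 + W)`, with `W² = 1 + 4κs²`, makes
sense also for `κ = 0`. It satisfies `κ r² = (W - 1)/(W + 1)`, so that `W` is the value of the
weight at the preimage. -/
theorem PhiInv_spec (hR : 0 < R) (h : R ^ 2 * |κ| < 1) {ζ : ℂ} (hζ : ‖ζ‖ ≤ 1) :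
    ‖PhiInv κ R ζ‖ ≤ R ∧ (‖ζ‖ < 1 → ‖PhiInv κ R ζ‖ < R) ∧ Phi κ R (PhiInv κ R ζ) = ζ ∧
      weight κ (PhiInv κ R ζ) = √(1 + 4 * κ * (scale κ R * ‖ζ‖) ^ 2) := by
  have hD := scale_pos hR h
  have hsle : scale κ R * ‖ζ‖ ≤ scale κ R := mul_le_of_le_one_right hD.le hζ
  have hs0 : 0 ≤ scale κ R * ‖ζ‖ := by positivity
  have hpos := disc_pos h hs0 hsle
  set s := scale κ R * ‖ζ‖ with hs
  set W := √(1 + 4 * κ * s ^ 2) with hW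
  have hWpos : 0 < W := Real.sqrt_pos.2 hpos
  have hWsq : W ^ 2 = 1 + 4 * κ * s ^ 2 := Real.sq_sqrt hpos.le
  have hP : PhiInv κ R ζ = ((2 / (1 + W) : ℝ) : ℂ) * ((scale κ R : ℂ) * ζ) := rfl
  have hn : ‖PhiInv κ R ζ‖ = 2 * s / (1 + W) := by
    rw [hP, norm_mul, norm_mul, Complex.norm_real, Complex.norm_real, Real.norm_of_nonneg hD.le,
      Real.norm_of_nonneg (by positivity), ← hs]
    ring
  have hk : κ * ‖PhiInv κ R ζ‖ ^ 2 = (W - 1) / (W + 1) := by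
    rw [hn]
    field_simp
    linear_combination -(W + 1) * hWsq
  have hsub : 1 - κ * ‖PhiInv κ R ζ‖ ^ 2 = 2 / (W + 1) := by
    rw [hk]; field_simp; ring
  have hrk : ‖PhiInv κ R ζ‖ ^ 2 * |κ| < 1 := by
    have : ‖PhiInv κ R ζ‖ ^ 2 * |κ| = |κ * ‖PhiInv κ R ζ‖ ^ 2| := by
      rw [abs_mul, abs_of_nonneg (sq_nonneg ‖PhiInv κ R ζ‖), mul_comm]
    rw [this, hk, abs_lt]
    constructor
    · rw [lt_div_iff₀ (by positivity)]; linarith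
    · rw [div_lt_one (by positivity)]; linarith
  have hquot : ‖PhiInv κ R ζ‖ / (1 - κ * ‖PhiInv κ R ζ‖ ^ 2) = s := by
    rw [hsub, hn]; field_simp; ring
  have hiff := div_le_scale_iff h (norm_nonneg (PhiInv κ R ζ)) hrk hR
  rw [hquot] at hiff
  have hDc : (scale κ R : ℂ) ≠ 0 := by exact_mod_cast hD.ne'
  have hWc : (1 + W : ℂ) ≠ 0 := by
    have : (1 + W : ℝ) ≠ 0 := by positivity
    exact_mod_cast this
  refine ⟨hiff.1.1 hsle, fun hlt => hiff.2.1 (mul_lt_of_lt_one_right hD hlt), ?_, ?_⟩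
  · have e : Phi κ R (PhiInv κ R ζ) =
        (((1 - κ * ‖PhiInv κ R ζ‖ ^ 2)⁻¹ * (scale κ R)⁻¹ : ℝ) : ℂ) * PhiInv κ R ζ := by
      rw [Phi, scale]
      push_cast
      field_simp
    rw [e, hsub, hP]
    push_cast
    field_simp
    ring_nf
  · rw [weight, hk]
    field_simp
    ring

theorem Phi_PhiInv (hR : 0 < R) (h : R ^ 2 * |κ| < 1) {ζ : ℂ} (hζ : ‖ζ‖ ≤ 1) :
    Phi κ R (PhiInv κ R ζ) = ζ := (PhiInv_spec hR h hζ).2.2.1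

theorem contDiffOn_Phi (h : R ^ 2 * |κ| < 1) :
    ContDiffOn ℝ ∞ (Phi κ R) (closedBall (0 : ℂ) R) := by
  have hn : ContDiff ℝ ∞ fun z : ℂ => κ * ‖z‖ ^ 2 := contDiff_const.mul (contDiff_norm_sq ℝ)
  refine ContDiffOn.mul (Complex.ofRealCLM.contDiff.comp_contDiffOn
    (contDiffOn_const.div (contDiff_const.sub hn).contDiffOn
      fun z hz => (one_sub_pos h (by simpa using hz)).ne')) ?_
  exact (contDiff_id.div_const _).contDiffOn

theorem contDiffOn_PhiInv (hR : 0 < R) (h : R ^ 2 * |κ| < 1) :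
    ContDiffOn ℝ ∞ (PhiInv κ R) unitDisk := by
  have hn : ContDiff ℝ ∞ fun ζ : ℂ => 1 + 4 * κ * (scale κ R * ‖ζ‖) ^ 2 := by
    simp_rw [mul_pow]
    exact contDiff_const.add (contDiff_const.mul (contDiff_const.mul (contDiff_norm_sq ℝ)))
  have hD := scale_pos hR h
  have hs : ContDiffOn ℝ ∞ (fun ζ : ℂ => √(1 + 4 * κ * (scale κ R * ‖ζ‖) ^ 2)) unitDisk :=
    hn.contDiffOn.sqrt fun ζ hζ => (disc_pos h (by positivity)
      (mul_le_of_le_one_right hD.le (by simpa using hζ))).ne'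
  refine ContDiffOn.mul (Complex.ofRealCLM.contDiff.comp_contDiffOn
    (contDiffOn_const.div (contDiffOn_const.add hs) fun z hz => by positivity)) ?_
  exact (contDiff_const.mul contDiff_id).contDiffOn

theorem mapsTo_Phi (hR : 0 < R) (h : R ^ 2 * |κ| < 1) :
    Set.MapsTo (Phi κ R) (closedBall (0 : ℂ) R) unitDisk := fun z hz => by
  simpa using norm_Phi_le_one hR h (by simpa using hz)

theorem mapsTo_PhiInv (hR : 0 < R) (h : R ^ 2 * |κ| < 1) :
    Set.MapsTo (PhiInv κ R) unitDisk (closedBall (0 : ℂ) R) := fun ζ hζ => by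
  simpa using (PhiInv_spec hR h (by simpa using hζ)).1

theorem injOn_Phi (hR : 0 < R) (h : R ^ 2 * |κ| < 1) :
    Set.InjOn (Phi κ R) (closedBall (0 : ℂ) R) := fun x hx y hy hxy => by
  rw [← PhiInv_Phi hR h (z := x) (by simpa using hx), hxy, PhiInv_Phi hR h (by simpa using hy)]

theorem image_Phi (hR : 0 < R) (h : R ^ 2 * |κ| < 1) :
    Phi κ R '' closedBall (0 : ℂ) R = unitDisk := by
  refine Set.Subset.antisymm (mapsTo_Phi hR h).image_subset fun ζ hζ => ?_
  exact ⟨_, mapsTo_PhiInv hR h hζ, Phi_PhiInv hR h (by simpa using hζ)⟩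

/-- The differential of `Phi`. -/
def dPhi (κ R : ℝ) (z : ℂ) : ℂ →L[ℝ] ℂ :=
  ((scale κ R * (1 - κ * ‖z‖ ^ 2) ^ 2)⁻¹ : ℝ) •
    (ContinuousLinearMap.id ℝ ℂ +
      (ContinuousLinearMap.mul ℝ ℂ (κ * z ^ 2)).comp (Complex.conjCLE : ℂ →L[ℝ] ℂ))

theorem dPhi_apply (κ R : ℝ) (z v : ℂ) : dPhi κ R z v =
    ((scale κ R * (1 - κ * ‖z‖ ^ 2) ^ 2)⁻¹ : ℝ) * (v + κ * z ^ 2 * starRingEnd ℂ v) := by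
  simp [dPhi]
  ring

/-- With `|z|² = z z̄`, `Φ` is `z/(1 - κ z z̄)` up to the scale, and the quotient rule gives a
numerator `v + κ z² v̄`. -/
theorem hasFDerivAt_Phi (hR : 0 < R) (h : R ^ 2 * |κ| < 1) {z : ℂ} (hz : ‖z‖ ≤ R) :
    HasFDerivAt (Phi κ R) (dPhi κ R z) z := by
  have hd := one_sub_pos h hz
  have hD := one_sub_radius_pos h
  have hDs := scale_pos hR h
  have hden : HasFDerivAt (fun z : ℂ => (1 : ℂ) - κ * (z * starRingEnd ℂ z)) _ z :=
    (((hasFDerivAt_id z).fun_mul (Complex.conjCLE : ℂ →L[ℝ] ℂ).hasFDerivAt).const_mul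
      (κ : ℂ)).const_sub (1 : ℂ)
  have hzz : ∀ z : ℂ, (1 : ℂ) - κ * (z * starRingEnd ℂ z) = ((1 - κ * ‖z‖ ^ 2 : ℝ) : ℂ) := fun z => by
    rw [Complex.mul_conj, Complex.normSq_eq_norm_sq]; push_cast; ring
  have hne : (1 : ℂ) - κ * (z * starRingEnd ℂ z) ≠ 0 := by
    rw [hzz]; exact_mod_cast hd.ne'
  have hfun : Phi κ R = fun z : ℂ =>
      ((scale κ R : ℂ)⁻¹ * z) * ((1 : ℂ) - κ * (z * starRingEnd ℂ z))⁻¹ := by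
    ext y
    rw [hzz, Phi, scale]
    push_cast
    field_simp
  rw [hfun]
  refine (((hasFDerivAt_id z).const_mul (scale κ R : ℂ)⁻¹).fun_mul
    ((hasFDerivAt_inv' (𝕜 := ℝ) hne).comp z hden)).congr_fderiv ?_
  ext1 v
  rw [dPhi_apply]
  push_cast
  have e : (1 - κ * ‖z‖ ^ 2 : ℂ) = (1 : ℂ) - κ * (z * starRingEnd ℂ z) := by
    rw [hzz]; push_cast; ring
  have hDc : (scale κ R : ℂ) ≠ 0 := by exact_mod_cast hDs.ne'
  rw [e]
  simp
  field_simp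
  ring

theorem det_id_add_mul_conj (c : ℝ) (b : ℂ) :
    (c • (ContinuousLinearMap.id ℝ ℂ +
      (ContinuousLinearMap.mul ℝ ℂ b).comp (Complex.conjCLE : ℂ →L[ℝ] ℂ))).det =
      c ^ 2 * (1 - ‖b‖ ^ 2) := by
  rw [ContinuousLinearMap.det, ← LinearMap.det_toMatrix Complex.basisOneI, Matrix.det_fin_two]
  simp [LinearMap.toMatrix_apply, Complex.coe_basisOneI_repr]
  rw [← Complex.normSq_eq_norm_sq, Complex.normSq_apply]
  ring

theorem setIntegral_unitDisk_eq (hR : 0 < R) (h : R ^ 2 * |κ| < 1) (G : ℂ → ℂ) :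
    ∫ ζ in unitDisk, G ζ = ((scale κ R ^ 2)⁻¹ : ℝ) •
      ∫ z in closedBall (0 : ℂ) R, (weight κ z / (1 - κ * ‖z‖ ^ 2) ^ 2) • G (Phi κ R z) := by
  rw [← image_Phi hR h, integral_image_eq_integral_abs_det_fderiv_smul volume
    measurableSet_closedBall (fun z hz => (hasFDerivAt_Phi hR h
      (by simpa using hz)).hasFDerivWithinAt) (injOn_Phi hR h), ← integral_smul]
  refine setIntegral_congr_fun measurableSet_closedBall fun z hz => ?_
  have hz' : ‖z‖ ≤ R := by simpa using hz
  have hd := one_sub_pos h hz'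
  have ha := one_add_pos h hz'
  have hDs := scale_pos hR h
  -- The determinant is proportional to `(1 - κ² |z|⁴)/(1 - κ |z|²)⁴`, and the numerator splits into
  -- the two factors of `w`.
  have hdet : (dPhi κ R z).det = (scale κ R ^ 2)⁻¹ * (weight κ z / (1 - κ * ‖z‖ ^ 2) ^ 2) := by
    rw [dPhi, det_id_add_mul_conj, weight]
    have : ‖(κ : ℂ) * z ^ 2‖ ^ 2 = (κ * ‖z‖ ^ 2) ^ 2 := by
      rw [norm_mul, norm_pow, Complex.norm_real, mul_pow, mul_pow, Real.norm_eq_abs, sq_abs]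
    rw [this]
    field_simp
    ring
  have hw := weight_pos h hz'
  simp only [hdet]
  rw [abs_of_nonneg (by positivity), smul_smul]

/-! ### The measures -/

theorem integral_vol (F : ℂ → ℂ) :
    ∫ z, F z ∂(vol κ R) = ∫ z in closedBall (0 : ℂ) R, ((1 + κ * ‖z‖ ^ 2) ^ 2)⁻¹ • F z := by
  rw [vol, integral_withDensity_eq_integral_toReal_smul (by fun_prop) (by simp)]
  refine integral_congr_ae (Filter.Eventually.of_forall fun z => ?_)
  simp only
  rw [ENNReal.toReal_ofReal (by positivity)]

theorem measurable_weight (κ : ℝ) : Measurable (weight κ) := by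
  unfold weight
  fun_prop

theorem ae_vol_mem (κ R : ℝ) : ∀ᵐ z ∂(vol κ R), ‖z‖ ≤ R := by
  refine (withDensity_absolutelyContinuous _ _).ae_le ?_
  filter_upwards [ae_restrict_mem measurableSet_closedBall] with z hz
  simpa using hz

theorem ae_wvol_mem (κ R : ℝ) : ∀ᵐ z ∂(wvol κ R), ‖z‖ ≤ R :=
  (withDensity_absolutelyContinuous _ _).ae_le (ae_vol_mem κ R)

theorem vol_absolutelyContinuous_wvol (h : R ^ 2 * |κ| < 1) : vol κ R ≪ wvol κ R := by
  refine withDensity_absolutelyContinuous' (measurable_weight κ).ennreal_ofReal.aemeasurable ?_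
  filter_upwards [ae_vol_mem κ R] with z hz
  simpa using weight_pos h hz

theorem restrict_absolutelyContinuous_vol (h : R ^ 2 * |κ| < 1) :
    volume.restrict (closedBall (0 : ℂ) R) ≪ vol κ R := by
  refine withDensity_absolutelyContinuous' (by fun_prop) ?_
  filter_upwards [ae_restrict_mem measurableSet_closedBall] with z hz
  have := one_add_pos h (z := z) (by simpa using hz)
  simp
  positivity

theorem integral_wvol (h : R ^ 2 * |κ| < 1) (F : ℂ → ℂ) :
    ∫ z, F z ∂(wvol κ R) = ∫ z, weight κ z * F z ∂(vol κ R) := by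
  rw [wvol, integral_withDensity_eq_integral_toReal_smul (measurable_weight κ).ennreal_ofReal
    (by simp)]
  refine integral_congr_ae ?_
  filter_upwards [ae_vol_mem κ R] with z hz
  rw [ENNReal.toReal_ofReal (weight_pos h hz).le, Complex.real_smul]

theorem exists_bounds_weight (hR : 0 < R) (h : R ^ 2 * |κ| < 1) :
    ∃ m M : ℝ, 0 < m ∧ 0 < M ∧ ∀ z : ℂ, ‖z‖ ≤ R → m ≤ weight κ z ∧ weight κ z ≤ M := by
  have hne : (closedBall (0 : ℂ) R).Nonempty := ⟨0, by simpa using hR.le⟩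
  obtain ⟨a, ha, hmin⟩ := (isCompact_closedBall (0 : ℂ) R).exists_isMinOn hne (continuousOn_weight h)
  obtain ⟨b, hb, hmax⟩ := (isCompact_closedBall (0 : ℂ) R).exists_isMaxOn hne (continuousOn_weight h)
  refine ⟨weight κ a, weight κ b, weight_pos h (by simpa using ha), weight_pos h (by simpa using hb),
    fun z hz => ⟨hmin (by simpa using hz), hmax (by simpa using hz)⟩⟩

theorem exists_wvol_le (hR : 0 < R) (h : R ^ 2 * |κ| < 1) :
    ∃ C : ENNReal, C ≠ ⊤ ∧ wvol κ R ≤ C • vol κ R := by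
  obtain ⟨m, M, _, _, hb⟩ := exists_bounds_weight hR h
  refine ⟨ENNReal.ofReal M, ENNReal.ofReal_ne_top, ?_⟩
  rw [wvol, ← withDensity_const]
  refine withDensity_mono ?_
  filter_upwards [ae_vol_mem κ R] with z hz
  exact ENNReal.ofReal_le_ofReal (hb z hz).2

theorem exists_vol_le (hR : 0 < R) (h : R ^ 2 * |κ| < 1) :
    ∃ C : ENNReal, C ≠ ⊤ ∧ vol κ R ≤ C • wvol κ R := by
  obtain ⟨m, M, hm, _, hb⟩ := exists_bounds_weight hR h
  refine ⟨ENNReal.ofReal m⁻¹, ENNReal.ofReal_ne_top, ?_⟩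
  rw [wvol, ← withDensity_smul _ (measurable_weight κ).ennreal_ofReal]
  conv_lhs => rw [← withDensity_one (μ := vol κ R)]
  refine withDensity_mono ?_
  filter_upwards [ae_vol_mem κ R] with z hz
  simp only [Pi.one_apply, Pi.smul_apply, smul_eq_mul]
  rw [← ENNReal.ofReal_mul (by positivity), ← ENNReal.ofReal_one]
  refine ENNReal.ofReal_le_ofReal ?_
  rw [← div_eq_inv_mul, le_div_iff₀ hm, one_mul]
  exact (hb z hz).1

theorem memLp_vol_iff (hR : 0 < R) (h : R ^ 2 * |κ| < 1) {f : ℂ → ℂ} :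
    MemLp f 2 (vol κ R) ↔ MemLp f 2 (wvol κ R) := by
  obtain ⟨C, hC, h1⟩ := exists_wvol_le hR h
  obtain ⟨C', hC', h2⟩ := exists_vol_le hR h
  exact ⟨fun hf => hf.of_measure_le_smul hC h1, fun hf => hf.of_measure_le_smul hC' h2⟩

theorem isFiniteMeasure_vol (h : R ^ 2 * |κ| < 1) : IsFiniteMeasure (vol κ R) := by
  have hc : ContinuousOn (fun z : ℂ => ((1 + κ * ‖z‖ ^ 2) ^ 2)⁻¹) (closedBall (0 : ℂ) R) :=
    ContinuousOn.inv₀ (by fun_prop) fun z hz =>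
      (pow_pos (one_add_pos h (by simpa using hz)) 2).ne'
  obtain ⟨C, hC⟩ := (isCompact_closedBall (0 : ℂ) R).exists_bound_of_continuousOn hc
  have hle : vol κ R ≤ ENNReal.ofReal C • volume.restrict (closedBall (0 : ℂ) R) := by
    rw [vol, ← withDensity_const]
    refine withDensity_mono ?_
    filter_upwards [ae_restrict_mem measurableSet_closedBall] with z hz
    exact ENNReal.ofReal_le_ofReal ((le_abs_self _).trans (hC z hz))
  have : IsFiniteMeasure (volume.restrict (closedBall (0 : ℂ) R)) :=
    ⟨by rw [Measure.restrict_apply_univ]; exact measure_closedBall_lt_top⟩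
  refine ⟨(hle _).trans_lt ?_⟩
  rw [Measure.smul_apply, smul_eq_mul]
  exact ENNReal.mul_lt_top ENNReal.ofReal_lt_top (measure_lt_top _ _)

theorem isFiniteMeasure_wvol (hR : 0 < R) (h : R ^ 2 * |κ| < 1) : IsFiniteMeasure (wvol κ R) := by
  obtain ⟨C, hC, h1⟩ := exists_wvol_le hR h
  have := isFiniteMeasure_vol h
  refine ⟨(h1 _).trans_lt ?_⟩
  rw [Measure.smul_apply, smul_eq_mul]
  exact ENNReal.mul_lt_top hC.lt_top (measure_lt_top _ _)

theorem memLp_vol_of_continuousOn (h : R ^ 2 * |κ| < 1) {f : ℂ → ℂ}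
    (hf : ContinuousOn f (closedBall (0 : ℂ) R)) : MemLp f 2 (vol κ R) := by
  have := isFiniteMeasure_vol h
  obtain ⟨C, hC⟩ := (isCompact_closedBall (0 : ℂ) R).exists_bound_of_continuousOn hf
  refine MemLp.of_bound ?_ C ?_
  · exact (hf.aestronglyMeasurable measurableSet_closedBall).mono_ac
      (withDensity_absolutelyContinuous _ _)
  · filter_upwards [ae_vol_mem κ R] with z hz
    exact hC z (by simpa using hz)

theorem memLp_wvol_of_continuousOn (hR : 0 < R) (h : R ^ 2 * |κ| < 1) {f : ℂ → ℂ}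
    (hf : ContinuousOn f (closedBall (0 : ℂ) R)) : MemLp f 2 (wvol κ R) :=
  (memLp_vol_iff hR h).1 (memLp_vol_of_continuousOn h hf)

/-! ### Transfer of functions -/

open Classical in
/-- The function `w · h ∘ Φ` on `M`. -/
def liftM (κ R : ℝ) (u : ℂ → ℂ) (z : ℂ) : ℂ := if ‖z‖ ≤ R then weight κ z * u (Phi κ R z) else 0

/-- The inverse of `liftM`. -/
def pullD (κ R : ℝ) (f : ℂ → ℂ) (ζ : ℂ) : ℂ := f (PhiInv κ R ζ) / weight κ (PhiInv κ R ζ)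

theorem liftM_of_le {u : ℂ → ℂ} {z : ℂ} (hz : ‖z‖ ≤ R) :
    liftM κ R u z = weight κ z * u (Phi κ R z) := if_pos hz

theorem contDiffOn_liftM (hR : 0 < R) (h : R ^ 2 * |κ| < 1) {u : ℂ → ℂ} (hu : SmoothD u) :
    ContDiffOn ℝ ∞ (liftM κ R u) (closedBall (0 : ℂ) R) := by
  have h1 : ContDiffOn ℝ ∞ (fun z => (weight κ z : ℂ) * u (Phi κ R z)) (closedBall (0 : ℂ) R) :=
    (Complex.ofRealCLM.contDiff.comp_contDiffOn (contDiffOn_weight h)).mul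
      (ContDiffOn.comp hu (contDiffOn_Phi h) (mapsTo_Phi hR h))
  exact h1.congr fun z hz => liftM_of_le (by simpa using hz)

/-- `liftM` of a smooth function, as an element of `C^∞(M)`. -/
def liftS (hR : 0 < R) (h : R ^ 2 * |κ| < 1) {u : ℂ → ℂ} (hu : SmoothD u) : SmoothM R :=
  ⟨liftM κ R u, contDiffOn_liftM hR h hu, fun z hz => if_neg (by simpa using hz)⟩

theorem SmoothM.continuousOn (φ : SmoothM R) : ContinuousOn (φ : ℂ → ℂ) (closedBall (0 : ℂ) R) :=
  φ.2.1.continuousOn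

theorem smoothD_pullD (hR : 0 < R) (h : R ^ 2 * |κ| < 1) (φ : SmoothM R) :
    SmoothD (pullD κ R φ) := by
  have h1 : ContDiffOn ℝ ∞ (fun ζ => (weight κ (PhiInv κ R ζ) : ℂ)) unitDisk :=
    Complex.ofRealCLM.contDiff.comp_contDiffOn
      ((contDiffOn_weight h).comp (contDiffOn_PhiInv hR h) (mapsTo_PhiInv hR h))
  refine ContDiffOn.mul (φ.2.1.comp (contDiffOn_PhiInv hR h) (mapsTo_PhiInv hR h)) (h1.inv ?_)
  intro ζ hζ
  have := weight_pos h (PhiInv_spec hR h (ζ := ζ) (by simpa using hζ)).1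
  exact_mod_cast this.ne'

theorem liftM_pullD (hR : 0 < R) (h : R ^ 2 * |κ| < 1) (f : ℂ → ℂ) {z : ℂ} (hz : ‖z‖ ≤ R) :
    liftM κ R (pullD κ R f) z = f z := by
  have : (weight κ z : ℂ) ≠ 0 := by exact_mod_cast (weight_pos h hz).ne'
  rw [liftM_of_le hz, pullD, PhiInv_Phi hR h hz, mul_div_cancel₀ _ this]

theorem pullD_liftM (hR : 0 < R) (h : R ^ 2 * |κ| < 1) (u : ℂ → ℂ) {ζ : ℂ} (hζ : ζ ∈ unitDisk) :
    pullD κ R (liftM κ R u) ζ = u ζ := by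
  have hζ' : ‖ζ‖ ≤ 1 := by simpa using hζ
  have hs := PhiInv_spec hR h hζ'
  have : (weight κ (PhiInv κ R ζ) : ℂ) ≠ 0 := by exact_mod_cast (weight_pos h hs.1).ne'
  rw [pullD, liftM_of_le hs.1, hs.2.2.1, mul_div_cancel_left₀ _ this]

/-- The weight of `w dVol` and the two factors `w` from `liftM` combine to `w³/(1 + κ|z|²)² = w/(1 -
κ|z|²)²`, the Jacobian of `Φ` up to `scale²`. This transports orthogonality from the unit disk to
`L²(M, w dVol)`. -/
theorem pair_liftM (hR : 0 < R) (h : R ^ 2 * |κ| < 1) (u v : ℂ → ℂ) :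
    pair κ R (liftM κ R u) (liftM κ R v) = (scale κ R ^ 2 : ℝ) * ∫ ζ in unitDisk, u ζ * v ζ := by
  have hD := scale_pos hR h
  rw [setIntegral_unitDisk_eq hR h, Complex.real_smul, ← mul_assoc, ← Complex.ofReal_mul,
    mul_inv_cancel₀ (by positivity), Complex.ofReal_one, one_mul, pair, integral_wvol h,
    integral_vol]
  refine setIntegral_congr_fun measurableSet_closedBall fun z hz => ?_
  have hz' : ‖z‖ ≤ R := by simpa using hz
  have h1 := (one_add_pos h hz').ne'
  have h2 := (one_sub_pos h hz').ne'
  simp only [liftM_of_le hz']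
  rw [Complex.real_smul, Complex.real_smul]
  have e : ((weight κ z / (1 - κ * ‖z‖ ^ 2) ^ 2 : ℝ) : ℂ) =
      (((1 + κ * ‖z‖ ^ 2) ^ 2)⁻¹ * weight κ z ^ 3 : ℝ) := by
    congr 1
    rw [weight]
    field_simp
  rw [e]
  push_cast
  ring

theorem pair_congr_ae {f f' g g' : ℂ → ℂ} (hf : f =ᵐ[wvol κ R] f') (hg : g =ᵐ[wvol κ R] g') :
    pair κ R f g = pair κ R f' g' := by
  refine integral_congr_ae ?_
  filter_upwards [hf, hg] with z h1 h2
  rw [h1, h2]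

theorem pair_eq_pullD (hR : 0 < R) (h : R ^ 2 * |κ| < 1) (φ : SmoothM R) (v : ℂ → ℂ) :
    pair κ R φ (liftM κ R v) = (scale κ R ^ 2 : ℝ) * ∫ ζ in unitDisk, pullD κ R φ ζ * v ζ := by
  rw [← pair_liftM hR h]
  refine pair_congr_ae ?_ (Filter.EventuallyEq.refl _ _)
  filter_upwards [ae_wvol_mem κ R] with z hz
  rw [liftM_pullD hR h _ hz]

theorem isEigen_iff (hR : 0 < R) (h : R ^ 2 * |κ| < 1) (lam : ℝ) (e : SmoothM R) :
    IsEigen κ R lam e ↔ ∀ ζ : ℂ, 0 < ‖ζ‖ → ‖ζ‖ < 1 →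
      opLc (pullD κ R e) ζ = lam * pullD κ R e ζ := by
  have hs := smoothD_pullD hR h e
  have hopL : ∀ z, opL κ R e z = weight κ z * opLe (pullD κ R e) (Phi κ R z) := fun z => rfl
  have hP0 : ∀ z : ℂ, ‖z‖ ≤ R → 0 < ‖z‖ → 0 < ‖Phi κ R z‖ := fun z hz h0 => by
    have h1 := norm_Phi hR h hz
    have h2 : 0 < ‖z‖ / (1 - κ * ‖z‖ ^ 2) := div_pos h0 (one_sub_pos h hz)
    rw [← h1] at h2
    exact pos_of_mul_pos_right h2 (scale_pos hR h).le
  have hP0' : ∀ ζ : ℂ, ‖ζ‖ ≤ 1 → 0 < ‖ζ‖ → 0 < ‖PhiInv κ R ζ‖ := fun ζ hζ h0 => by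
    rw [norm_pos_iff]
    intro h1
    have := Phi_PhiInv hR h hζ
    rw [h1] at this
    rw [← this] at h0
    simp [Phi] at h0
  constructor
  · intro he ζ h0 h1
    have hsp := PhiInv_spec hR h h1.le
    have h2 := he (PhiInv κ R ζ) (hP0' ζ h1.le h0) (hsp.2.1 h1)
    rw [hopL, hsp.2.2.1, opLe_eq_opLc hs h0 h1] at h2
    have hw : (weight κ (PhiInv κ R ζ) : ℂ) ≠ 0 := by exact_mod_cast (weight_pos h hsp.1).ne'
    rw [pullD]
    field_simp
    rw [← h2]
    ring
  · intro he z h0 h1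
    have h2 := norm_Phi_lt_one hR h h1
    have hw : (weight κ z : ℂ) ≠ 0 := by exact_mod_cast (weight_pos h h1.le).ne'
    rw [hopL, opLe_eq_opLc hs (hP0 z h1.le h0) h2, he _ (hP0 z h1.le h0) h2, pullD,
      PhiInv_Phi hR h h1.le]
    field_simp

end

/-! ### Geodesics -/

section

variable {κ R : ℝ}

/-- `T` is the Euclidean radius along a unit-speed geodesic through the origin: `tanh`, the identity
or `tan`, according to the sign of `κ`. The condition on `c` places it below the stationary value
`1/√(-κ)` when `κ < 0`. -/
theorem exists_riccati (κ : ℝ) {c : ℝ} (hc : 0 < c) (hk : 0 < 1 + κ * c ^ 2) :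
    ∃ (τ : ℝ) (T : ℝ → ℝ), 0 < τ ∧ T 0 = 0 ∧ T τ = c ∧
      (∀ t ∈ Set.Icc 0 τ, HasDerivAt T (1 + κ * T t ^ 2) t) ∧
      ∀ t ∈ Set.Ioo 0 τ, 0 < T t ∧ T t < c := by
  rcases lt_trichotomy κ 0 with h | h | h
  · obtain ⟨k, hk0, rfl⟩ : ∃ k : ℝ, 0 < k ∧ κ = -k ^ 2 :=
      ⟨√(-κ), Real.sqrt_pos.2 (by linarith), by rw [Real.sq_sqrt (by linarith), neg_neg]⟩
    have hkc : k * c ∈ Set.Ioo (-1 : ℝ) 1 := by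
      have h1 : (k * c) ^ 2 < 1 := by nlinarith
      have h2 := (sq_lt_one_iff₀ (by positivity)).1 h1
      exact ⟨by linarith [mul_pos hk0 hc], h2⟩
    have hd : ∀ t, HasDerivAt (fun t => Real.tanh (k * t) / k)
        (1 + -k ^ 2 * (Real.tanh (k * t) / k) ^ 2) t := fun t => by
      have h0 := (Real.cosh_pos (k * t)).ne'
      have hlin : HasDerivAt (fun t => k * t) k t := by
        simpa using (hasDerivAt_id t).const_mul k
      have h1 := ((hlin.sinh.fun_div hlin.cosh h0).div_const k)
      simp only [Real.tanh_eq_sinh_div_cosh]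
      convert! h1 using 1
      field_simp
      ring
    have hmono : StrictMono fun t => Real.tanh (k * t) / k := by
      refine strictMono_of_hasDerivAt_pos hd fun t => ?_
      have h0 := Real.cosh_pos (k * t)
      rw [Real.tanh_eq_sinh_div_cosh]
      have : 1 + -k ^ 2 * (Real.sinh (k * t) / Real.cosh (k * t) / k) ^ 2 =
          1 / Real.cosh (k * t) ^ 2 := by
        have := Real.cosh_sq (k * t)
        field_simp
        linarith
      rw [this]
      positivity
    have h0 : Real.tanh (k * 0) / k = 0 := by simp
    have hτ : Real.tanh (k * (Real.artanh (k * c) / k)) / k = c := by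
      rw [mul_div_cancel₀ _ hk0.ne', Real.tanh_artanh hkc]
      field_simp
    refine ⟨Real.artanh (k * c) / k, fun t => Real.tanh (k * t) / k,
      div_pos (Real.artanh_pos ⟨mul_pos hk0 hc, hkc.2⟩) hk0, h0, hτ, fun t _ => hd t,
      fun t ht => ⟨?_, ?_⟩⟩
    · have := hmono ht.1
      simp only at this
      rwa [h0] at this
    · have := hmono ht.2
      simp only at this
      rwa [hτ] at this
  · subst h
    exact ⟨c, id, hc, rfl, rfl, fun t _ => by simpa using hasDerivAt_id t, fun t ht => ht⟩
  · obtain ⟨k, hk0, rfl⟩ : ∃ k : ℝ, 0 < k ∧ κ = k ^ 2 :=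
      ⟨√κ, Real.sqrt_pos.2 h, by rw [Real.sq_sqrt h.le]⟩
    have hτ0 : 0 < Real.arctan (k * c) := Real.arctan_pos.2 (mul_pos hk0 hc)
    have hrange : ∀ t ∈ Set.Icc 0 (Real.arctan (k * c) / k),
        0 ≤ k * t ∧ k * t < Real.pi / 2 := fun t ht => by
      have h1 := (le_div_iff₀ hk0).1 ht.2
      exact ⟨mul_nonneg hk0.le ht.1, by nlinarith [Real.arctan_lt_pi_div_two (k * c)]⟩
    refine ⟨Real.arctan (k * c) / k, fun t => Real.tan (k * t) / k, div_pos hτ0 hk0, by simp, ?_,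
      fun t ht => ?_, fun t ht => ?_⟩
    · simp only
      rw [mul_div_cancel₀ _ hk0.ne', Real.tan_arctan]
      field_simp
    · have h1 := hrange t ht
      have h0 : Real.cos (k * t) ≠ 0 :=
        (Real.cos_pos_of_mem_Ioo ⟨by linarith [Real.pi_pos], h1.2⟩).ne'
      have hlin : HasDerivAt (fun t => k * t) k t := by
        simpa using (hasDerivAt_id t).const_mul k
      convert! ((Real.hasDerivAt_tan h0).comp t hlin).div_const k using 1
      simp only [Real.tan_eq_sin_div_cos]
      have := Real.sin_sq_add_cos_sq (k * t)
      field_simp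
      linarith
    · have h1 := hrange t ⟨ht.1.le, ht.2.le⟩
      refine ⟨div_pos (Real.tan_pos_of_pos_of_lt_pi_div_two (mul_pos hk0 ht.1) h1.2) hk0, ?_⟩
      simp only
      rw [div_lt_iff₀ hk0, mul_comm c]
      have h2 : k * t < Real.arctan (k * c) := by
        have := (lt_div_iff₀ hk0).1 ht.2
        linarith
      have := Real.tan_lt_tan_of_lt_of_lt_pi_div_two (by linarith [Real.pi_pos])
        (Real.arctan_lt_pi_div_two _) h2
      rwa [Real.tan_arctan] at this

theorem normSq_sub_exp_mul (a b α T : ℝ) :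
    ‖(a : ℂ) + b * (Complex.exp (α * Complex.I) * T)‖ ^ 2 =
      a ^ 2 + 2 * a * b * T * Real.cos α + b ^ 2 * T ^ 2 := by
  rw [← Complex.normSq_eq_norm_sq, Complex.normSq_apply]
  simp only [Complex.exp_mul_I, Complex.add_re, Complex.ofReal_re, Complex.mul_re,
    Complex.cos_ofReal_re, Complex.add_im, Complex.ofReal_im, Complex.mul_im, Complex.cos_ofReal_im,
    Complex.sin_ofReal_re, Complex.sin_ofReal_im, Complex.I_re, Complex.I_im]
  have := Real.sin_sq_add_cos_sq α
  linear_combination b ^ 2 * T ^ 2 * this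

/-- The geodesic is the image of a ray from the origin under the Möbius isometry `ζ ↦ b (R - ζ)/(1 +
κ R ζ)`, which sends `0` to the starting point, evaluated at `ζ = a T(t)` with `T` the solution of
the Riccati equation. -/
theorem exists_isChord (hR : 0 < R) (h : R ^ 2 * |κ| < 1) (β : ℝ) {α : ℝ}
    (hα : 0 < Real.cos α) : ∃ c : ℝ × (ℝ → ℂ), IsChord κ R β α c.1 c.2 := by
  have hD := one_sub_radius_pos h
  have hS := one_add_radius_pos h
  -- `T₁` is the nonzero root of `|m T| = R`: the difference of the two sides, squared and cleared
  -- of denominators, is `T (1 + κR²)(2R cos α - T (1 - κR²))`.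
  set T₁ := 2 * R * Real.cos α / (1 - κ * R ^ 2) with hT₁
  have hT₁pos : 0 < T₁ := by positivity
  have hc1 := Real.cos_le_one α
  -- For `κ < 0`, `κ T₁² (1 - κR²)² ≥ 4κR²`, and `(1 - κR²)² + 4κR² = (1 + κR²)²`.
  have hκT : 0 < 1 + κ * T₁ ^ 2 := by
    rcases le_or_gt 0 κ with hk | hk
    · positivity
    · have e : κ * T₁ ^ 2 * (1 - κ * R ^ 2) ^ 2 = 4 * (κ * R ^ 2) * Real.cos α ^ 2 := by
        rw [hT₁]; field_simp; ring
      have h1 : Real.cos α ^ 2 ≤ 1 := by nlinarith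
      have h2 : κ * R ^ 2 < 0 := by nlinarith [sq_pos_of_pos hR]
      have h3 : 0 < (1 + κ * T₁ ^ 2) * (1 - κ * R ^ 2) ^ 2 := by
        rw [add_mul, e]
        nlinarith [sq_pos_of_pos hS]
      exact pos_of_mul_pos_left h3 (by positivity)
  obtain ⟨τ, T, hτ, hT0, hTτ, hTd, hTi⟩ := exists_riccati κ hT₁pos hκT
  have hTle : ∀ t ∈ Set.Icc 0 τ, 0 ≤ T t ∧ T t ≤ T₁ := fun t ht => by
    rcases eq_or_lt_of_le ht.1 with h0 | h0
    · rw [← h0, hT0]; exact ⟨le_rfl, hT₁pos.le⟩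
    · rcases eq_or_lt_of_le ht.2 with h1 | h1
      · rw [h1, hTτ]; exact ⟨hT₁pos.le, le_rfl⟩
      · exact ⟨(hTi t ⟨h0, h1⟩).1.le, (hTi t ⟨h0, h1⟩).2.le⟩
  set a := Complex.exp (α * Complex.I) with ha
  set b := Complex.exp (β * Complex.I) with hb
  have hare : a.re = Real.cos α := by rw [ha, Complex.exp_ofReal_mul_I_re]
  -- The real part of the denominator is positive.
  have hden : ∀ T : ℝ, 0 ≤ T → T ≤ T₁ → (1 : ℂ) + κ * R * (a * T) ≠ 0 := fun T h0 h1 h2 => by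
    have h3 : 0 < 1 + κ * R * (Real.cos α * T) := by
      rcases le_or_gt 0 κ with hk | hk
      · positivity
      · have h4 : T * (1 - κ * R ^ 2) ≤ 2 * R * Real.cos α := by
          rwa [hT₁, le_div_iff₀ hD] at h1
        have h5 : -κ * R * (Real.cos α * T) * (1 - κ * R ^ 2) ≤ 2 * (-κ * R ^ 2) := by
          calc -κ * R * (Real.cos α * T) * (1 - κ * R ^ 2)
              = -κ * R * Real.cos α * (T * (1 - κ * R ^ 2)) := by ring
            _ ≤ -κ * R * Real.cos α * (2 * R * Real.cos α) := by
                apply mul_le_mul_of_nonneg_left h4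
                have : 0 < -κ := by linarith
                positivity
            _ = 2 * (-κ * R ^ 2) * Real.cos α ^ 2 := by ring
            _ ≤ 2 * (-κ * R ^ 2) * 1 := by
                apply mul_le_mul_of_nonneg_left (by nlinarith)
                have : 0 < -κ := by linarith
                positivity
            _ = _ := by ring
        have h6 : 0 < (1 + κ * R * (Real.cos α * T)) * (1 - κ * R ^ 2) := by nlinarith
        exact pos_of_mul_pos_left h6 hD.le
    have h7 := congrArg Complex.re h2
    simp [hare] at h7
    linarith
  let m : ℝ → ℂ := fun T => b * ((R : ℂ) - a * T) / (1 + κ * R * (a * T))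
  let m' : ℝ → ℂ := fun T => -(b * a * (1 + κ * R ^ 2)) / (1 + κ * R * (a * T)) ^ 2
  have hnb : ‖b‖ = 1 := by rw [hb, Complex.norm_exp_ofReal_mul_I]
  have hnorm : ∀ T : ℝ, 0 ≤ T → T ≤ T₁ → ‖m T‖ ^ 2 = (R ^ 2 - 2 * R * T * Real.cos α + T ^ 2) /
      (1 + 2 * (κ * R) * T * Real.cos α + (κ * R) ^ 2 * T ^ 2) ∧
      0 < 1 + 2 * (κ * R) * T * Real.cos α + (κ * R) ^ 2 * T ^ 2 := fun T h0 h1 => by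
    have e1 := normSq_sub_exp_mul R (-1) α T
    have e2 := normSq_sub_exp_mul 1 (κ * R) α T
    rw [← ha] at e1 e2
    push_cast at e1 e2
    have e3 : (R : ℂ) - a * T = R + -1 * (a * T) := by ring
    have hp : 0 < ‖(1 : ℂ) + κ * R * (a * T)‖ ^ 2 :=
      pow_pos (norm_pos_iff.2 (hden T h0 h1)) 2
    rw [e2] at hp
    constructor
    · simp only [m, norm_div, norm_mul, hnb, one_mul, div_pow]
      rw [e3, e1, e2]
      ring_nf
    · linarith
  have hmd : ∀ T : ℝ, 0 ≤ T → T ≤ T₁ → HasDerivAt m (m' T) T := fun T h0 h1 => by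
    have hid := Complex.ofRealCLM.hasDerivAt (x := T)
    have h2 : HasDerivAt (fun T : ℝ => b * ((R : ℂ) - a * T)) (b * (-(a * 1))) T := by
      simpa using ((hid.const_mul a).const_sub (R : ℂ)).const_mul b
    have h3 : HasDerivAt (fun T : ℝ => (1 : ℂ) + κ * R * (a * T)) (κ * R * (a * 1)) T := by
      simpa using ((hid.const_mul a).const_mul ((κ : ℂ) * R)).const_add (1 : ℂ)
    convert! h2.fun_div h3 (hden T h0 h1) using 1
    simp only [m']
    congr 1
    ring
  have hm'd : ∀ T : ℝ, 0 ≤ T → T ≤ T₁ → HasDerivAt m'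
      (2 * (b * a * (1 + κ * R ^ 2)) * (κ * R * a) / (1 + κ * R * (a * T)) ^ 3) T :=
    fun T h0 h1 => by
    have hid := Complex.ofRealCLM.hasDerivAt (x := T)
    have h3 : HasDerivAt (fun T : ℝ => (1 : ℂ) + κ * R * (a * T)) (κ * R * (a * 1)) T := by
      simpa using ((hid.const_mul a).const_mul ((κ : ℂ) * R)).const_add (1 : ℂ)
    have hne := hden T h0 h1
    convert! (hasDerivAt_const T (-(b * a * (1 + κ * R ^ 2)))).fun_div (h3.fun_pow 2)
      (pow_ne_zero 2 hne) using 1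
    generalize (1 : ℂ) + κ * R * (a * T) = d at hne ⊢
    push_cast
    field_simp
    ring
  have hconj : ∀ T : ℝ, starRingEnd ℂ (m T) =
      b⁻¹ * ((R : ℂ) - a⁻¹ * T) / (1 + κ * R * (a⁻¹ * T)) := fun T => by
    have hca : starRingEnd ℂ a = a⁻¹ := by
      rw [Complex.inv_def, Complex.normSq_eq_norm_sq, ha, Complex.norm_exp_ofReal_mul_I]; simp
    have hcb : starRingEnd ℂ b = b⁻¹ := by
      rw [Complex.inv_def, Complex.normSq_eq_norm_sq, hnb]; simp
    simp [m, hca, hcb]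
  have ha0 : a ≠ 0 := Complex.exp_ne_zero _
  have hb0 : b ≠ 0 := Complex.exp_ne_zero _
  refine ⟨(τ, fun t => m (T t)), ⟨hτ, ?_, ⟨fun t => m' (T t) * (1 + κ * (T t : ℂ) ^ 2), ?_, ?_⟩,
    fun t ht => ?_, ?_⟩⟩
  · simp only [m, hT0]
    rw [Complex.ofReal_zero, mul_zero, mul_zero, sub_zero, add_zero, div_one, mul_comm]
  · have e : Complex.exp ((β + Real.pi + α) * Complex.I) = -(b * a) := by
      rw [add_mul, add_mul, Complex.exp_add, Complex.exp_add, Complex.exp_pi_mul_I, ← ha, ← hb]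
      ring
    rw [e]
    simp [m', hT0]
    ring
  · intro t ht
    obtain ⟨h0, h1⟩ := hTle t ht
    have hTt := hTd t ht
    constructor
    · have := ((hmd (T t) h0 h1).scomp t hTt).hasDerivWithinAt (s := Set.Icc 0 τ)
      convert! this using 1
      rw [Complex.real_smul]
      push_cast
      ring
    · have hd1 := (hm'd (T t) h0 h1).scomp t hTt
      have hd2 : HasDerivAt (fun t => (1 : ℂ) + κ * (T t : ℂ) ^ 2)
          (κ * (2 * (T t : ℂ) * ((1 + κ * T t ^ 2 : ℝ) : ℂ))) t := by
        have := ((hTt.ofReal_comp.fun_pow 2).const_mul (κ : ℂ)).const_add (1 : ℂ)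
        simpa using this
      have := (hd1.fun_mul hd2).hasDerivWithinAt (s := Set.Icc 0 τ)
      convert! this using 1
      have hden1 := hden (T t) h0 h1
      have hden2 : (1 : ℂ) + κ * R * (a⁻¹ * T t) ≠ 0 := fun h2 => by
        have hca : starRingEnd ℂ a = a⁻¹ := by
          rw [Complex.inv_def, Complex.normSq_eq_norm_sq, ha, Complex.norm_exp_ofReal_mul_I]; simp
        have h3 := congrArg (starRingEnd ℂ) h2
        rw [← hca] at h3
        simp at h3
        exact hden1 h3
      have hden3 : a + κ * R * T t ≠ 0 := fun h3 => hden2 (by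
        have : (1 : ℂ) + κ * R * (a⁻¹ * T t) = a⁻¹ * (a + κ * R * T t) := by field_simp
        rw [this, h3, mul_zero])
      have hSc : (1 : ℂ) + κ * R ^ 2 ≠ 0 := by exact_mod_cast hS.ne'
      have hTc : (1 : ℂ) + κ * (T t : ℂ) ^ 2 ≠ 0 := by
        have : 0 < 1 + κ * T t ^ 2 := by
          rcases le_or_gt 0 κ with hk | hk
          · positivity
          · have : T t ^ 2 ≤ T₁ ^ 2 := by gcongr
            nlinarith
        exact_mod_cast this.ne'
      -- This is the isometry property of the Möbius map, in the form needed to clear the conformal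
      -- factor from the geodesic equation.
      have hq : (1 : ℂ) + κ * (‖m (T t)‖ : ℂ) ^ 2 = (1 + κ * R ^ 2) * (1 + κ * (T t : ℂ) ^ 2) /
          ((1 + κ * R * (a * T t)) * (1 + κ * R * (a⁻¹ * T t))) := by
        have : ((‖m (T t)‖ : ℂ)) ^ 2 = m (T t) * starRingEnd ℂ (m (T t)) := by
          rw [Complex.mul_conj, Complex.normSq_eq_norm_sq]; push_cast; ring
        rw [this, hconj]
        simp only [m]
        have hy := mul_ne_zero hden1 hden2
        have hX : ∀ x y : ℂ, y ≠ 0 → (1 + κ * (x / y)) * y = y + κ * x := fun x y hy => by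
          field_simp
        rw [div_mul_div_comm, eq_div_iff hy, hX _ _ hy]
        field_simp
        ring
      rw [hq, hconj]
      simp only [m', Function.comp, Complex.real_smul]
      push_cast
      field_simp
      ring
  · have h0 := hTi t ht
    obtain ⟨e, hp⟩ := hnorm (T t) h0.1.le h0.2.le
    refine lt_of_pow_lt_pow_left₀ 2 hR.le ?_
    simp only
    rw [e, div_lt_iff₀ hp, ← sub_pos]
    have h1 : T t * (1 - κ * R ^ 2) < 2 * R * Real.cos α := by
      have := h0.2
      rwa [hT₁, lt_div_iff₀ hD] at this
    have e2 : R ^ 2 * (1 + 2 * (κ * R) * T t * Real.cos α + (κ * R) ^ 2 * T t ^ 2) -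
        (R ^ 2 - 2 * R * T t * Real.cos α + T t ^ 2) =
        T t * (1 + κ * R ^ 2) * (2 * R * Real.cos α - T t * (1 - κ * R ^ 2)) := by ring
    rw [e2]
    have := h0.1
    have : 0 < 2 * R * Real.cos α - T t * (1 - κ * R ^ 2) := by linarith
    positivity
  · simp only
    rw [hTτ]
    obtain ⟨e, hp⟩ := hnorm T₁ hT₁pos.le le_rfl
    have h1 : T₁ * (1 - κ * R ^ 2) = 2 * R * Real.cos α := by
      rw [hT₁, div_mul_cancel₀ _ hD.ne']
    refine (pow_left_inj₀ (norm_nonneg _) hR.le two_ne_zero).1 ?_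
    rw [e, div_eq_iff hp.ne']
    linear_combination T₁ * (1 + κ * R ^ 2) * h1

/-! ### Straightening of the geodesics by `Phi`. -/

/-- The complex direction `cos α + i sin α / w(R)` of the straightened geodesic. -/
def direction (κ R α : ℝ) : ℂ :=
  Real.cos α + (Real.sin α * ((1 - κ * R ^ 2) / (1 + κ * R ^ 2)) : ℝ) * Complex.I

theorem direction_re (κ R α : ℝ) : (direction κ R α).re = Real.cos α := by
  simp only [direction, Complex.add_re, Complex.ofReal_re, Complex.re_ofReal_mul, Complex.I_re,
    mul_zero, add_zero]

theorem direction_ne_zero {α : ℝ} (hα : 0 < Real.cos α) : direction κ R α ≠ 0 := fun h => by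
  have := direction_re κ R α
  rw [h] at this
  simp at this
  linarith

/-- `(γ' + κ γ² γ̄')/(1 + κ|γ|²)²` is conserved along a geodesic, and the velocity of `Φ ∘ γ` is
this constant times `w²/scale`. So `Φ ∘ γ` runs on a straight line, with affine parameter `S` and
`S' = w²`. The argument applies to every `γ` with `IsChord`, so the choice made in `xray` is
immaterial and uniqueness for the geodesic equation is never invoked. -/
theorem isChord_projective (hR : 0 < R) (h : R ^ 2 * |κ| < 1) {β α τ : ℝ} {γ : ℝ → ℂ}
    (hγ : IsChord κ R β α τ γ) (hα : 0 < Real.cos α) :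
    ContinuousOn γ (Set.Icc 0 τ) ∧ (∀ t ∈ Set.Icc 0 τ, ‖γ t‖ ≤ R) ∧
    ∃ S : ℝ → ℝ, S 0 = 0 ∧ S τ = 2 * scale κ R * Real.cos α / ‖direction κ R α‖ ^ 2 ∧
      (∀ t ∈ Set.Icc 0 τ, HasDerivWithinAt S (weight κ (γ t) ^ 2) (Set.Icc 0 τ) t) ∧
      ∀ t ∈ Set.Icc 0 τ, Phi κ R (γ t) =
        Complex.exp (β * Complex.I) * (1 - direction κ R α * (S t / scale κ R)) := by
  obtain ⟨hτ, hstart, ⟨γ', hγ'0, hode⟩, hin, hexit⟩ := hγ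
  have hDs := scale_pos hR h
  have hS := one_add_radius_pos h
  have hD := one_sub_radius_pos h
  have hcont : ContinuousOn γ (Set.Icc 0 τ) := fun t ht => (hode t ht).1.continuousWithinAt
  have hle : ∀ t ∈ Set.Icc 0 τ, ‖γ t‖ ≤ R := fun t ht => by
    rcases eq_or_lt_of_le ht.1 with h0 | h0
    · rw [← h0, hstart, norm_mul, Complex.norm_exp_ofReal_mul_I, Complex.norm_real,
        Real.norm_of_nonneg hR.le, mul_one]
    · rcases eq_or_lt_of_le ht.2 with h1 | h1
      · rw [h1, hexit]
      · exact (hin t ⟨h0, h1⟩).le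
  refine ⟨hcont, hle, ?_⟩
  set q := direction κ R α with hq
  have hq0 : q ≠ 0 := direction_ne_zero hα
  set b := Complex.exp (β * Complex.I) with hb
  have hb0 : b ≠ 0 := Complex.exp_ne_zero _
  have hnb : ‖b‖ = 1 := by rw [hb, Complex.norm_exp_ofReal_mul_I]
  have hDc : (scale κ R : ℂ) ≠ 0 := by exact_mod_cast hDs.ne'
  let Q : ℝ → ℂ := fun t => 1 + κ * (γ t * starRingEnd ℂ (γ t))
  have hQ : ∀ t, Q t = ((1 + κ * ‖γ t‖ ^ 2 : ℝ) : ℂ) := fun t => by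
    simp only [Q]; rw [Complex.mul_conj, Complex.normSq_eq_norm_sq]; push_cast; ring
  have hQ0 : ∀ t ∈ Set.Icc 0 τ, Q t ≠ 0 := fun t ht => by
    rw [hQ]; exact_mod_cast (one_add_pos h (hle t ht)).ne'
  let G : ℝ → ℂ := fun t => (γ' t + κ * γ t ^ 2 * starRingEnd ℂ (γ' t)) / Q t ^ 2
  have hGd : ∀ t ∈ Set.Icc 0 τ, HasDerivWithinAt G 0 (Set.Icc 0 τ) t := fun t ht => by
    obtain ⟨h1, h2⟩ := hode t ht
    have hd1 : HasDerivWithinAt (fun t => γ' t + κ * γ t ^ 2 * starRingEnd ℂ (γ' t)) _ _ t :=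
      h2.fun_add (((h1.fun_pow 2).const_mul (κ : ℂ)).fun_mul h2.star)
    have hd2 : HasDerivWithinAt (fun t => Q t ^ 2) _ _ t :=
      (((h1.fun_mul h1.star).const_mul (κ : ℂ)).const_add (1 : ℂ)).fun_pow 2
    convert! hd1.fun_div hd2 (pow_ne_zero 2 (hQ0 t ht)) using 1
    have hQt : (1 : ℂ) + κ * (‖γ t‖ : ℂ) ^ 2 = Q t := by rw [hQ]; push_cast; ring
    have hsr : ∀ z : ℂ, star z = starRingEnd ℂ z := fun z => rfl
    rw [hQt]
    simp only [hsr, map_div₀, map_mul, map_pow, Complex.conj_conj, Complex.conj_ofReal, map_ofNat]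
    have hQc : starRingEnd ℂ (Q t) = Q t := by rw [hQ, Complex.conj_ofReal]
    rw [hQc, eq_comm, div_eq_zero_iff]
    left
    have hne := hQ0 t ht
    field_simp
    simp only [Q]
    ring
  have hGc : ∀ t ∈ Set.Icc 0 τ, G t = G 0 :=
    constant_of_has_deriv_right_zero (fun t ht => (hGd t ht).continuousWithinAt)
      (fun t ht => (hGd t ⟨ht.1, ht.2.le⟩).mono_of_mem_nhdsWithin
        (Icc_mem_nhdsGE_of_mem ht))
  have hG0 : G 0 = -(b * q) := by
    have hQ00 : Q 0 = 1 + κ * R ^ 2 := by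
      rw [hQ, hstart, norm_mul, Complex.norm_exp_ofReal_mul_I, Complex.norm_real,
        Real.norm_of_nonneg hR.le, mul_one]; push_cast; ring
    have hSc : (1 : ℂ) + κ * R ^ 2 ≠ 0 := by exact_mod_cast hS.ne'
    have e : Complex.exp ((β + Real.pi + α) * Complex.I) =
        -(b * (Real.cos α + Real.sin α * Complex.I)) := by
      rw [add_mul, add_mul, Complex.exp_add, Complex.exp_add, Complex.exp_pi_mul_I, ← hb,
        Complex.exp_mul_I, Complex.ofReal_cos, Complex.ofReal_sin]
      ring
    have hcb : starRingEnd ℂ b = b⁻¹ := by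
      rw [Complex.inv_def, Complex.normSq_eq_norm_sq, hnb]; simp
    simp only [G]
    rw [hQ00, hγ'0, hstart, e, hq, direction]
    simp only [map_mul, map_add, map_neg, map_one, map_pow, Complex.conj_ofReal, Complex.conj_I, hcb]
    push_cast
    field_simp
    ring
  -- `Z` is the affine parameter, a priori complex; its derivative is real and it starts at zero, so
  -- it is real.
  let Z : ℝ → ℂ := fun t => (Phi κ R (γ t) - b) * (scale κ R : ℂ) / (-(b * q))
  have hZd : ∀ t ∈ Set.Icc 0 τ, HasDerivWithinAt Z ((weight κ (γ t) ^ 2 : ℝ) : ℂ)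
      (Set.Icc 0 τ) t := fun t ht => by
    have h1 := (hasFDerivAt_Phi hR h (hle t ht)).comp_hasDerivWithinAt t (hode t ht).1
    convert! (((h1.sub_const b).mul_const (scale κ R : ℂ)).div_const (-(b * q))) using 1
    have h2 : γ' t + κ * γ t ^ 2 * starRingEnd ℂ (γ' t) = -(b * q) * Q t ^ 2 := by
      rw [← hG0, ← hGc t ht]
      simp only [G]
      rw [div_mul_cancel₀ _ (pow_ne_zero 2 (hQ0 t ht))]
    rw [dPhi_apply, h2, hQ, weight]
    have h3 : (1 - κ * ‖γ t‖ ^ 2 : ℂ) ≠ 0 := by exact_mod_cast (one_sub_pos h (hle t ht)).ne'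
    push_cast
    field_simp
  have hPhi0 : Phi κ R (γ 0) = b := by
    have hRc : (R : ℂ) ≠ 0 := by exact_mod_cast hR.ne'
    have h3 : (1 - κ * R ^ 2 : ℂ) ≠ 0 := by exact_mod_cast hD.ne'
    rw [Phi, hstart, norm_mul, hnb, Complex.norm_real,
      Real.norm_of_nonneg hR.le, mul_one, div_self hD.ne', Complex.ofReal_one, one_mul,
      mul_div_cancel_left₀ _ hRc]
  have hZ0 : Z 0 = 0 := by simp [Z, hPhi0]
  have him : ∀ t ∈ Set.Icc 0 τ, (Z t).im = 0 := fun t ht => by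
    have hd : ∀ t ∈ Set.Icc 0 τ, HasDerivWithinAt (fun t => (Z t).im) 0 (Set.Icc 0 τ) t :=
      fun t ht => by
        have := Complex.imCLM.hasFDerivAt.comp_hasDerivWithinAt t (hZd t ht)
        rw [Complex.imCLM_apply, Complex.ofReal_im] at this
        exact this
    have := constant_of_has_deriv_right_zero (fun t ht => (hd t ht).continuousWithinAt)
      (fun t ht => (hd t ⟨ht.1, ht.2.le⟩).mono_of_mem_nhdsWithin (Icc_mem_nhdsGE_of_mem ht)) t ht
    rw [this, hZ0]; rfl
  have hSd : ∀ t ∈ Set.Icc 0 τ,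
      HasDerivWithinAt (fun t => (Z t).re) (weight κ (γ t) ^ 2) (Set.Icc 0 τ) t := fun t ht => by
    have := Complex.reCLM.hasFDerivAt.comp_hasDerivWithinAt t (hZd t ht)
    rw [Complex.reCLM_apply, Complex.ofReal_re] at this
    exact this
  have hrep : ∀ t ∈ Set.Icc 0 τ, Phi κ R (γ t) = b * (1 - q * ((Z t).re / scale κ R)) := fun t ht => by
    have h1 : ((Z t).re : ℂ) = Z t := by
      apply Complex.ext
      · simp
      · simp [him t ht]
    rw [h1]
    simp only [Z]
    field_simp
    ring
  refine ⟨fun t => (Z t).re, by simp [hZ0], ?_, hSd, hrep⟩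
  -- Positivity singles out the exit point: `|1 - q s| = 1` also has the root `s = 0`, the starting
  -- point.
  have hpos : 0 < (Z τ).re := by
    obtain ⟨c, hc, hc'⟩ := exists_hasDerivAt_eq_slope (fun t => (Z t).re)
      (fun t => weight κ (γ t) ^ 2) hτ (fun t ht => (hSd t ht).continuousWithinAt)
      (fun t ht => (hSd t ⟨ht.1.le, ht.2.le⟩).hasDerivAt (Icc_mem_nhds ht.1 ht.2))
    have hw := weight_pos h (hle c ⟨hc.1.le, hc.2.le⟩)
    rw [hZ0, Complex.zero_re, sub_zero, sub_zero] at hc'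
    have : 0 < (Z τ).re / τ := by rw [← hc']; positivity
    exact (div_pos_iff_of_pos_right hτ).1 this
  have hend : ‖(1 : ℂ) - q * ((Z τ).re / scale κ R)‖ ^ 2 = 1 := by
    have h1 := norm_Phi_eq_one hR h hexit
    rw [hrep τ ⟨hτ.le, le_rfl⟩, norm_mul, hnb, one_mul] at h1
    rw [h1, one_pow]
  have hexp : ‖(1 : ℂ) - q * ((Z τ).re / scale κ R)‖ ^ 2 =
      1 - 2 * Real.cos α * ((Z τ).re / scale κ R) + ‖q‖ ^ 2 * ((Z τ).re / scale κ R) ^ 2 := by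
    have hqr := direction_re κ R α
    rw [← hq] at hqr
    rw [← hqr, ← Complex.ofReal_div, ← Complex.normSq_eq_norm_sq, ← Complex.normSq_eq_norm_sq,
      Complex.normSq_apply, Complex.normSq_apply]
    simp
    ring
  rw [hexp] at hend
  set s := (Z τ).re / scale κ R with hs
  have hs0 : 0 < s := div_pos hpos hDs
  have hnq : 0 < ‖q‖ := norm_pos_iff.2 hq0
  have h2 : ‖q‖ ^ 2 * s = 2 * Real.cos α := by
    apply mul_left_cancel₀ hs0.ne'
    linear_combination hend
  have h3 : (Z τ).re = scale κ R * s := by rw [hs]; field_simp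
  simp only
  rw [h3, eq_div_iff (by positivity)]
  linear_combination scale κ R * h2

theorem mem_unitDisk_of_chord {q : ℂ} {s : ℝ} (h0 : 0 ≤ s) (h1 : s * ‖q‖ ^ 2 ≤ 2 * q.re) (β : ℝ) :
    Complex.exp (β * Complex.I) * (1 - q * s) ∈ unitDisk := by
  rw [mem_closedBall_zero_iff, norm_mul, Complex.norm_exp_ofReal_mul_I, one_mul,
    ← sq_le_one_iff₀ (norm_nonneg _), ← Complex.normSq_eq_norm_sq, Complex.normSq_apply]
  rw [← Complex.normSq_eq_norm_sq, Complex.normSq_apply] at h1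
  simp
  nlinarith

/-- The X-ray transform of `w² · u ∘ Φ` as an integral over a Euclidean chord. -/
theorem xray_eq_integral (hR : 0 < R) (h : R ^ 2 * |κ| < 1) (β : ℝ) {α : ℝ} (hα : 0 < Real.cos α)
    {f u : ℂ → ℂ} (hu : ContinuousOn u unitDisk)
    (hf : ∀ z, ‖z‖ ≤ R → f z = (weight κ z : ℂ) ^ 2 * u (Phi κ R z)) :
    xray κ R f (β, α) = scale κ R * ∫ s in (0 : ℝ)..2 * Real.cos α / ‖direction κ R α‖ ^ 2,
      u (Complex.exp (β * Complex.I) * (1 - direction κ R α * s)) := by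
  have hex := exists_isChord hR h β hα
  have hDs := scale_pos hR h
  rw [xray, dif_pos hex]
  obtain ⟨hcont, hle, S, hS0, hSτ, hSd, hrep⟩ := isChord_projective hR h hex.choose_spec hα
  have hpos := hex.choose_spec.pos
  set τ := hex.choose.1
  set γ := hex.choose.2
  set q := direction κ R α
  set g : ℝ → ℂ := fun s => u (Complex.exp (β * Complex.I) * (1 - q * (s / scale κ R))) with hg
  have hmem : ∀ t ∈ Set.Icc 0 τ, Phi κ R (γ t) ∈ unitDisk := fun t ht =>
    mapsTo_Phi hR h (by simpa using hle t ht)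
  have hSc : ContinuousOn S (Set.Icc 0 τ) := fun t ht => (hSd t ht).continuousWithinAt
  have hw : ContinuousOn (fun t => weight κ (γ t) ^ 2) (Set.Icc 0 τ) :=
    ((continuousOn_weight h).comp hcont (fun t ht => by simpa using hle t ht)).pow 2
  have hgc : ContinuousOn g (S '' Set.Icc 0 τ) := by
    refine hu.comp (Continuous.continuousOn (by fun_prop)) ?_
    rintro _ ⟨t, ht, rfl⟩
    change Complex.exp (β * Complex.I) * (1 - q * (S t / scale κ R)) ∈ unitDisk
    rw [← hrep t ht]
    exact hmem t ht
  have hIcc : Set.uIcc 0 τ = Set.Icc 0 τ := Set.uIcc_of_le hpos.le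
  -- Substitution `s = S(t)`: the factor `w²` in front of `u ∘ Φ` is exactly `dS/dt`.
  have hsub := intervalIntegral.integral_deriv_smul_comp'' (f := S)
    (f' := fun t => weight κ (γ t) ^ 2) (g := g) (a := 0) (b := τ) (by rwa [hIcc])
    (fun t ht => by
      rw [min_eq_left hpos.le, max_eq_right hpos.le] at ht
      exact ((hSd t ⟨ht.1.le, ht.2.le⟩).hasDerivAt (Icc_mem_nhds ht.1 ht.2)).hasDerivWithinAt)
    (by rwa [hIcc]) (by rwa [hIcc])
  have hl : ∫ t in (0 : ℝ)..τ, f (γ t) = ∫ t in (0 : ℝ)..τ, weight κ (γ t) ^ 2 • (g ∘ S) t := by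
    refine intervalIntegral.integral_congr fun t ht => ?_
    rw [hIcc] at ht
    simp only [Function.comp, hg]
    rw [hf _ (hle t ht), hrep t ht, Complex.real_smul]
    push_cast
    rfl
  rw [hl, hsub, hS0, hSτ]
  have hscale := intervalIntegral.integral_comp_mul_right
    (fun s => g s) hDs.ne' (a := 0) (b := 2 * Real.cos α / ‖q‖ ^ 2)
  rw [zero_mul, show 2 * Real.cos α / ‖q‖ ^ 2 * scale κ R =
    2 * scale κ R * Real.cos α / ‖q‖ ^ 2 by ring] at hscale
  have hDc : (scale κ R : ℂ) ≠ 0 := by exact_mod_cast hDs.ne'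
  have e : ∀ s : ℝ, g (s * scale κ R) = u (Complex.exp (β * Complex.I) * (1 - q * s)) := fun s => by
    simp only [hg]
    push_cast
    rw [mul_div_cancel_right₀ _ hDc]
  simp_rw [e] at hscale
  rw [hscale, Complex.real_smul, ← mul_assoc]
  push_cast
  rw [mul_inv_cancel₀ hDc, one_mul]

end

/-! ### The X-ray transform of the basis -/

section

variable {κ R : ℝ}

/-- The angle of the straightened geodesic with the inner normal. -/
def angle (κ R α : ℝ) : ℝ := Real.arctan (Real.tan α * ((1 - κ * R ^ 2) / (1 + κ * R ^ 2)))

theorem direction_im (κ R α : ℝ) :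
    (direction κ R α).im = Real.sin α * ((1 - κ * R ^ 2) / (1 + κ * R ^ 2)) := by
  simp only [direction, Complex.add_im, Complex.ofReal_im, Complex.im_ofReal_mul, Complex.I_im,
    mul_one, zero_add]

theorem normSq_direction (κ R α : ℝ) : ‖direction κ R α‖ ^ 2 =
    Real.cos α ^ 2 + Real.sin α ^ 2 * ((1 - κ * R ^ 2) / (1 + κ * R ^ 2)) ^ 2 := by
  rw [← Complex.normSq_eq_norm_sq, Complex.normSq_apply, direction_re, direction_im]
  ring

theorem norm_direction_mul_exp {α : ℝ} (hα : 0 < Real.cos α) :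
    (‖direction κ R α‖ : ℂ) * Complex.exp (angle κ R α * Complex.I) = direction κ R α := by
  have h1 : angle κ R α = (direction κ R α).arg := by
    have h2 : |(direction κ R α).arg| < Real.pi / 2 :=
      Complex.abs_arg_lt_pi_div_two_iff.2 (Or.inl (by rwa [direction_re]))
    rw [abs_lt] at h2
    rw [angle, ← Real.arctan_tan h2.1 h2.2, Complex.tan_arg, direction_re, direction_im,
      Real.tan_eq_sin_div_cos]
    ring_nf
  rw [h1, Complex.norm_mul_exp_arg_mul_I]

theorem norm_direction_mul_cos {α : ℝ} (hα : 0 < Real.cos α) :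
    ‖direction κ R α‖ * Real.cos (angle κ R α) = Real.cos α := by
  have h1 := congrArg Complex.re (norm_direction_mul_exp (κ := κ) (R := R) hα)
  rwa [Complex.re_ofReal_mul, Complex.exp_ofReal_mul_I_re, direction_re] at h1

/-- With `q = N e^{iθ}`, the points `e^{iβ}(1 - q s)` form the chord with unit normal
`e^{i(β+θ-π/2)}` at signed distance `sin θ`, and `v = cos θ - N s` is arc length measured from its
midpoint. Hence the factor `1/N` and the angle `π/2 - θ` in the role of `ψ`. -/
theorem xray_eq_integral_chord (hR : 0 < R) (h : R ^ 2 * |κ| < 1) (β : ℝ) {α : ℝ}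
    (hα : 0 < Real.cos α) {f u : ℂ → ℂ} (hu : ContinuousOn u unitDisk)
    (hf : ∀ z, ‖z‖ ≤ R → f z = (weight κ z : ℂ) ^ 2 * u (Phi κ R z)) :
    xray κ R f (β, α) = ((scale κ R / ‖direction κ R α‖ : ℝ) : ℂ) *
      ∫ v in -Real.sin (Real.pi / 2 - angle κ R α)..Real.sin (Real.pi / 2 - angle κ R α),
        u (Complex.exp ((β + angle κ R α - Real.pi / 2 : ℝ) * Complex.I) *
          (Real.cos (Real.pi / 2 - angle κ R α) + v * Complex.I)) := by
  rw [xray_eq_integral hR h β hα hu hf]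
  set θ := angle κ R α
  set N := ‖direction κ R α‖ with hN
  have hN0 : 0 < N := norm_pos_iff.2 (direction_ne_zero hα)
  have hc : N * Real.cos θ = Real.cos α := norm_direction_mul_cos hα
  have hq : (N : ℂ) * Complex.exp (θ * Complex.I) = direction κ R α := norm_direction_mul_exp hα
  have h1 := intervalIntegral.integral_comp_sub_mul (a := 0) (b := 2 * Real.cos α / N ^ 2)
    (fun v : ℝ => u (Complex.exp ((β + θ - Real.pi / 2 : ℝ) * Complex.I) *
          (Real.cos (Real.pi / 2 - θ) + v * Complex.I))) hN0.ne' (Real.cos θ)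
  have h2 : Real.cos θ - N * (2 * Real.cos α / N ^ 2) = -Real.cos θ := by
    rw [← hc]; field_simp; ring
  rw [h2, mul_zero, sub_zero] at h1
  rw [Real.sin_pi_div_two_sub, Complex.ofReal_div, div_mul_eq_mul_div,
    mul_div_assoc (scale κ R : ℂ)]
  rw [Complex.real_smul, Complex.ofReal_inv, ← div_eq_inv_mul] at h1
  rw [← h1]
  congr 1
  refine intervalIntegral.integral_congr fun s _ => ?_
  have h3 : Complex.exp ((β + θ - Real.pi / 2 : ℝ) * Complex.I) =
      Complex.exp (β * Complex.I) * Complex.exp (θ * Complex.I) * -Complex.I := by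
    push_cast
    rw [sub_mul, add_mul, sub_eq_add_neg, Complex.exp_add, Complex.exp_add, ← neg_mul,
      ← neg_div, Complex.exp_neg_pi_div_two_mul_I]
  have h4 : Complex.exp (θ * Complex.I) * (Real.cos θ - Real.sin θ * Complex.I) = 1 := by
    have := Real.sin_sq_add_cos_sq θ
    have h5 : (Real.sin θ : ℂ) ^ 2 + (Real.cos θ : ℂ) ^ 2 = 1 := by exact_mod_cast this
    rw [Complex.exp_mul_I, ← Complex.ofReal_cos, ← Complex.ofReal_sin]
    linear_combination h5 - (Real.sin θ : ℂ) ^ 2 * Complex.I_sq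
  congr 1
  rw [h3, Real.cos_pi_div_two_sub, ← hq]
  push_cast
  rw [Complex.ofReal_cos, Complex.ofReal_sin] at h4
  linear_combination Complex.exp (β * Complex.I) * (-1 : ℂ) * h4 + Complex.exp (β * Complex.I) *
    Complex.exp (θ * Complex.I) * (Complex.cos θ - N * s) * Complex.I_sq

/-- The X-ray transform of `w² · cbasis i ∘ Φ`. -/
def xrayBasis (κ R : ℝ) (i : ℕ × ℕ) (p : ℝ × ℝ) : ℝ :=
  scale κ R / ‖direction κ R p.2‖ * (2 / (deg i + 1) *
    Real.sin ((deg i + 1) * (Real.pi / 2 - angle κ R p.2)) *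
      chebU (deg i) (Real.cos (p.1 + angle κ R p.2 - Real.pi / 2 - i.1 * Real.pi / (deg i + 1))))

theorem xray_linearCombination (hR : 0 < R) (h : R ^ 2 * |κ| < 1) (c : ℕ × ℕ →₀ ℂ) (β : ℝ) {α : ℝ}
    (hα : 0 < Real.cos α) {f : ℂ → ℂ} (hf : ∀ z, ‖z‖ ≤ R → f z =
      (weight κ z : ℂ) ^ 2 * Finsupp.linearCombination ℂ cbasis c (Phi κ R z)) :
    xray κ R f (β, α) = c.sum fun i a => a * (xrayBasis κ R i (β, α) : ℂ) := by
  have hsum : ∀ x, Finsupp.linearCombination ℂ cbasis c x = ∑ i ∈ c.support, c i * cbasis i x :=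
    fun x => by
      simp [Finsupp.linearCombination_apply, Finsupp.sum, Finset.sum_apply]
  have hcont : Continuous (Finsupp.linearCombination ℂ cbasis c) := by
    rw [funext hsum]
    exact continuous_finsetSum _ fun i _ => continuous_const.mul (continuous_cbasis i)
  rw [xray_eq_integral_chord hR h β hα hcont.continuousOn hf]
  simp_rw [hsum]
  have hcb := continuous_cbasis
  rw [intervalIntegral.integral_finsetSum fun i _ =>
    (Continuous.intervalIntegrable (by fun_prop) _ _), Finsupp.sum, Finset.mul_sum]
  refine Finset.sum_congr rfl fun i _ => ?_
  rw [intervalIntegral.integral_const_mul, mul_left_comm]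
  congr 1
  simp only [cbasis, ridgeBasis]
  rw [intervalIntegral.integral_ofReal, integral_ridge_chord, ← Complex.ofReal_mul, xrayBasis]

/-- Both transforms are integrals over the same bounded parameter interval, so uniform approximation
on the disk gives convergence of the transforms at every inward vector. -/
theorem norm_xray_sub_le (hR : 0 < R) (h : R ^ 2 * |κ| < 1) (β : ℝ) {α : ℝ}
    (hα : 0 < Real.cos α) {f g u v : ℂ → ℂ} (hu : ContinuousOn u unitDisk)
    (hv : ContinuousOn v unitDisk)
    (hf : ∀ z, ‖z‖ ≤ R → f z = (weight κ z : ℂ) ^ 2 * u (Phi κ R z))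
    (hg : ∀ z, ‖z‖ ≤ R → g z = (weight κ z : ℂ) ^ 2 * v (Phi κ R z)) {ε : ℝ}
    (hε : ∀ x ∈ unitDisk, ‖u x - v x‖ ≤ ε) :
    ‖xray κ R f (β, α) - xray κ R g (β, α)‖ ≤
      ε * (scale κ R * (2 * Real.cos α / ‖direction κ R α‖ ^ 2)) := by
  have hDs := scale_pos hR h
  have hN : 0 < ‖direction κ R α‖ := norm_pos_iff.2 (direction_ne_zero hα)
  have hb : 0 ≤ 2 * Real.cos α / ‖direction κ R α‖ ^ 2 := by positivity
  have hmem : ∀ s ∈ Set.uIcc (0 : ℝ) (2 * Real.cos α / ‖direction κ R α‖ ^ 2),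
      Complex.exp (β * Complex.I) * (1 - direction κ R α * s) ∈ unitDisk := fun s hs => by
    rw [Set.uIcc_of_le hb] at hs
    refine mem_unitDisk_of_chord hs.1 ?_ β
    rw [direction_re]
    exact (le_div_iff₀ (by positivity)).1 hs.2
  have hint : ∀ u : ℂ → ℂ, ContinuousOn u unitDisk → IntervalIntegrable
      (fun s : ℝ => u (Complex.exp (β * Complex.I) * (1 - direction κ R α * s))) volume 0
        (2 * Real.cos α / ‖direction κ R α‖ ^ 2) := fun u hu =>
    (hu.comp (Continuous.continuousOn (by fun_prop)) hmem).intervalIntegrable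
  rw [xray_eq_integral hR h β hα hu hf, xray_eq_integral hR h β hα hv hg, ← mul_sub,
    ← intervalIntegral.integral_sub (hint u hu) (hint v hv), norm_mul, Complex.norm_real,
    Real.norm_of_nonneg hDs.le, mul_left_comm]
  refine mul_le_mul_of_nonneg_left ?_ hDs.le
  refine (intervalIntegral.norm_integral_le_of_norm_le_const fun s hs =>
    hε _ (hmem s (Set.uIoc_subset_uIcc hs))).trans_eq ?_
  rw [sub_zero, abs_of_nonneg hb]

/-! ### Orthogonality of the images -/

theorem cos_pos_of_mem {α : ℝ} (hα : α ∈ Set.Ioo (-(Real.pi / 2)) (Real.pi / 2)) :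
    0 < Real.cos α := Real.cos_pos_of_mem_Ioo hα

theorem hasDerivAt_angle (h : R ^ 2 * |κ| < 1) {α : ℝ} (hα : 0 < Real.cos α) :
    HasDerivAt (angle κ R)
      (((1 - κ * R ^ 2) / (1 + κ * R ^ 2)) / ‖direction κ R α‖ ^ 2) α := by
  have h1 := ((Real.hasDerivAt_tan hα.ne').mul_const
    ((1 - κ * R ^ 2) / (1 + κ * R ^ 2))).arctan
  refine HasDerivAt.congr_deriv h1 ?_
  rw [normSq_direction, Real.tan_eq_sin_div_cos]
  have hν : 0 < (1 - κ * R ^ 2) / (1 + κ * R ^ 2) :=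
    div_pos (one_sub_radius_pos h) (one_add_radius_pos h)
  generalize (1 - κ * R ^ 2) / (1 + κ * R ^ 2) = ν at hν ⊢
  have h2 : Real.cos α ^ 2 + Real.sin α ^ 2 * ν ^ 2 ≠ 0 := by positivity
  have h3 : 1 + (Real.sin α / Real.cos α * ν) ^ 2 ≠ 0 := by positivity
  field_simp

theorem image_angle (h : R ^ 2 * |κ| < 1) :
    angle κ R '' Set.Ioo (-(Real.pi / 2)) (Real.pi / 2) =
      Set.Ioo (-(Real.pi / 2)) (Real.pi / 2) := by
  have hν : 0 < (1 - κ * R ^ 2) / (1 + κ * R ^ 2) :=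
    div_pos (one_sub_radius_pos h) (one_add_radius_pos h)
  refine Set.Subset.antisymm ?_ fun θ hθ =>
    ⟨Real.arctan (Real.tan θ / ((1 - κ * R ^ 2) / (1 + κ * R ^ 2))), Real.arctan_mem_Ioo _, ?_⟩
  · rintro _ ⟨α, _, rfl⟩
    exact Real.arctan_mem_Ioo _
  · rw [angle, Real.tan_arctan, div_mul_cancel₀ _ hν.ne', Real.arctan_tan hθ.1 hθ.2]

theorem injOn_angle (h : R ^ 2 * |κ| < 1) :
    Set.InjOn (angle κ R) (Set.Ioo (-(Real.pi / 2)) (Real.pi / 2)) := fun α hα α' hα' e => by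
  have hν : 0 < (1 - κ * R ^ 2) / (1 + κ * R ^ 2) :=
    div_pos (one_sub_radius_pos h) (one_add_radius_pos h)
  exact Real.injOn_tan hα hα' (mul_right_cancel₀ hν.ne' (Real.arctan_injective e))

/-- The weight `‖direction‖^(-2)` left by the squared amplitude of `xrayBasis` is, up to a constant,
the Jacobian of `α ↦ angle`; in the new variable the curvature survives only in the constant. -/
theorem integral_angle (h : R ^ 2 * |κ| < 1) (g : ℝ → ℝ) :
    ∫ α in Set.Ioo (-(Real.pi / 2)) (Real.pi / 2),
        (‖direction κ R α‖ ^ 2)⁻¹ * g (Real.pi / 2 - angle κ R α) =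
      ((1 + κ * R ^ 2) / (1 - κ * R ^ 2)) * ∫ ψ in (0 : ℝ)..Real.pi, g ψ := by
  have hS := one_add_radius_pos h
  have hD := one_sub_radius_pos h
  have h1 := integral_image_eq_integral_abs_deriv_smul (measurableSet_Ioo)
    (fun α hα => (hasDerivAt_angle h (cos_pos_of_mem hα)).hasDerivWithinAt) (injOn_angle h)
    (fun θ => g (Real.pi / 2 - θ))
  rw [image_angle h] at h1
  have h2 : ∫ θ in Set.Ioo (-(Real.pi / 2)) (Real.pi / 2), g (Real.pi / 2 - θ) =
      ∫ ψ in (0 : ℝ)..Real.pi, g ψ := by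
    rw [← integral_Ioc_eq_integral_Ioo, ← intervalIntegral.integral_of_le
      (by linarith [Real.pi_pos]), intervalIntegral.integral_comp_sub_left (fun x => g x)]
    congr 1 <;> ring
  rw [← h2, h1, ← integral_const_mul]
  refine setIntegral_congr_fun measurableSet_Ioo fun α hα => ?_
  have hN : 0 < ‖direction κ R α‖ := norm_pos_iff.2 (direction_ne_zero (cos_pos_of_mem hα))
  simp only [smul_eq_mul]
  rw [abs_of_pos (by positivity)]
  field_simp

theorem integral_chebU_shift (n m : ℕ) (c a b : ℝ) :
    ∫ β in (0 : ℝ)..2 * Real.pi, chebU n (Real.cos (β + c - a)) * chebU m (Real.cos (β + c - b)) =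
      ∫ β in (0 : ℝ)..2 * Real.pi, chebU n (Real.cos (β - a)) * chebU m (Real.cos (β - b)) := by
  have hper : Function.Periodic
      (fun β => chebU n (Real.cos (β - a)) * chebU m (Real.cos (β - b))) (2 * Real.pi) := fun β => by
    simp only
    rw [add_sub_right_comm, add_sub_right_comm, Real.cos_add_two_pi, Real.cos_add_two_pi]
  have h1 := intervalIntegral.integral_comp_add_right (a := 0) (b := 2 * Real.pi)
    (fun β => chebU n (Real.cos (β - a)) * chebU m (Real.cos (β - b))) c
  rw [h1, zero_add, add_comm (2 * Real.pi) c]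
  simpa using hper.intervalIntegral_add_eq c 0

theorem exists_direction_lower (h : R ^ 2 * |κ| < 1) :
    ∃ m : ℝ, 0 < m ∧ ∀ α, m ≤ ‖direction κ R α‖ := by
  have hν : 0 < (1 - κ * R ^ 2) / (1 + κ * R ^ 2) :=
    div_pos (one_sub_radius_pos h) (one_add_radius_pos h)
  refine ⟨min 1 ((1 - κ * R ^ 2) / (1 + κ * R ^ 2)), by positivity, fun α => ?_⟩
  refine le_of_pow_le_pow_left₀ two_ne_zero (norm_nonneg _) ?_
  rw [normSq_direction]
  generalize (1 - κ * R ^ 2) / (1 + κ * R ^ 2) = ν at hν ⊢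
  have h1 := Real.sin_sq_add_cos_sq α
  have h2 : min 1 ν ^ 2 ≤ 1 ^ 2 := pow_le_pow_left₀ (by positivity) (min_le_left _ _) 2
  have h3 : min 1 ν ^ 2 ≤ ν ^ 2 := pow_le_pow_left₀ (by positivity) (min_le_right _ _) 2
  nlinarith [sq_nonneg (Real.sin α), sq_nonneg (Real.cos α)]

/-- The fan-beam coordinate domain. -/
def fanDomain : Set (ℝ × ℝ) :=
  Set.Ioc 0 (2 * Real.pi) ×ˢ Set.Ioo (-(Real.pi / 2)) (Real.pi / 2)

theorem measurableSet_fanDomain : MeasurableSet fanDomain := measurableSet_Ioc.prod measurableSet_Ioo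

theorem continuousOn_xrayBasis (h : R ^ 2 * |κ| < 1) (i : ℕ × ℕ) :
    ContinuousOn (xrayBasis κ R i) fanDomain := by
  have hang : ContinuousOn (fun p : ℝ × ℝ => angle κ R p.2) fanDomain := fun p hp =>
    ((hasDerivAt_angle h (cos_pos_of_mem hp.2)).continuousAt.comp
      continuous_snd.continuousAt).continuousWithinAt
  have hdir : ContinuousOn (fun p : ℝ × ℝ => ‖direction κ R p.2‖) fanDomain := by
    unfold direction
    fun_prop
  refine (continuousOn_const.div hdir fun p hp => ?_).mul ((continuousOn_const.mul
    (Real.continuous_sin.comp_continuousOn (continuousOn_const.mul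
      (continuousOn_const.sub hang)))).mul ((continuous_chebU _).comp_continuousOn
        (Real.continuous_cos.comp_continuousOn
          (((continuousOn_fst.add hang).sub continuousOn_const).sub continuousOn_const))))
  exact norm_ne_zero_iff.2 (direction_ne_zero (cos_pos_of_mem hp.2))

theorem exists_abs_xrayBasis_le (hR : 0 < R) (h : R ^ 2 * |κ| < 1) (i : ℕ × ℕ) :
    ∃ C, ∀ p, |xrayBasis κ R i p| ≤ C := by
  obtain ⟨m, hm, hN⟩ := exists_direction_lower h
  have hD := scale_pos hR h
  refine ⟨scale κ R / m * (2 / (deg i + 1) * 1 * (deg i + 1)), fun p => ?_⟩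
  rw [xrayBasis, abs_mul, abs_mul, abs_mul]
  have h1 : 0 < ‖direction κ R p.2‖ := hm.trans_le (hN _)
  gcongr
  · rw [abs_of_pos (by positivity)]
    gcongr
    exact hN _
  · rw [abs_of_pos (by positivity)]
  · exact Real.abs_sin_le_one _
  · exact abs_chebU_le _ (Real.abs_cos_le_one _)

theorem bdryMeasure_eq (κ R : ℝ) : bdryMeasure κ R =
    ENNReal.ofReal (R / (1 + κ * R ^ 2)) • volume.restrict fanDomain := rfl

instance isFiniteMeasure_fanDomain : IsFiniteMeasure (volume.restrict fanDomain) :=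
  ⟨by
    rw [Measure.restrict_apply_univ, fanDomain, Measure.volume_eq_prod, Measure.prod_prod,
      Real.volume_Ioc, Real.volume_Ioo]
    exact ENNReal.mul_lt_top ENNReal.ofReal_lt_top ENNReal.ofReal_lt_top⟩

theorem ae_bdryMeasure_mem (κ R : ℝ) : ∀ᵐ p ∂(bdryMeasure κ R), p ∈ fanDomain := by
  rw [bdryMeasure_eq]
  exact Measure.ae_smul_measure (ae_restrict_mem measurableSet_fanDomain) _

theorem memLp_xrayBasis (hR : 0 < R) (h : R ^ 2 * |κ| < 1) (i : ℕ × ℕ) :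
    MemLp (fun p => (xrayBasis κ R i p : ℂ)) 2 (bdryMeasure κ R) := by
  obtain ⟨C, hC⟩ := exists_abs_xrayBasis_le hR h i
  rw [bdryMeasure_eq]
  refine MemLp.smul_measure ?_ ENNReal.ofReal_ne_top
  refine MemLp.of_bound ?_ C (Filter.Eventually.of_forall fun p => ?_)
  · exact (Complex.continuous_ofReal.comp_continuousOn
      (continuousOn_xrayBasis h i)).aestronglyMeasurable measurableSet_fanDomain
  · simpa using hC p

/-- The squared norms of the X-ray transforms of the basis, up to the factor `1 / (deg i + 1)`. -/
def imageConst (κ R : ℝ) : ℝ :=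
  R / (1 + κ * R ^ 2) * (scale κ R ^ 2 * ((1 + κ * R ^ 2) / (1 - κ * R ^ 2)) * (4 * Real.pi ^ 2))

theorem imageConst_pos (hR : 0 < R) (h : R ^ 2 * |κ| < 1) : 0 < imageConst κ R := by
  have hS := one_add_radius_pos h
  have hD := one_sub_radius_pos h
  have := scale_pos hR h
  unfold imageConst
  positivity

/-- For fixed `α` the `β`-integral is invariant under the shift by the angle, and for equal degrees
it is the reproducing formula for `U_n`, which separates directions. The `α`-integral of sines
separates degrees. The squared norm collects `(2/(n+1))² · 2π(n+1) · π/2 = 4π²/(n+1)`; this single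
factor `1/(n+1)` is the smoothing by one order. -/
theorem integral_xrayBasis_mul (hR : 0 < R) (h : R ^ 2 * |κ| < 1) (i j : ℕ × ℕ) :
    ∫ p, xrayBasis κ R i p * xrayBasis κ R j p ∂(bdryMeasure κ R) =
      if i = j then imageConst κ R / (deg i + 1) else 0 := by
  have hS := one_add_radius_pos h
  have hD := one_sub_radius_pos h
  have hi1 : (0 : ℝ) < deg i + 1 := by positivity
  have hj1 : (0 : ℝ) < deg j + 1 := by positivity
  have hint : Integrable (fun p => xrayBasis κ R i p * xrayBasis κ R j p)
      (volume.restrict fanDomain) := by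
    obtain ⟨C, hC⟩ := exists_abs_xrayBasis_le hR h i
    obtain ⟨C', hC'⟩ := exists_abs_xrayBasis_le hR h j
    refine Integrable.of_bound (((continuousOn_xrayBasis h i).mul
      (continuousOn_xrayBasis h j)).aestronglyMeasurable measurableSet_fanDomain) (C * C')
      (Filter.Eventually.of_forall fun p => ?_)
    rw [norm_mul]
    exact mul_le_mul (hC p) (hC' p) (abs_nonneg _) ((abs_nonneg _).trans (hC p))
  rw [bdryMeasure_eq, integral_smul_measure, ENNReal.toReal_ofReal (by positivity), smul_eq_mul]
  have e : (volume.restrict fanDomain : Measure (ℝ × ℝ)) =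
      (volume.restrict (Set.Ioc 0 (2 * Real.pi))).prod
        (volume.restrict (Set.Ioo (-(Real.pi / 2)) (Real.pi / 2))) := by
    rw [Measure.prod_restrict, ← Measure.volume_eq_prod, fanDomain]
  rw [e] at hint ⊢
  rw [integral_prod_symm _ hint]
  set J := ∫ β in (0 : ℝ)..2 * Real.pi, chebU (deg i) (Real.cos (β - i.1 * Real.pi / (deg i + 1))) *
    chebU (deg j) (Real.cos (β - j.1 * Real.pi / (deg j + 1))) with hJ
  have hin : ∀ α, ∫ β in Set.Ioc 0 (2 * Real.pi),
      xrayBasis κ R i (β, α) * xrayBasis κ R j (β, α) =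
      scale κ R ^ 2 * (2 / (deg i + 1)) * (2 / (deg j + 1)) * J * ((‖direction κ R α‖ ^ 2)⁻¹ *
        (Real.sin ((deg i + 1) * (Real.pi / 2 - angle κ R α)) *
          Real.sin ((deg j + 1) * (Real.pi / 2 - angle κ R α)))) := fun α => by
    rw [← intervalIntegral.integral_of_le (by positivity), hJ,
      ← integral_chebU_shift _ _ (angle κ R α - Real.pi / 2),
      mul_right_comm _ _ (_ * _ : ℝ), ← intervalIntegral.integral_const_mul]
    refine intervalIntegral.integral_congr fun β _ => ?_
    simp only [xrayBasis, add_sub_assoc]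
    ring
  simp_rw [hin]
  rw [integral_const_mul, integral_angle h
    (fun ψ => Real.sin ((deg i + 1) * ψ) * Real.sin ((deg j + 1) * ψ)), integral_sin_mul_sin]
  by_cases hd : deg i = deg j
  · rw [if_pos hd]
    have hi : i.1 ≤ deg i := Nat.le_add_right _ _
    have hj : j.1 ≤ deg i := hd ▸ Nat.le_add_right _ _
    have hJ' : J = 2 * Real.pi * if i.1 = j.1 then (deg i : ℝ) + 1 else 0 := by
      rw [hJ, ← hd, integral_chebU_mul_chebU, chebU_cos_node hi hj]
    rw [hJ', ← hd]
    by_cases hij : i = j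
    · rw [if_pos hij, if_pos (congrArg Prod.fst hij), imageConst]
      field_simp
      ring
    · have : i.1 ≠ j.1 := fun h1 => hij (Prod.ext h1 (by simp only [deg] at hd; omega))
      rw [if_neg hij, if_neg this]
      ring
  · have hij : i ≠ j := fun e => hd (by rw [e])
    rw [if_neg hd, if_neg hij]
    ring

end

/-! ### Orthogonal families in `L²` -/

theorem inner_toLp {α : Type*} [MeasurableSpace α] {μ : Measure α} {f g : α → ℂ}
    (hf : MemLp f 2 μ) (hg : MemLp g 2 μ) :
    inner ℂ (hf.toLp f) (hg.toLp g) = ∫ x, starRingEnd ℂ (f x) * g x ∂μ := by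
  rw [L2.inner_def]
  refine integral_congr_ae ?_
  filter_upwards [hf.coeFn_toLp, hg.coeFn_toLp] with x h1 h2
  rw [h1, h2, RCLike.inner_apply, mul_comm]

theorem norm_sq_linearCombination {ι E : Type*} [NormedAddCommGroup E] [InnerProductSpace ℂ E]
    [DecidableEq ι] {v : ι → E} {a : ι → ℝ}
    (hv : ∀ i j, inner ℂ (v i) (v j) = if i = j then (a i : ℂ) else 0) (c : ι →₀ ℂ) :
    ‖Finsupp.linearCombination ℂ v c‖ ^ 2 = ∑ i ∈ c.support, a i * ‖c i‖ ^ 2 := by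
  have h1 : inner ℂ (Finsupp.linearCombination ℂ v c) (Finsupp.linearCombination ℂ v c) =
      ((∑ i ∈ c.support, a i * ‖c i‖ ^ 2 : ℝ) : ℂ) := by
    simp only [Finsupp.linearCombination_apply, Finsupp.sum, sum_inner, inner_sum, inner_smul_left,
      inner_smul_right, hv, mul_ite, mul_zero]
    push_cast
    refine Finset.sum_congr rfl fun i hi => ?_
    rw [Finset.sum_ite_eq', if_pos hi, ← mul_assoc, Complex.mul_conj, Complex.normSq_eq_norm_sq]
    push_cast
    ring
  rw [← inner_self_eq_norm_sq (𝕜 := ℂ), h1]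
  exact Complex.ofReal_re _

theorem coeFn_linearCombination {ι α : Type*} [MeasurableSpace α] {μ : Measure α}
    {v : ι → Lp ℂ 2 μ} {V : ι → α → ℂ} (hv : ∀ i, v i =ᵐ[μ] V i) (c : ι →₀ ℂ) :
    Finsupp.linearCombination ℂ v c =ᵐ[μ] fun x => c.sum fun i a => a * V i x := by
  rw [Finsupp.linearCombination_apply, Finsupp.sum]
  have h1 : ∀ᵐ x ∂μ, ∀ i ∈ c.support, (c i • v i : Lp ℂ 2 μ) x = c i * V i x := by
    refine (ae_ball_iff c.support.countable_toSet).2 fun i _ => ?_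
    filter_upwards [Lp.coeFn_smul (c i) (v i), hv i] with x h1 h2
    rw [h1, Pi.smul_apply, h2, smul_eq_mul]
  filter_upwards [Lp.coeFn_finsetSum c.support fun i => c i • v i, h1] with x h2 h3
  rw [h2, Finset.sum_apply, Finsupp.sum]
  exact Finset.sum_congr rfl h3

theorem linearCombination_cbasis_apply (c : ℕ × ℕ →₀ ℂ) (x : ℂ) :
    Finsupp.linearCombination ℂ cbasis c x = c.sum fun i a => a * cbasis i x := by
  simp [Finsupp.linearCombination_apply, Finsupp.sum, Finset.sum_apply]

section

variable {κ R : ℝ}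

theorem norm_sub_linearCombination_le {μ : Measure ℂ} [IsFiniteMeasure μ] (hμ : ∀ᵐ z ∂μ, ‖z‖ ≤ R)
    {ρ : ℂ → ℂ} {M : ℝ} (hM0 : 0 ≤ M) (hM : ∀ z, ‖z‖ ≤ R → ‖ρ z‖ ≤ M) (hρ0 : ∀ z, ‖z‖ ≤ R → ρ z ≠ 0)
    {v : ℕ × ℕ → Lp ℂ 2 μ} (hv : ∀ i, v i =ᵐ[μ] fun z => ρ z * cbasis i (Phi κ R z))
    {F : Lp ℂ 2 μ} {f : ℂ → ℂ} (hF : F =ᵐ[μ] f) {c : ℕ × ℕ →₀ ℂ} {ε : ℝ} (hε : 0 ≤ ε)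
    (hc : ∀ z, ‖z‖ ≤ R → ‖f z / ρ z - Finsupp.linearCombination ℂ cbasis c (Phi κ R z)‖ ≤ ε) :
    ‖F - Finsupp.linearCombination ℂ v c‖ ≤
      measureUnivNNReal μ ^ (2 : ENNReal).toReal⁻¹ * (M * ε) := by
  refine Lp.norm_le_of_ae_bound (by positivity) ?_
  filter_upwards [Lp.coeFn_sub F (Finsupp.linearCombination ℂ v c), hF,
    coeFn_linearCombination hv c, hμ] with z h1 h2 h3 hz
  have h4 : f z - (c.sum fun i a => a * (ρ z * cbasis i (Phi κ R z))) =
      ρ z * (f z / ρ z - Finsupp.linearCombination ℂ cbasis c (Phi κ R z)) := by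
    rw [mul_sub, mul_div_cancel₀ _ (hρ0 z hz), linearCombination_cbasis_apply, Finsupp.mul_sum]
    simp only [mul_left_comm]
  rw [h1, Pi.sub_apply, h2, h3, h4, norm_mul]
  exact mul_le_mul (hM z hz) (hc z hz) (norm_nonneg _) hM0

/-- Bounded continuous functions are dense in `L²`, and `g/ρ` is uniformly approximated by the ridge
basis in the injective coordinate `Φ`. A general `ρ` covers the factor `w` of `basisW` and the
factor `w²` of `sourceBasis`. -/
theorem denseRange_linearCombination (hR : 0 < R) (h : R ^ 2 * |κ| < 1) {μ : Measure ℂ}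
    [IsFiniteMeasure μ] (hμ : ∀ᵐ z ∂μ, ‖z‖ ≤ R) {ρ : ℂ → ℂ}
    (hρ : ContinuousOn ρ (closedBall (0 : ℂ) R)) (hρ0 : ∀ z, ‖z‖ ≤ R → ρ z ≠ 0)
    {v : ℕ × ℕ → Lp ℂ 2 μ} (hv : ∀ i, v i =ᵐ[μ] fun z => ρ z * cbasis i (Phi κ R z)) :
    DenseRange (Finsupp.linearCombination ℂ v) := by
  refine dense_closure.1 ((BoundedContinuousFunction.toLp_denseRange ℂ μ (p := 2) ℂ
    (by simp)).mono ?_)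
  rintro _ ⟨g, rfl⟩
  refine Metric.mem_closure_iff.2 fun ε hε => ?_
  obtain ⟨M, hM⟩ := (isCompact_closedBall (0 : ℂ) R).exists_bound_of_continuousOn hρ
  set K : ℝ := measureUnivNNReal μ ^ (2 : ENNReal).toReal⁻¹ with hK
  have hK0 : 0 ≤ K := by positivity
  have hM0 : 0 ≤ M := (norm_nonneg _).trans (hM 0 (by simpa using hR.le))
  -- The `+ 1` keeps the denominator positive even if `K * M = 0`.
  obtain ⟨c, hc⟩ := exists_cbasis_approx (isCompact_closedBall (0 : ℂ) R)
    (contDiffOn_Phi h).continuousOn (injOn_Phi hR h)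
    (f := fun z => g z / ρ z) (g.continuous.continuousOn.div hρ fun z hz => hρ0 z (by simpa using hz))
    (ε := ε / (K * M + 1)) (by positivity)
  refine ⟨_, ⟨c, rfl⟩, ?_⟩
  rw [dist_eq_norm]
  refine (norm_sub_linearCombination_le hμ hM0 (fun z hz => hM z (by simpa using hz)) hρ0 hv
    (BoundedContinuousFunction.coeFn_toLp (p := 2) μ ℂ g) (ε := ε / (K * M + 1)) (by positivity)
    fun z hz => (hc z (by simpa using hz)).le).trans_lt ?_
  rw [← hK, ← mul_assoc, mul_div_assoc', div_lt_iff₀ (by positivity)]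
  nlinarith

/-! ### The basis of `L²(M)` and its images -/

/-- The eigenbasis of `𝓛`. -/
def basisM (κ R : ℝ) (i : ℕ × ℕ) : ℂ → ℂ := liftM κ R (cbasis i)

theorem continuousOn_basisM (hR : 0 < R) (h : R ^ 2 * |κ| < 1) (i : ℕ × ℕ) :
    ContinuousOn (basisM κ R i) (closedBall (0 : ℂ) R) :=
  (contDiffOn_liftM hR h (smoothD_cbasis i)).continuousOn

/-- Reality of the basis lets the bilinear `pair` replace the Hermitian inner product. -/
theorem conj_basisM (κ R : ℝ) (i : ℕ × ℕ) (z : ℂ) :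
    starRingEnd ℂ (basisM κ R i z) = basisM κ R i z := by
  unfold basisM liftM cbasis
  split_ifs <;> simp

theorem memLp_basisM (hR : 0 < R) (h : R ^ 2 * |κ| < 1) (i : ℕ × ℕ) :
    MemLp (basisM κ R i) 2 (wvol κ R) :=
  memLp_wvol_of_continuousOn hR h (continuousOn_basisM hR h i)

theorem pair_basisM (hR : 0 < R) (h : R ^ 2 * |κ| < 1) (i j : ℕ × ℕ) :
    pair κ R (basisM κ R i) (basisM κ R j) =
      if i = j then ((scale κ R ^ 2 * Real.pi : ℝ) : ℂ) else 0 := by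
  rw [basisM, basisM, pair_liftM hR h, integral_cbasis_mul]
  split_ifs <;> simp

theorem memLp_weight_mul (hR : 0 < R) (h : R ^ 2 * |κ| < 1) {f : ℂ → ℂ}
    (hf : MemLp f 2 (wvol κ R)) : MemLp (fun z => weight κ z * f z) 2 (vol κ R) := by
  obtain ⟨m, M, _, hM, hb⟩ := exists_bounds_weight hR h
  have hf' := (memLp_vol_iff hR h).2 hf
  refine MemLp.of_le_mul (c := M) hf' ((Complex.measurable_ofReal.comp
    (measurable_weight κ)).aestronglyMeasurable.mul hf'.1) ?_
  filter_upwards [ae_vol_mem κ R] with z hz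
  rw [norm_mul, Complex.norm_real, Real.norm_of_nonneg (weight_pos h hz).le]
  exact mul_le_mul_of_nonneg_right (hb z hz).2 (norm_nonneg _)

theorem exists_norm_toLp_le (hR : 0 < R) (h : R ^ 2 * |κ| < 1) :
    ∃ K : ℝ, 0 ≤ K ∧ ∀ (f : ℂ → ℂ) (hf : MemLp f 2 (wvol κ R)),
      ‖hf.toLp f‖ ≤ K * ‖(memLp_weight_mul hR h hf).toLp _‖ := by
  obtain ⟨m, M, hm, _, hb⟩ := exists_bounds_weight hR h
  obtain ⟨C, hC, hle⟩ := exists_wvol_le hR h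
  have hC' : C ^ (1 / (2 : ENNReal)).toReal ≠ ⊤ := ENNReal.rpow_ne_top_of_nonneg (by simp) hC
  refine ⟨(C ^ (1 / (2 : ENNReal)).toReal * ENNReal.ofReal m⁻¹).toReal, ENNReal.toReal_nonneg,
    fun f hf => ?_⟩
  rw [Lp.norm_toLp, Lp.norm_toLp, ← ENNReal.toReal_mul]
  refine ENNReal.toReal_mono (ENNReal.mul_ne_top (ENNReal.mul_ne_top hC' ENNReal.ofReal_ne_top)
    (memLp_weight_mul hR h hf).2.ne) ?_
  refine (eLpNorm_mono_measure _ hle).trans ?_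
  rw [eLpNorm_smul_measure_of_ne_top (by simp), smul_eq_mul, mul_assoc]
  refine mul_le_mul_right (eLpNorm_le_mul_eLpNorm_of_ae_le_mul ?_ _) _
  filter_upwards [ae_vol_mem κ R] with z hz
  rw [norm_mul, Complex.norm_real, Real.norm_of_nonneg (weight_pos h hz).le, inv_mul_eq_div,
    le_div_iff₀ hm, mul_comm]
  exact mul_le_mul_of_nonneg_right (hb z hz).1 (norm_nonneg _)

/-- The basis of `L²(M, w dVol)`. -/
def basisW (hR : 0 < R) (h : R ^ 2 * |κ| < 1) (i : ℕ × ℕ) : Lp ℂ 2 (wvol κ R) :=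
  (memLp_basisM hR h i).toLp _

theorem inner_basisW_toLp (hR : 0 < R) (h : R ^ 2 * |κ| < 1) (i : ℕ × ℕ) {f : ℂ → ℂ}
    (hf : MemLp f 2 (wvol κ R)) :
    inner ℂ (basisW hR h i) (hf.toLp f) = pair κ R f (basisM κ R i) := by
  rw [basisW, inner_toLp, pair]
  simp only [conj_basisM, mul_comm]

theorem inner_basisW (hR : 0 < R) (h : R ^ 2 * |κ| < 1) (i j : ℕ × ℕ) :
    inner ℂ (basisW hR h i) (basisW hR h j) =
      if i = j then ((scale κ R ^ 2 * Real.pi : ℝ) : ℂ) else 0 := by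
  conv_lhs => rw [basisW.eq_1 hR h j]
  rw [inner_basisW_toLp, pair_basisM hR h]
  simp only [eq_comm]

/-- The classes in `L²(M, dVol)` of the products of `w` and the basis functions. -/
def sourceBasis (hR : 0 < R) (h : R ^ 2 * |κ| < 1) (i : ℕ × ℕ) : L2M κ R :=
  (memLp_weight_mul hR h (memLp_basisM hR h i)).toLp _

/-- The images of `sourceBasis` under the X-ray transform. -/
def imageBasis (hR : 0 < R) (h : R ^ 2 * |κ| < 1) (i : ℕ × ℕ) : L2Bdry κ R :=
  (memLp_xrayBasis hR h i).toLp _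

theorem inner_imageBasis (hR : 0 < R) (h : R ^ 2 * |κ| < 1) (i j : ℕ × ℕ) :
    inner ℂ (imageBasis hR h i) (imageBasis hR h j) =
      if i = j then ((imageConst κ R / (deg i + 1) : ℝ) : ℂ) else 0 := by
  rw [imageBasis, imageBasis, inner_toLp]
  simp only [Complex.conj_ofReal, ← Complex.ofReal_mul]
  rw [integral_complex_ofReal, integral_xrayBasis_mul hR h]
  split_ifs <;> simp

theorem coeFn_basisW (hR : 0 < R) (h : R ^ 2 * |κ| < 1) (i : ℕ × ℕ) :
    basisW hR h i =ᵐ[wvol κ R] fun z => (weight κ z : ℂ) * cbasis i (Phi κ R z) := by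
  filter_upwards [(memLp_basisM hR h i).coeFn_toLp, ae_wvol_mem κ R] with z h1 hz
  rw [basisW, h1, basisM, liftM_of_le hz]

theorem coeFn_sourceBasis (hR : 0 < R) (h : R ^ 2 * |κ| < 1) (i : ℕ × ℕ) :
    sourceBasis hR h i =ᵐ[vol κ R] fun z => (weight κ z : ℂ) ^ 2 * cbasis i (Phi κ R z) := by
  filter_upwards [(memLp_weight_mul hR h (memLp_basisM hR h i)).coeFn_toLp, ae_vol_mem κ R]
    with z h1 hz
  rw [sourceBasis, h1, basisM, liftM_of_le hz]
  ring

theorem continuousOn_weight_pow (h : R ^ 2 * |κ| < 1) (k : ℕ) :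
    ContinuousOn (fun z => (weight κ z : ℂ) ^ k) (closedBall (0 : ℂ) R) :=
  (Complex.continuous_ofReal.comp_continuousOn (continuousOn_weight h)).pow k

theorem weight_ne_zero (h : R ^ 2 * |κ| < 1) {z : ℂ} (hz : ‖z‖ ≤ R) : (weight κ z : ℂ) ≠ 0 := by
  exact_mod_cast (weight_pos h hz).ne'

theorem denseRange_basisW (hR : 0 < R) (h : R ^ 2 * |κ| < 1) :
    DenseRange (Finsupp.linearCombination ℂ (basisW hR h)) := by
  have := isFiniteMeasure_wvol hR h
  refine denseRange_linearCombination hR h (ae_wvol_mem κ R) (ρ := fun z => (weight κ z : ℂ)) ?_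
    (fun z hz => weight_ne_zero h hz) (coeFn_basisW hR h)
  simpa using continuousOn_weight_pow h 1

theorem denseRange_sourceBasis (hR : 0 < R) (h : R ^ 2 * |κ| < 1) :
    DenseRange (Finsupp.linearCombination ℂ (sourceBasis hR h)) := by
  have := isFiniteMeasure_vol h
  exact denseRange_linearCombination hR h (ae_vol_mem κ R) (continuousOn_weight_pow h 2)
    (fun z hz => pow_ne_zero 2 (weight_ne_zero h hz)) (coeFn_sourceBasis hR h)

/-- Orthogonality on the source side is available in `L²(M, w dVol)`, so the comparison passes
through `basisW`, whose norm is controlled by that of `sourceBasis` because `w` is bounded below and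
above. In orthogonal expansions the bound is `1/(n+1) ≤ 1`. -/
theorem exists_norm_imageBasis_le (hR : 0 < R) (h : R ^ 2 * |κ| < 1) :
    ∃ K, ∀ c, ‖Finsupp.linearCombination ℂ (imageBasis hR h) c‖ ≤
      K * ‖Finsupp.linearCombination ℂ (sourceBasis hR h) c‖ := by
  obtain ⟨K, hK0, hK⟩ := exists_norm_toLp_le hR h
  have hA := imageConst_pos hR h
  have hB : 0 < scale κ R ^ 2 * Real.pi := mul_pos (pow_pos (scale_pos hR h) 2) Real.pi_pos
  refine ⟨√(imageConst κ R / (scale κ R ^ 2 * Real.pi)) * K, fun c => ?_⟩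
  set A := Finsupp.linearCombination ℂ (basisW hR h) c with hAdef
  have h1 : ‖A‖ ≤ K * ‖Finsupp.linearCombination ℂ (sourceBasis hR h) c‖ := by
    have h2 := hK A (Lp.memLp A)
    rw [Lp.toLp_coeFn] at h2
    have h3 : (memLp_weight_mul hR h (Lp.memLp A)).toLp _ =
        Finsupp.linearCombination ℂ (sourceBasis hR h) c := by
      refine Lp.ext ?_
      filter_upwards [(memLp_weight_mul hR h (Lp.memLp A)).coeFn_toLp,
        coeFn_linearCombination (coeFn_sourceBasis hR h) c,
        (vol_absolutelyContinuous_wvol h).ae_le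
          (coeFn_linearCombination (coeFn_basisW hR h) c)] with z e1 e2 e3
      rw [e1, e2, e3, Finsupp.mul_sum]
      refine Finsupp.sum_congr fun i _ => ?_
      ring
    rwa [h3] at h2
  rw [mul_assoc]
  refine le_trans ?_ (mul_le_mul_of_nonneg_left h1 (Real.sqrt_nonneg _))
  refine le_of_pow_le_pow_left₀ two_ne_zero (by positivity) ?_
  rw [mul_pow, Real.sq_sqrt (by positivity), norm_sq_linearCombination (inner_imageBasis hR h), hAdef,
    norm_sq_linearCombination (a := fun _ => scale κ R ^ 2 * Real.pi) (inner_basisW hR h),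
    ← Finset.mul_sum, ← mul_assoc, div_mul_cancel₀ _ hB.ne', Finset.mul_sum]
  refine Finset.sum_le_sum fun i _ => mul_le_mul_of_nonneg_right ?_ (sq_nonneg _)
  exact div_le_self hA.le (one_le_deg_add_one i)

/-- The operator is defined by continuity from combinations of `sourceBasis`. That it is given by
`xray` on an arbitrary continuous `f` is checked by approximating `f/w²` uniformly: the images
converge in `L²`, and also pointwise to `xray f`, so the limits agree. -/
theorem exists_isXrayL2 (hR : 0 < R) (h : R ^ 2 * |κ| < 1) :
    ∃ I₀ : L2M κ R →L[ℂ] L2Bdry κ R, IsXrayL2 κ R I₀ := by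
  have hfin := isFiniteMeasure_vol h
  obtain ⟨K, hK⟩ := exists_norm_imageBasis_le hR h
  let T : L2M κ R →L[ℂ] L2Bdry κ R := (Finsupp.linearCombination ℂ (imageBasis hR h)).extendOfNorm
    (Finsupp.linearCombination ℂ (sourceBasis hR h))
  have hT : ∀ c, T (Finsupp.linearCombination ℂ (sourceBasis hR h) c) =
      Finsupp.linearCombination ℂ (imageBasis hR h) c :=
    LinearMap.extendOfNorm_eq (denseRange_sourceBasis hR h) ⟨K, hK⟩
  refine ⟨T, fun f hf F hF => ?_⟩
  have hfw : ContinuousOn (fun z => f z / (weight κ z : ℂ) ^ 2) (closedBall (0 : ℂ) R) :=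
    hf.div (continuousOn_weight_pow h 2) fun z hz => pow_ne_zero 2 (weight_ne_zero h (by simpa using hz))
  obtain ⟨M, hM⟩ := (isCompact_closedBall (0 : ℂ) R).exists_bound_of_continuousOn
    (continuousOn_weight_pow h 2)
  have hM0 : 0 ≤ M := (norm_nonneg _).trans (hM 0 (by simpa using hR.le))
  have happ := fun k : ℕ => exists_cbasis_approx (isCompact_closedBall (0 : ℂ) R)
    (contDiffOn_Phi h).continuousOn (injOn_Phi hR h) hfw (ε := 1 / ((k : ℝ) + 1)) (by positivity)
  choose c hc using happ
  have hlim := tendsto_one_div_add_atTop_nhds_zero_nat (𝕜 := ℝ)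
  have hconv : Filter.Tendsto (fun k => Finsupp.linearCombination ℂ (sourceBasis hR h) (c k))
      Filter.atTop (nhds F) := by
    rw [tendsto_iff_norm_sub_tendsto_zero]
    refine squeeze_zero (fun _ => norm_nonneg _) (fun k => ?_)
      (g := fun k : ℕ => measureUnivNNReal (vol κ R) ^ (2 : ENNReal).toReal⁻¹ * (M * (1 / ((k : ℝ) + 1)))) ?_
    · rw [norm_sub_rev]
      exact norm_sub_linearCombination_le (ae_vol_mem κ R) hM0
        (fun z hz => hM z (by simpa using hz)) (fun z hz => pow_ne_zero 2 (weight_ne_zero h hz))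
        (coeFn_sourceBasis hR h) hF (by positivity) fun z hz => (hc k z (by simpa using hz)).le
    · simpa using (hlim.const_mul M).const_mul
        ((measureUnivNNReal (vol κ R) : ℝ) ^ (2 : ENNReal).toReal⁻¹)
  have hTconv := (T.continuous.tendsto F).comp hconv
  -- Convergence in `L²` yields almost everywhere convergence of a subsequence, to be compared with
  -- the pointwise limit.
  obtain ⟨ns, hns, hae⟩ := (tendstoInMeasure_of_tendsto_Lp hTconv).exists_seq_tendsto_ae
  have hrep : ∀ᵐ p ∂(bdryMeasure κ R), ∀ k,
      (T (Finsupp.linearCombination ℂ (sourceBasis hR h) (c k)) : ℝ × ℝ → ℂ) p =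
        (c k).sum fun i a => a * (xrayBasis κ R i p : ℂ) := by
    rw [ae_all_iff]
    intro k
    rw [hT]
    exact coeFn_linearCombination (fun i => (memLp_xrayBasis hR h i).coeFn_toLp) (c k)
  filter_upwards [hae, hrep, ae_bdryMeasure_mem κ R] with p h1 h2 h3
  refine tendsto_nhds_unique h1 ?_
  have hα := cos_pos_of_mem h3.2
  let u : ℂ → ℂ := fun ζ => f (PhiInv κ R ζ) / (weight κ (PhiInv κ R ζ) : ℂ) ^ 2
  have hu : ContinuousOn u unitDisk :=
    hfw.comp (contDiffOn_PhiInv hR h).continuousOn (mapsTo_PhiInv hR h)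
  have hfu : ∀ z, ‖z‖ ≤ R → f z = (weight κ z : ℂ) ^ 2 * u (Phi κ R z) := fun z hz => by
    simp only [u]
    rw [PhiInv_Phi hR h hz, mul_div_cancel₀ _ (pow_ne_zero 2 (weight_ne_zero h hz))]
  have hcc : ∀ k, Continuous (Finsupp.linearCombination ℂ cbasis (c k)) := fun k => by
    rw [funext (linearCombination_cbasis_apply (c k))]
    exact continuous_finsetSum _ fun i _ => continuous_const.mul (continuous_cbasis i)
  have hd : ∀ k, ∀ x ∈ unitDisk,
      ‖Finsupp.linearCombination ℂ cbasis (c k) x - u x‖ ≤ 1 / ((k : ℝ) + 1) := fun k x hx => by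
    have hx' := mapsTo_PhiInv hR h hx
    have := (hc k _ hx').le
    rwa [Phi_PhiInv hR h (by simpa using hx), norm_sub_rev] at this
  rw [tendsto_iff_norm_sub_tendsto_zero]
  have hb : ∀ k, ‖(T (Finsupp.linearCombination ℂ (sourceBasis hR h) (c k)) : ℝ × ℝ → ℂ) p -
      xray κ R f p‖ ≤ 1 / ((k : ℝ) + 1) *
        (scale κ R * (2 * Real.cos p.2 / ‖direction κ R p.2‖ ^ 2)) := fun k => by
    rw [h2 k, ← xray_linearCombination hR h (c k) p.1 hα (f := fun z =>
      (weight κ z : ℂ) ^ 2 * Finsupp.linearCombination ℂ cbasis (c k) (Phi κ R z)) fun _ _ => rfl]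
    exact norm_xray_sub_le hR h p.1 hα (hcc k).continuousOn hu (fun _ _ => rfl) hfu (hd k)
  have hz := (hlim.comp hns.tendsto_atTop).mul_const
    (scale κ R * (2 * Real.cos p.2 / ‖direction κ R p.2‖ ^ 2))
  rw [zero_mul] at hz
  exact squeeze_zero (fun _ => norm_nonneg _) (fun k => hb (ns k)) hz

/-! ### The normal operator on the basis -/

theorem IsXrayL2.apply_sourceBasis (hR : 0 < R) (h : R ^ 2 * |κ| < 1)
    {I₀ : L2M κ R →L[ℂ] L2Bdry κ R} (hI : IsXrayL2 κ R I₀) (i : ℕ × ℕ) :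
    I₀ (sourceBasis hR h i) = imageBasis hR h i := by
  refine Lp.ext ?_
  have h1 := hI (fun z => (weight κ z : ℂ) ^ 2 * cbasis i (Phi κ R z))
    ((continuousOn_weight_pow h 2).mul ((continuous_cbasis i).comp_continuousOn
      (contDiffOn_Phi h).continuousOn)) _ (coeFn_sourceBasis hR h i)
  filter_upwards [h1, (memLp_xrayBasis hR h i).coeFn_toLp, ae_bdryMeasure_mem κ R] with p e1 e2 hp
  rw [e1, imageBasis, e2]
  have := xray_linearCombination hR h (Finsupp.single i 1) p.1 (cos_pos_of_mem hp.2) (f := fun z =>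
    (weight κ z : ℂ) ^ 2 * cbasis i (Phi κ R z)) fun z _ => by simp
  simpa using this

theorem IsXrayL2.unique (hR : 0 < R) (h : R ^ 2 * |κ| < 1)
    {I₀ I₁ : L2M κ R →L[ℂ] L2Bdry κ R} (h0 : IsXrayL2 κ R I₀) (h1 : IsXrayL2 κ R I₁) : I₀ = I₁ := by
  refine DFunLike.coe_injective ((denseRange_sourceBasis hR h).equalizer I₀.continuous
    I₁.continuous (funext fun c => ?_))
  simp only [Function.comp, Finsupp.linearCombination_apply, Finsupp.sum, map_sum, map_smul,
    h0.apply_sourceBasis hR h, h1.apply_sourceBasis hR h]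

/-- `I₀* I₀ w` multiplies the basis functions by `normalConst / (deg + 1)`. -/
def normalConst (κ R : ℝ) : ℝ := imageConst κ R / (scale κ R ^ 2 * Real.pi)

theorem normalConst_pos (hR : 0 < R) (h : R ^ 2 * |κ| < 1) : 0 < normalConst κ R :=
  div_pos (imageConst_pos hR h) (mul_pos (pow_pos (scale_pos hR h) 2) Real.pi_pos)

theorem integral_vol_eq_pair (h : R ^ 2 * |κ| < 1) (f g : ℂ → ℂ) :
    ∫ z, f z * (weight κ z * g z) ∂(vol κ R) = pair κ R f g := by
  rw [pair, integral_wvol h]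
  simp only [mul_left_comm]

/-- Testing against the dense span of `sourceBasis`: the left side becomes the inner product of two
image functions, the right side the `w dVol` pairing of two basis functions, and both are diagonal.
The multiplier is the quotient of the squared norms. -/
theorem IsXrayL2.normalOp_sourceBasis (hR : 0 < R) (h : R ^ 2 * |κ| < 1)
    {I₀ : L2M κ R →L[ℂ] L2Bdry κ R} (hI : IsXrayL2 κ R I₀) (i : ℕ × ℕ) :
    normalOp I₀ (sourceBasis hR h i) = ((normalConst κ R / (deg i + 1) : ℝ) : ℂ) •
      ((memLp_vol_iff hR h).2 (memLp_basisM hR h i)).toLp _ := by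
  refine ext_inner_left ℂ fun F => ?_
  refine congrFun ((denseRange_sourceBasis hR h).equalizer
    (g := fun F => inner ℂ F (normalOp I₀ (sourceBasis hR h i)))
    (h := fun F => inner ℂ F (((normalConst κ R / (deg i + 1) : ℝ) : ℂ) •
      ((memLp_vol_iff hR h).2 (memLp_basisM hR h i)).toLp _)) (by fun_prop) (by fun_prop)
      (funext fun c => ?_)) F
  simp only [Function.comp, Finsupp.linearCombination_apply, Finsupp.sum, sum_inner, inner_smul_left]
  refine Finset.sum_congr rfl fun j _ => ?_
  congr 1
  rw [normalOp, ContinuousLinearMap.comp_apply, ContinuousLinearMap.adjoint_inner_right,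
    hI.apply_sourceBasis hR h, hI.apply_sourceBasis hR h, inner_imageBasis, inner_smul_right,
    sourceBasis, inner_toLp]
  simp only [map_mul, Complex.conj_ofReal, conj_basisM, mul_comm _ (basisM κ R i _)]
  rw [integral_vol_eq_pair h, pair_basisM hR h]
  by_cases hij : i = j
  · subst hij
    rw [if_pos rfl, if_pos rfl, ← Complex.ofReal_mul, normalConst]
    congr 1
    have := (scale_pos hR h).ne'
    field_simp
  · rw [if_neg hij, if_neg (Ne.symm hij), mul_zero]

/-- The coefficients of `I₀* I₀ F` in the basis. -/
theorem IsXrayL2.pair_normalOp (hR : 0 < R) (h : R ^ 2 * |κ| < 1)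
    {I₀ : L2M κ R →L[ℂ] L2Bdry κ R} (hI : IsXrayL2 κ R I₀) {F : L2M κ R} {f : ℂ → ℂ}
    (hF : F =ᵐ[vol κ R] fun z => weight κ z * f z) (i : ℕ × ℕ) :
    pair κ R (normalOp I₀ F) (basisM κ R i) =
      ((normalConst κ R / (deg i + 1) : ℝ) : ℂ) * pair κ R f (basisM κ R i) := by
  have h1 : pair κ R (normalOp I₀ F) (basisM κ R i) =
      inner ℂ (sourceBasis hR h i) (normalOp I₀ F) := by
    conv_rhs => rw [← Lp.toLp_coeFn (normalOp I₀ F) (Lp.memLp _)]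
    rw [sourceBasis, inner_toLp, ← integral_vol_eq_pair h]
    simp only [map_mul, Complex.conj_ofReal, conj_basisM, mul_comm]
  -- Self-adjointness moves the operator onto the basis element.
  have h2 : inner ℂ (sourceBasis hR h i) (normalOp I₀ F) =
      inner ℂ (normalOp I₀ (sourceBasis hR h i)) F := by
    simp only [normalOp, ContinuousLinearMap.comp_apply, ContinuousLinearMap.adjoint_inner_right,
      ContinuousLinearMap.adjoint_inner_left]
  rw [h1, h2, hI.normalOp_sourceBasis hR h, inner_smul_left, Complex.conj_ofReal]
  congr 1
  conv_lhs => rw [← Lp.toLp_coeFn F (Lp.memLp _)]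
  rw [inner_toLp, ← integral_vol_eq_pair h]
  refine integral_congr_ae ?_
  filter_upwards [hF] with z hz
  rw [hz, conj_basisM]
  ring

end

section

variable {κ R : ℝ}

/-! ### Expansion in the basis -/

/-- The squared norm of the basis functions in `L²(M, w dVol)`. -/
def normConst (κ R : ℝ) : ℝ := scale κ R ^ 2 * Real.pi

theorem normConst_pos (hR : 0 < R) (h : R ^ 2 * |κ| < 1) : 0 < normConst κ R :=
  mul_pos (pow_pos (scale_pos hR h) 2) Real.pi_pos

theorem normConst_ne_zero (hR : 0 < R) (h : R ^ 2 * |κ| < 1) : (normConst κ R : ℂ) ≠ 0 := by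
  exact_mod_cast (normConst_pos hR h).ne'

/-- The coefficients of a function in the eigenbasis. -/
def coef (κ R : ℝ) (f : ℂ → ℂ) (i : ℕ × ℕ) : ℂ := pair κ R f (basisM κ R i)

/-- The normalised eigenbasis. -/
def unitBasis (hR : 0 < R) (h : R ^ 2 * |κ| < 1) (i : ℕ × ℕ) : Lp ℂ 2 (wvol κ R) :=
  ((√(normConst κ R))⁻¹ : ℂ) • basisW hR h i

theorem sqrt_mul_sqrt_normConst (hR : 0 < R) (h : R ^ 2 * |κ| < 1) :
    (√(normConst κ R) : ℂ) * √(normConst κ R) = normConst κ R := by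
  rw [← Complex.ofReal_mul, Real.mul_self_sqrt (normConst_pos hR h).le]

theorem sqrt_normConst_ne_zero (hR : 0 < R) (h : R ^ 2 * |κ| < 1) : (√(normConst κ R) : ℂ) ≠ 0 := by
  exact_mod_cast (Real.sqrt_pos.2 (normConst_pos hR h)).ne'

theorem orthonormal_unitBasis (hR : 0 < R) (h : R ^ 2 * |κ| < 1) :
    Orthonormal ℂ (unitBasis hR h) := by
  rw [orthonormal_iff_ite]
  intro i j
  have h0 := sqrt_normConst_ne_zero hR h
  have h1 := sqrt_mul_sqrt_normConst hR h
  rw [unitBasis, unitBasis, inner_smul_left, inner_smul_right, inner_basisW]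
  split_ifs
  · rw [map_inv₀, Complex.conj_ofReal, ← normConst, ← h1]
    field_simp
  · simp

theorem top_le_closure_span_unitBasis (hR : 0 < R) (h : R ^ 2 * |κ| < 1) :
    ⊤ ≤ (Submodule.span ℂ (Set.range (unitBasis hR h))).topologicalClosure := by
  have hd := denseRange_basisW hR h
  have hspan : Set.range (Finsupp.linearCombination ℂ (basisW hR h)) ⊆
      Submodule.span ℂ (Set.range (unitBasis hR h)) := by
    rw [← LinearMap.coe_range, Finsupp.range_linearCombination]
    refine Submodule.span_le.2 ?_
    rintro _ ⟨i, rfl⟩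
    have : basisW hR h i = (√(normConst κ R) : ℂ) • unitBasis hR h i := by
      rw [unitBasis, smul_smul, mul_inv_cancel₀ (sqrt_normConst_ne_zero hR h), one_smul]
    rw [this]
    exact Submodule.smul_mem _ _ (Submodule.subset_span ⟨i, rfl⟩)
  exact (Submodule.dense_iff_topologicalClosure_eq_top.1 (hd.mono hspan)).ge

/-- The normalised eigenbasis as a Hilbert basis. -/
def hilbertBasis (hR : 0 < R) (h : R ^ 2 * |κ| < 1) :
    HilbertBasis (ℕ × ℕ) ℂ (Lp ℂ 2 (wvol κ R)) :=
  HilbertBasis.mk (orthonormal_unitBasis hR h) (top_le_closure_span_unitBasis hR h)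

theorem hilbertBasis_apply (hR : 0 < R) (h : R ^ 2 * |κ| < 1) (i : ℕ × ℕ) :
    hilbertBasis hR h i = unitBasis hR h i :=
  congrFun (HilbertBasis.coe_mk _ _) i

theorem inner_unitBasis_toLp (hR : 0 < R) (h : R ^ 2 * |κ| < 1) (i : ℕ × ℕ) {f : ℂ → ℂ}
    (hf : MemLp f 2 (wvol κ R)) :
    inner ℂ (unitBasis hR h i) (hf.toLp f) = (√(normConst κ R) : ℂ)⁻¹ * coef κ R f i := by
  rw [unitBasis, inner_smul_left, inner_basisW_toLp, map_inv₀, Complex.conj_ofReal, coef]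

theorem ae_eq_of_coef_eq (hR : 0 < R) (h : R ^ 2 * |κ| < 1) {f g : ℂ → ℂ}
    (hf : MemLp f 2 (wvol κ R)) (hg : MemLp g 2 (wvol κ R))
    (hfg : ∀ i, coef κ R f i = coef κ R g i) : f =ᵐ[wvol κ R] g := by
  refine (MemLp.toLp_eq_toLp_iff hf hg).1 ((hilbertBasis hR h).repr.injective ?_)
  ext i
  rw [HilbertBasis.repr_apply_apply, HilbertBasis.repr_apply_apply, hilbertBasis_apply,
    inner_unitBasis_toLp, inner_unitBasis_toLp, hfg]

theorem summable_coef (hR : 0 < R) (h : R ^ 2 * |κ| < 1) {f : ℂ → ℂ}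
    (hf : MemLp f 2 (wvol κ R)) : Summable fun i => ‖coef κ R f i‖ ^ 2 := by
  have h1 := (orthonormal_unitBasis hR h).inner_products_summable (x := hf.toLp f)
  simp only [inner_unitBasis_toLp, norm_mul, mul_pow] at h1
  exact (summable_mul_left_iff (pow_ne_zero 2 (norm_ne_zero_iff.2
    (inv_ne_zero (sqrt_normConst_ne_zero hR h))))).1 h1

theorem exists_coef_eq (hR : 0 < R) (h : R ^ 2 * |κ| < 1) {a : ℕ × ℕ → ℂ}
    (ha : Summable fun i => ‖a i‖ ^ 2) :
    ∃ f : ℂ → ℂ, MemLp f 2 (wvol κ R) ∧ ∀ i, coef κ R f i = a i := by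
  have h0 := sqrt_normConst_ne_zero hR h
  have hm : Memℓp (fun i => (√(normConst κ R) : ℂ)⁻¹ * a i) 2 := by
    refine memℓp_gen ?_
    simp only [ENNReal.toReal_ofNat, Real.rpow_ofNat, norm_mul, mul_pow]
    exact ha.mul_left _
  let F := (hilbertBasis hR h).repr.symm ⟨_, hm⟩
  refine ⟨F, Lp.memLp F, fun i => ?_⟩
  have h1 := inner_unitBasis_toLp hR h i (Lp.memLp F)
  rw [Lp.toLp_coeFn, ← hilbertBasis_apply hR h i, ← HilbertBasis.repr_apply_apply] at h1
  simp only [F, LinearIsometryEquiv.apply_symm_apply] at h1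
  exact (mul_left_cancel₀ (inv_ne_zero h0) h1).symm

/-- Parseval's identity for the conjugate of `f` and `g`; the factor `normConst⁻¹` appears because
`coef` pairs with the unnormalised basis. -/
theorem hasSum_pair (hR : 0 < R) (h : R ^ 2 * |κ| < 1) {f g : ℂ → ℂ}
    (hf : MemLp f 2 (wvol κ R)) (hg : MemLp g 2 (wvol κ R)) :
    HasSum (fun i => (normConst κ R : ℂ)⁻¹ * coef κ R f i * coef κ R g i) (pair κ R f g) := by
  have hf' : MemLp (fun z => starRingEnd ℂ (f z)) 2 (wvol κ R) := hf.star
  have h1 := (hilbertBasis hR h).hasSum_inner_mul_inner (hf'.toLp _) (hg.toLp g)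
  rw [inner_toLp] at h1
  simp only [Complex.conj_conj] at h1
  have h2 : (fun i => (normConst κ R : ℂ)⁻¹ * coef κ R f i * coef κ R g i) = fun i =>
      inner ℂ (hf'.toLp _) (hilbertBasis hR h i) * inner ℂ (hilbertBasis hR h i) (hg.toLp g) := by
    funext i
    rw [hilbertBasis_apply, inner_unitBasis_toLp, unitBasis, inner_smul_right, basisW, inner_toLp]
    simp only [Complex.conj_conj]
    rw [← sqrt_mul_sqrt_normConst hR h, mul_inv]
    change _ = (√(normConst κ R) : ℂ)⁻¹ * coef κ R f i * _
    ring
  rw [h2]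
  exact h1

theorem pair_eq_tsum (hR : 0 < R) (h : R ^ 2 * |κ| < 1) {f g : ℂ → ℂ}
    (hf : MemLp f 2 (wvol κ R)) (hg : MemLp g 2 (wvol κ R)) :
    pair κ R f g = ∑' i, (normConst κ R : ℂ)⁻¹ * coef κ R f i * coef κ R g i :=
  (hasSum_pair hR h hf hg).tsum_eq.symm

/-! ### Smooth functions -/

theorem SmoothM.memLp (hR : 0 < R) (h : R ^ 2 * |κ| < 1) (φ : SmoothM R) :
    MemLp (φ : ℂ → ℂ) 2 (wvol κ R) := memLp_wvol_of_continuousOn hR h (SmoothM.continuousOn φ)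

theorem coef_smooth (hR : 0 < R) (h : R ^ 2 * |κ| < 1) (φ : SmoothM R) (i : ℕ × ℕ) :
    coef κ R φ i = (scale κ R ^ 2 : ℝ) * ∫ ζ in unitDisk, pullD κ R φ ζ * cbasis i ζ :=
  pair_eq_pullD hR h φ (cbasis i)

theorem RapidDecay.const_mul {a : ℕ × ℕ → ℂ} (ha : RapidDecay a) (c : ℂ) :
    RapidDecay fun i => c * a i :=
  ha.mul_of_le (c := fun _ => c) 0 ‖c‖ fun i => by simp

theorem rapidDecay_coef (hR : 0 < R) (h : R ^ 2 * |κ| < 1) (φ : SmoothM R) :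
    RapidDecay (coef κ R φ) := by
  rw [funext (coef_smooth hR h φ)]
  exact (rapidDecay_integral_cbasis (smoothD_pullD hR h φ)).const_mul _

/-- Functions continuous on the closed disk that agree almost everywhere agree on it, the disk being
the closure of its interior; outside, both are zero by convention. -/
theorem SmoothM.ext_coef (hR : 0 < R) (h : R ^ 2 * |κ| < 1) {φ ψ : SmoothM R}
    (hc : ∀ i, coef κ R φ i = coef κ R ψ i) : φ = ψ := by
  have h1 := ae_eq_of_coef_eq hR h (SmoothM.memLp hR h φ) (SmoothM.memLp hR h ψ) hc
  have h2 : (φ : ℂ → ℂ) =ᵐ[volume.restrict (closedBall (0 : ℂ) R)] ψ :=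
    (restrict_absolutelyContinuous_vol h).ae_le ((vol_absolutelyContinuous_wvol h).ae_le h1)
  have h3 := Measure.eqOn_of_ae_eq h2 (SmoothM.continuousOn φ) (SmoothM.continuousOn ψ) (by
    rw [interior_closedBall _ hR.ne', closure_ball _ hR.ne'])
  refine Subtype.ext (funext fun z => ?_)
  by_cases hz : z ∈ closedBall (0 : ℂ) R
  · exact h3 hz
  · rw [φ.2.2 z hz, ψ.2.2 z hz]

/-- With `rapidDecay_coef` and `SmoothM.ext_coef` this identifies `C^∞(M)` with the space of rapidly
decaying sequences. -/
theorem exists_smooth_coef_eq (hR : 0 < R) (h : R ^ 2 * |κ| < 1) {a : ℕ × ℕ → ℂ}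
    (ha : RapidDecay a) : ∃ φ : SmoothM R, ∀ i, coef κ R φ i = a i := by
  have ha' := ha.const_mul (normConst κ R : ℂ)⁻¹
  refine ⟨liftS hR h ha'.smoothD, fun i => ?_⟩
  have h0 := normConst_ne_zero hR h
  have h1 : coef κ R (liftS hR h ha'.smoothD) i =
      pair κ R (liftM κ R (synthD fun i => (normConst κ R : ℂ)⁻¹ * a i)) (liftM κ R (cbasis i)) := rfl
  rw [h1, pair_liftM hR h, ha'.integral_synthD_mul]
  rw [normConst] at h0 ⊢
  rw [← mul_assoc, mul_comm _ (Real.pi : ℂ), ← mul_assoc, ← mul_assoc, ← Complex.ofReal_mul,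
    mul_comm Real.pi, mul_inv_cancel₀ h0, one_mul]

/-! ### Eigenfunctions and powers -/

/-- The eigenvalues of `𝓛`. -/
def eigval (i : ℕ × ℕ) : ℝ := ((deg i : ℝ) + 1) ^ 2

theorem eigval_pos (i : ℕ × ℕ) : 0 < eigval i := by unfold eigval; positivity

theorem eigval_rpow (i : ℕ × ℕ) (s : ℝ) : eigval i ^ (s / 2) = ((deg i : ℝ) + 1) ^ s := by
  rw [eigval, ← Real.rpow_natCast, ← Real.rpow_mul (by positivity)]
  congr 1
  push_cast
  ring

theorem isEigen_basis (hR : 0 < R) (h : R ^ 2 * |κ| < 1) (i : ℕ × ℕ) :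
    IsEigen κ R (eigval i) (liftS hR h (smoothD_cbasis i)) := by
  rw [isEigen_iff hR h]
  intro ζ _ hζ
  have hmem : ζ ∈ unitDisk := by simpa using hζ.le
  have he : Set.EqOn (pullD κ R (liftS hR h (smoothD_cbasis i))) (cbasis i) unitDisk :=
    fun x hx => pullD_liftM hR h _ hx
  rw [opLc_congr he hmem, he hmem, opLc_cbasis i hmem, eigval]
  push_cast
  rfl

/-- Symmetry of `opLc` against the basis element gives `(lam - eigval i)` times the coefficient
equal to zero. The eigenvalue equation is assumed only off the origin and the circle, which are null
sets. -/
theorem IsEigen.coef_eq_zero (hR : 0 < R) (h : R ^ 2 * |κ| < 1) {lam : ℝ} {e : SmoothM R}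
    (he : IsEigen κ R lam e) {i : ℕ × ℕ} (hi : eigval i ≠ lam) : coef κ R e i = 0 := by
  have hs := smoothD_pullD hR h e
  have h1 := integral_opLc_mul_cbasis hs i
  have h2 : ∫ x in unitDisk, opLc (pullD κ R e) x * cbasis i x =
      lam * ∫ x in unitDisk, pullD κ R e x * cbasis i x := by
    rw [← integral_const_mul]
    refine integral_congr_ae ?_
    have hsph : ∀ᵐ x ∂(volume.restrict unitDisk : Measure ℂ), x ∉ sphere (0 : ℂ) 1 :=
      ae_restrict_of_ae (measure_eq_zero_iff_ae_notMem.1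
        (Measure.addHaar_sphere volume (0 : ℂ) 1))
    have hzero : ∀ᵐ x ∂(volume.restrict unitDisk : Measure ℂ), x ≠ 0 :=
      ae_restrict_of_ae (Measure.ae_ne volume 0)
    filter_upwards [hsph, hzero, ae_restrict_mem measurableSet_closedBall] with x e1 e2 e3
    rw [(isEigen_iff hR h lam e).1 he x (norm_pos_iff.2 e2)
      (lt_of_le_of_ne (by simpa using e3) (by simpa using e1)), mul_assoc]
  rw [h2] at h1
  have h3 : ((lam : ℂ) - eigval i) * ∫ x in unitDisk, pullD κ R e x * cbasis i x = 0 := by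
    rw [eigval]
    push_cast
    linear_combination h1
  rw [coef_smooth hR h, (mul_eq_zero.1 h3).resolve_left, mul_zero]
  rw [← Complex.ofReal_sub]
  exact_mod_cast sub_ne_zero.2 hi.symm

/-- Testing on the basis suffices: an arbitrary eigenfunction has nonzero coefficients only at
indices with its own eigenvalue, where the multiplier is the same. -/
theorem isPow_iff (hR : 0 < R) (h : R ^ 2 * |κ| < 1) {a : ℝ} {f g : ℂ → ℂ}
    (hf : MemLp f 2 (wvol κ R)) (hg : MemLp g 2 (wvol κ R)) :
    IsPow κ R a f g ↔ ∀ i, coef κ R g i = ((eigval i ^ a : ℝ) : ℂ) * coef κ R f i := by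
  refine ⟨fun H i => H _ _ (isEigen_basis hR h i), fun H lam e he => ?_⟩
  rw [pair_eq_tsum hR h hf (SmoothM.memLp hR h e), pair_eq_tsum hR h hg (SmoothM.memLp hR h e), ← tsum_mul_left]
  refine tsum_congr fun i => ?_
  by_cases hi : eigval i = lam
  · rw [H i, hi]
    ring
  · rw [he.coef_eq_zero hR h hi]
    ring

theorem hasSpectralResolution (hR : 0 < R) (h : R ^ 2 * |κ| < 1) : HasSpectralResolution κ R := by
  refine ⟨fun lam e he h0 => ?_, fun g hg H => ?_⟩
  · by_contra hlam
    refine h0 (SmoothM.ext_coef hR h fun i => ?_)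
    rw [he.coef_eq_zero hR h fun hi => hlam (hi ▸ eigval_pos i)]
    simp [coef, pair]
  · refine ae_eq_of_coef_eq hR h hg MemLp.zero fun i => ?_
    have h1 : coef κ R g i = 0 := H _ _ (isEigen_basis hR h i)
    rw [h1]
    simp [coef, pair]

/-! ### The Hilbert scale -/

/-- Polynomial growth. -/
def PolyGrowth (m : ℕ × ℕ → ℂ) : Prop := ∃ (K : ℝ) (k : ℕ), ∀ i, ‖m i‖ ≤ K * ((deg i : ℝ) + 1) ^ k

theorem PolyGrowth.rapidDecay_mul {m a : ℕ × ℕ → ℂ} (hm : PolyGrowth m) (ha : RapidDecay a) :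
    RapidDecay fun i => m i * a i := by
  obtain ⟨K, k, hK⟩ := hm
  exact ha.mul_of_le k K hK

/-- A square-summable sequence is bounded: `‖b‖ ≤ 1 + ‖b‖²`. The real exponent is replaced by a
natural number above `|s|`. -/
theorem polyGrowth_mul_rpow {b : ℕ × ℕ → ℂ} (hb : Summable fun i => ‖b i‖ ^ 2) (s : ℝ) :
    PolyGrowth fun i => b i * ((((deg i : ℝ) + 1) ^ s : ℝ) : ℂ) := by
  refine ⟨1 + ∑' i, ‖b i‖ ^ 2, ⌈|s|⌉₊, fun i => ?_⟩
  have h1 : ‖b i‖ ^ 2 ≤ ∑' i, ‖b i‖ ^ 2 := hb.le_tsum i fun _ _ => by positivity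
  have h2 : ((deg i : ℝ) + 1) ^ s ≤ ((deg i : ℝ) + 1) ^ ⌈|s|⌉₊ := by
    rw [← Real.rpow_natCast]
    exact Real.rpow_le_rpow_of_exponent_le (one_le_deg_add_one i)
      ((le_abs_self s).trans (Nat.le_ceil _))
  rw [norm_mul, Complex.norm_real, Real.norm_of_nonneg (by positivity)]
  exact mul_le_mul (by nlinarith [sq_nonneg (‖b i‖ - 1), sq_nonneg ‖b i‖]) h2 (by positivity)
    (by positivity)

theorem coef_add (hR : 0 < R) (h : R ^ 2 * |κ| < 1) {f g : ℂ → ℂ} (hf : MemLp f 2 (wvol κ R))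
    (hg : MemLp g 2 (wvol κ R)) (i : ℕ × ℕ) :
    coef κ R (f + g) i = coef κ R f i + coef κ R g i := by
  have he := memLp_basisM hR h i
  have h1 := integral_add (hf.integrable_mul he) (hg.integrable_mul he)
  simp only [Pi.mul_apply, ← add_mul] at h1
  exact h1

theorem coef_smul (c : ℂ) (f : ℂ → ℂ) (i : ℕ × ℕ) : coef κ R (c • f) i = c * coef κ R f i := by
  rw [coef, coef, pair, pair, ← integral_const_mul]
  simp only [Pi.smul_apply, smul_eq_mul, mul_assoc]

theorem coef_smooth_add (hR : 0 < R) (h : R ^ 2 * |κ| < 1) (φ ψ : SmoothM R) (i : ℕ × ℕ) :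
    coef κ R (φ + ψ : SmoothM R) i = coef κ R φ i + coef κ R ψ i :=
  coef_add hR h (SmoothM.memLp hR h φ) (SmoothM.memLp hR h ψ) i

theorem coef_smooth_smul (c : ℂ) (φ : SmoothM R) (i : ℕ × ℕ) :
    coef κ R (c • φ : SmoothM R) i = c * coef κ R φ i := coef_smul c φ i

theorem PolyGrowth.summable (hR : 0 < R) (h : R ^ 2 * |κ| < 1) {m : ℕ × ℕ → ℂ} (hm : PolyGrowth m)
    (φ : SmoothM R) : Summable fun i => m i * coef κ R φ i := by
  have h1 := (hm.rapidDecay_mul (rapidDecay_coef hR h φ)).summable 0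
  simp only [pow_zero, mul_one] at h1
  exact h1.of_norm

/-- The functional with a given sequence of coefficients. -/
def functional (hR : 0 < R) (h : R ^ 2 * |κ| < 1) {m : ℕ × ℕ → ℂ} (hm : PolyGrowth m) : Distr R where
  toFun φ := ∑' i, m i * coef κ R φ i
  map_add' φ ψ := by
    rw [← (hm.summable hR h φ).tsum_add (hm.summable hR h ψ)]
    simp only [coef_smooth_add hR h, mul_add]
  map_smul' c φ := by
    rw [RingHom.id_apply, smul_eq_mul, ← tsum_mul_left]
    simp only [coef_smooth_smul, mul_left_comm]

theorem functional_apply (hR : 0 < R) (h : R ^ 2 * |κ| < 1) {m : ℕ × ℕ → ℂ} (hm : PolyGrowth m)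
    (φ : SmoothM R) : functional hR h hm φ = ∑' i, m i * coef κ R φ i := rfl

/-- One description for both signs of `s`: the coefficients of the functional are `(deg + 1)^(-s)`
times a square-summable sequence, since `eigval^(s/2) = (deg + 1)^s`. -/
theorem mem_Hscale_iff (hR : 0 < R) (h : R ^ 2 * |κ| < 1) (s : ℝ) (u : Distr R) :
    u ∈ Hscale κ R s ↔ ∃ b : ℕ × ℕ → ℂ, (Summable fun i => ‖b i‖ ^ 2) ∧
      ∀ φ : SmoothM R, u φ = ∑' i, b i * ((((deg i : ℝ) + 1) ^ (-s) : ℝ) : ℂ) * coef κ R φ i := by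
  have hC := normConst_ne_zero hR h
  have hdeg : ∀ i, (0 : ℝ) < (deg i : ℝ) + 1 := fun i => by positivity
  have hcancel : ∀ i, (((((deg i : ℝ) + 1) ^ (-s) : ℝ) : ℂ)) *
      ((((deg i : ℝ) + 1) ^ s : ℝ) : ℂ) = 1 := fun i => by
    rw [← Complex.ofReal_mul, ← Real.rpow_add (hdeg i), neg_add_cancel, Real.rpow_zero,
      Complex.ofReal_one]
  have hscale : ∀ {b : ℕ × ℕ → ℂ} (c : ℂ), (Summable fun i => ‖b i‖ ^ 2) →
      Summable fun i => ‖c * b i‖ ^ 2 := fun c hb => by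
    simp only [norm_mul, mul_pow]
    exact hb.mul_left _
  constructor
  · rintro (⟨_, f, g, hf, hg, hpow, hrep⟩ | ⟨_, g, hg, hu⟩)
    · refine ⟨fun i => (normConst κ R : ℂ)⁻¹ * coef κ R g i, hscale _ (summable_coef hR h hg),
        fun φ => ?_⟩
      rw [hrep φ, pair_eq_tsum hR h hf (SmoothM.memLp hR h φ)]
      refine tsum_congr fun i => ?_
      simp only
      rw [(isPow_iff hR h hf hg).1 hpow i, eigval_rpow]
      linear_combination -(normConst κ R : ℂ)⁻¹ * coef κ R f i * coef κ R φ i * hcancel i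
    · refine ⟨fun i => (normConst κ R : ℂ)⁻¹ * coef κ R g i, hscale _ (summable_coef hR h hg),
        fun φ => ?_⟩
      have hgrow : PolyGrowth fun i => ((((deg i : ℝ) + 1) ^ (-s) : ℝ) : ℂ) := by
        refine ⟨1, ⌈|s|⌉₊, fun i => ?_⟩
        rw [Complex.norm_real, Real.norm_of_nonneg (by positivity), one_mul, ← Real.rpow_natCast]
        exact Real.rpow_le_rpow_of_exponent_le (one_le_deg_add_one i)
          ((neg_le_abs s).trans (Nat.le_ceil _))
      -- The condition for `s < 0` speaks of every `ψ` representing `𝓛^(-s/2) φ`; a smooth one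
      -- exists because the multiplier has polynomial growth.
      obtain ⟨ψ, hψ⟩ := exists_smooth_coef_eq hR h
        (hgrow.rapidDecay_mul (rapidDecay_coef hR h φ))
      have hψm := SmoothM.memLp hR h ψ
      rw [hu φ ψ hψm ((isPow_iff hR h (SmoothM.memLp hR h φ) hψm).2 fun i => by
        rw [hψ, eigval_rpow]), pair_eq_tsum hR h hg hψm]
      refine tsum_congr fun i => ?_
      rw [hψ]
      ring
  · rintro ⟨b, hb, hu⟩
    obtain ⟨g, hg, hgb⟩ := exists_coef_eq hR h (hscale (normConst κ R : ℂ) hb)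
    rcases le_or_gt 0 s with hs | hs
    -- For `s ≥ 0` the functional must be a function in `L²`, which holds as `(deg + 1)^(-s) ≤ 1`.
    · have hb' : Summable fun i => ‖(normConst κ R : ℂ) *
          (b i * ((((deg i : ℝ) + 1) ^ (-s) : ℝ) : ℂ))‖ ^ 2 := by
        refine hscale _ (hb.of_nonneg_of_le (fun i => by positivity) fun i => ?_)
        rw [norm_mul, Complex.norm_real, Real.norm_of_nonneg (Real.rpow_nonneg (hdeg i).le _)]
        have h1 : ((deg i : ℝ) + 1) ^ (-s) ≤ 1 :=
          Real.rpow_le_one_of_one_le_of_nonpos (one_le_deg_add_one i) (by linarith)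
        gcongr
        exact mul_le_of_le_one_right (norm_nonneg _) h1
      obtain ⟨f, hf, hfb⟩ := exists_coef_eq hR h hb'
      refine Or.inl ⟨hs, f, g, hf, hg, (isPow_iff hR h hf hg).2 fun i => ?_, fun φ => ?_⟩
      · rw [hgb, hfb, eigval_rpow]
        linear_combination -(normConst κ R : ℂ) * b i * hcancel i
      · rw [hu φ, pair_eq_tsum hR h hf (SmoothM.memLp hR h φ)]
        refine tsum_congr fun i => ?_
        rw [hfb, inv_mul_cancel_left₀ hC]
    · refine Or.inr ⟨hs, g, hg, fun φ ψ hψ hpow => ?_⟩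
      rw [hu φ, pair_eq_tsum hR h hg hψ]
      refine tsum_congr fun i => ?_
      rw [hgb, (isPow_iff hR h (SmoothM.memLp hR h φ) hψ).1 hpow i, eigval_rpow,
        inv_mul_cancel_left₀ hC, mul_assoc]

/-! ### The normal operator on smooth functions -/

/-- The multiplier of `I₀* I₀ w` in the eigenbasis. -/
def normalMul (κ R : ℝ) (i : ℕ × ℕ) : ℂ := ((normalConst κ R / (deg i + 1) : ℝ) : ℂ)

theorem normalMul_ne_zero (hR : 0 < R) (h : R ^ 2 * |κ| < 1) (i : ℕ × ℕ) : normalMul κ R i ≠ 0 := by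
  have := normalConst_pos hR h
  have h1 : normalConst κ R / (deg i + 1) ≠ 0 := by positivity
  exact Complex.ofReal_ne_zero.2 h1

theorem polyGrowth_normalMul (hR : 0 < R) (h : R ^ 2 * |κ| < 1) : PolyGrowth (normalMul κ R) := by
  have := normalConst_pos hR h
  refine ⟨normalConst κ R, 0, fun i => ?_⟩
  rw [normalMul, Complex.norm_real, Real.norm_of_nonneg (by positivity), pow_zero, mul_one]
  exact div_le_self this.le (one_le_deg_add_one i)

theorem polyGrowth_inv_normalMul (hR : 0 < R) (h : R ^ 2 * |κ| < 1) :
    PolyGrowth fun i => (normalMul κ R i)⁻¹ := by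
  have := normalConst_pos hR h
  refine ⟨(normalConst κ R)⁻¹, 1, fun i => ?_⟩
  simp only [normalMul]
  rw [norm_inv, Complex.norm_real, Real.norm_of_nonneg (by positivity), inv_div, pow_one,
    div_eq_inv_mul]

/-- Multipliers of polynomial growth preserve rapid decay; linearity follows from uniqueness of the
coefficients. -/
theorem exists_normalSmooth (hR : 0 < R) (h : R ^ 2 * |κ| < 1) :
    ∃ N : SmoothM R →ₗ[ℂ] SmoothM R,
      ∀ φ i, coef κ R (N φ) i = normalMul κ R i * coef κ R φ i := by
  choose N hN using fun φ : SmoothM R => exists_smooth_coef_eq hR h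
    ((polyGrowth_normalMul hR h).rapidDecay_mul (rapidDecay_coef hR h φ))
  refine ⟨⟨⟨N, fun φ ψ => SmoothM.ext_coef hR h fun i => ?_⟩,
    fun c φ => SmoothM.ext_coef hR h fun i => ?_⟩, hN⟩
  · rw [coef_smooth_add hR h, hN, hN, hN, coef_smooth_add hR h, mul_add]
  · rw [RingHom.id_apply, coef_smooth_smul, hN, hN, coef_smooth_smul, mul_left_comm]

theorem IsXrayL2.normalOp_ae_eq (hR : 0 < R) (h : R ^ 2 * |κ| < 1)
    {I₀ : L2M κ R →L[ℂ] L2Bdry κ R} (hI : IsXrayL2 κ R I₀) {F : L2M κ R} {f g : ℂ → ℂ}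
    (hF : F =ᵐ[vol κ R] fun z => weight κ z * f z) (hg : MemLp g 2 (wvol κ R))
    (hc : ∀ i, coef κ R g i = normalMul κ R i * coef κ R f i) : normalOp I₀ F =ᵐ[vol κ R] g := by
  refine (vol_absolutelyContinuous_wvol h).ae_le (ae_eq_of_coef_eq hR h
    ((memLp_vol_iff hR h).1 (Lp.memLp _)) hg fun i => ?_)
  rw [hc]
  exact hI.pair_normalOp hR h hF i

theorem IsXrayL2.isNormalW (hR : 0 < R) (h : R ^ 2 * |κ| < 1)
    {I₀ : L2M κ R →L[ℂ] L2Bdry κ R} (hI : IsXrayL2 κ R I₀) {N : SmoothM R →ₗ[ℂ] SmoothM R}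
    (hN : ∀ φ i, coef κ R (N φ) i = normalMul κ R i * coef κ R φ i) : IsNormalW I₀ N where
  smooth φ := by
    have hF := (memLp_weight_mul hR h (SmoothM.memLp hR h φ)).coeFn_toLp
    exact ⟨_, hF, hI.normalOp_ae_eq hR h hF (SmoothM.memLp hR h (N φ)) (hN φ)⟩
  extends_L2 f hf := by
    have hF := (memLp_weight_mul hR h hf).coeFn_toLp
    have hgrow : PolyGrowth fun i => (normConst κ R : ℂ)⁻¹ * coef κ R f i := by
      have := polyGrowth_mul_rpow (summable_coef hR h hf) 0
      simp only [Real.rpow_zero, Complex.ofReal_one, mul_one] at this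
      obtain ⟨K, k, hK⟩ := this
      refine ⟨‖(normConst κ R : ℂ)⁻¹‖ * K, k, fun i => ?_⟩
      rw [norm_mul, mul_assoc]
      exact mul_le_mul_of_nonneg_left (hK i) (norm_nonneg _)
    have hrep : Represents κ R f (functional hR h hgrow) := fun φ => by
      rw [functional_apply, pair_eq_tsum hR h hf (SmoothM.memLp hR h φ)]
    refine ⟨_, functional hR h hgrow, hF, hrep, fun φ => ?_⟩
    rw [LinearMap.dualMap_apply, hrep, pair_eq_tsum hR h hf (SmoothM.memLp hR h _),
      pair_eq_tsum hR h ((memLp_vol_iff hR h).1 (Lp.memLp _)) (SmoothM.memLp hR h φ)]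
    refine tsum_congr fun i => ?_
    have h1 : coef κ R (normalOp I₀ ((memLp_weight_mul hR h hf).toLp _)) i =
        normalMul κ R i * coef κ R f i := hI.pair_normalOp hR h hF i
    rw [hN, h1]
    ring

/-- The factor `normalConst/(deg + 1)` turns the weight `(deg + 1)^(-s)` into `(deg + 1)^(-(s+1))`;
surjectivity holds because the remaining constant is invertible on square-summable sequences. -/
theorem dualMap_image_Hscale (hR : 0 < R) (h : R ^ 2 * |κ| < 1) {N : SmoothM R →ₗ[ℂ] SmoothM R}
    (hN : ∀ φ i, coef κ R (N φ) i = normalMul κ R i * coef κ R φ i) (s : ℝ) :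
    N.dualMap '' Hscale κ R s = Hscale κ R (s + 1) := by
  have hc : (normalConst κ R : ℂ) ≠ 0 := Complex.ofReal_ne_zero.2 (normalConst_pos hR h).ne'
  have hexp : ∀ i : ℕ × ℕ, ((((deg i : ℝ) + 1) ^ (-s) : ℝ) : ℂ) * normalMul κ R i =
      normalConst κ R * ((((deg i : ℝ) + 1) ^ (-(s + 1)) : ℝ) : ℂ) := fun i => by
    have hd : (0 : ℝ) < (deg i : ℝ) + 1 := by positivity
    rw [normalMul, ← Complex.ofReal_mul, ← Complex.ofReal_mul, neg_add, Real.rpow_add hd,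
      Real.rpow_neg_one]
    congr 1
    ring
  have hscale : ∀ {b : ℕ × ℕ → ℂ} (c : ℂ), (Summable fun i => ‖b i‖ ^ 2) →
      Summable fun i => ‖c * b i‖ ^ 2 := fun c hb => by
    simp only [norm_mul, mul_pow]
    exact hb.mul_left _
  ext v
  constructor
  · rintro ⟨u, hu, rfl⟩
    obtain ⟨b, hb, hub⟩ := (mem_Hscale_iff hR h s u).1 hu
    refine (mem_Hscale_iff hR h _ _).2 ⟨fun i => normalConst κ R * b i, hscale _ hb, fun φ => ?_⟩
    rw [LinearMap.dualMap_apply, hub]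
    refine tsum_congr fun i => ?_
    rw [hN]
    linear_combination b i * coef κ R φ i * hexp i
  · intro hv
    obtain ⟨b, hb, hvb⟩ := (mem_Hscale_iff hR h _ v).1 hv
    have hb' := hscale (normalConst κ R : ℂ)⁻¹ hb
    refine ⟨functional hR h (polyGrowth_mul_rpow hb' (-s)),
      (mem_Hscale_iff hR h s _).2 ⟨_, hb', fun φ => rfl⟩, LinearMap.ext fun φ => ?_⟩
    rw [LinearMap.dualMap_apply, functional_apply, hvb]
    refine tsum_congr fun i => ?_
    rw [hN]
    have h1 := mul_inv_cancel₀ hc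
    linear_combination (normalConst κ R : ℂ)⁻¹ * b i * coef κ R φ i * hexp i +
      b i * ((((deg i : ℝ) + 1) ^ (-(s + 1)) : ℝ) : ℂ) * coef κ R φ i * h1

/-! ### Passage from `I₀* I₀ w` to `I₀* I₀` on smooth functions. -/

theorem exists_smooth_weight_mul (h : R ^ 2 * |κ| < 1) (φ : SmoothM R) :
    ∃ ψ : SmoothM R, ∀ z, ‖z‖ ≤ R → (ψ : ℂ → ℂ) z = weight κ z * (φ : ℂ → ℂ) z :=
  ⟨⟨fun z => weight κ z * (φ : ℂ → ℂ) z,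
    (Complex.ofRealCLM.contDiff.comp_contDiffOn (contDiffOn_weight h)).mul φ.2.1,
    fun z hz => by simp only [φ.2.2 z hz, mul_zero]⟩, fun _ _ => rfl⟩

theorem exists_smooth_div_weight (h : R ^ 2 * |κ| < 1) (φ : SmoothM R) :
    ∃ ψ : SmoothM R, ∀ z, ‖z‖ ≤ R → (φ : ℂ → ℂ) z = weight κ z * (ψ : ℂ → ℂ) z :=
  ⟨⟨fun z => (weight κ z : ℂ)⁻¹ * (φ : ℂ → ℂ) z,
    ((Complex.ofRealCLM.contDiff.comp_contDiffOn (contDiffOn_weight h)).inv fun z hz =>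
      weight_ne_zero h (by simpa using hz)).mul φ.2.1,
    fun z hz => by simp only [φ.2.2 z hz, mul_zero]⟩, fun z hz =>
      (mul_inv_cancel_left₀ (weight_ne_zero h hz) _).symm⟩

/-- The weight is smooth and nowhere zero on `M`, so multiplication by it is a bijection of
`C^∞(M)`. Surjectivity then comes from the inverse multiplier, which grows linearly in the degree
and keeps rapid decay. -/
theorem IsXrayL2.normalOp_image_smoothL2 (hR : 0 < R) (h : R ^ 2 * |κ| < 1)
    {I₀ : L2M κ R →L[ℂ] L2Bdry κ R} (hI : IsXrayL2 κ R I₀) {N : SmoothM R →ₗ[ℂ] SmoothM R}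
    (hN : ∀ φ i, coef κ R (N φ) i = normalMul κ R i * coef κ R φ i) :
    normalOp I₀ '' smoothL2 κ R = smoothL2 κ R := by
  ext G
  constructor
  · rintro ⟨F, ⟨φ, hφ⟩, rfl⟩
    obtain ⟨ψ, hψ⟩ := exists_smooth_div_weight h φ
    refine ⟨N ψ, hI.normalOp_ae_eq hR h ?_ (SmoothM.memLp hR h _) (hN ψ)⟩
    filter_upwards [hφ, ae_vol_mem κ R] with z h1 h2
    rw [h1, hψ z h2]
  · rintro ⟨φ, hφ⟩
    obtain ⟨ψ, hψ⟩ := exists_smooth_coef_eq hR h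
      ((polyGrowth_inv_normalMul hR h).rapidDecay_mul (rapidDecay_coef hR h φ))
    obtain ⟨χ, hχ⟩ := exists_smooth_weight_mul h ψ
    have hF := (memLp_weight_mul hR h (SmoothM.memLp hR h ψ)).coeFn_toLp
    refine ⟨(memLp_weight_mul hR h (SmoothM.memLp hR h ψ)).toLp _, ⟨χ, ?_⟩, Lp.ext ?_⟩
    · filter_upwards [hF, ae_vol_mem κ R] with z h1 h2
      rw [h1, hχ z h2]
    · refine (hI.normalOp_ae_eq hR h hF (SmoothM.memLp hR h φ) fun i => ?_).trans hφ.symm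
      rw [hψ, mul_inv_cancel_left₀ (normalMul_ne_zero hR h i)]

end

end XrayDisk

end

theorem corollary1 (κ R : ℝ) (hR : 0 < R) (hκ : R ^ 2 * |κ| < 1) :
    XrayDisk.HasSpectralResolution κ R ∧
    (∃! I₀ : XrayDisk.L2M κ R →L[ℂ] XrayDisk.L2Bdry κ R, XrayDisk.IsXrayL2 κ R I₀) ∧
    ∀ I₀ : XrayDisk.L2M κ R →L[ℂ] XrayDisk.L2Bdry κ R, XrayDisk.IsXrayL2 κ R I₀ →
      (∃ N : XrayDisk.SmoothM R →ₗ[ℂ] XrayDisk.SmoothM R, XrayDisk.IsNormalW I₀ N ∧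
        ∀ s : ℝ, N.dualMap '' XrayDisk.Hscale κ R s = XrayDisk.Hscale κ R (s + 1)) ∧
      XrayDisk.normalOp I₀ '' XrayDisk.smoothL2 κ R = XrayDisk.smoothL2 κ R := by
  obtain ⟨N, hN⟩ := XrayDisk.exists_normalSmooth hR hκ
  obtain ⟨I, hI⟩ := XrayDisk.exists_isXrayL2 hR hκ
  exact ⟨XrayDisk.hasSpectralResolution hR hκ, ⟨I, hI, fun _ hJ => hJ.unique hR hκ hI⟩,
    fun _ hJ => ⟨⟨N, hJ.isNormalW hR hκ hN, XrayDisk.dualMap_image_Hscale hR hκ hN⟩,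
      hJ.normalOp_image_smoothL2 hR hκ hN⟩⟩
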